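/- Let $V^\perp:\mathbb R^2\to\mathbb R$ be measurable, locally bounded, polynomially bounded at infinity, with $V^\perp(x^\perp)\to\infty$ as $|x^\perp|\to\infty$. Let $s\in(0,\infty]$ and $V(z)=|z|^s$ on $\mathbb R$, where $s=\infty$ means the hard-wall box, $V=0$ on $[-1,1]$ and $V=\infty$ outside. Let $$e^\perp=\inf\Big\{\int_{\mathbb R^2}\big(|\nabla\psi|^2+V^\perp|\psi|^2\big)\,:\,\psi\in H^1(\mathbb R^2;\mathbb C),\ V^\perp|\psi|^2\in L^1,\ \int|\psi|^2=1\Big\}$$ be the ground state energy of $-\Delta^\perp+V^\perp$, and let $b\ge 0$, $\int b^2=1$, be its ground state wave function (the minimizer). For $r,a>0$ put $V^\perp_r(x^\perp)=r^{-2}V^\perp(x^\perp/r)$, $b_r(x^\perp)=r^{-1}b(x^\perp/r)$ and $$g=g(r,a)=8\pi a\int_{\mathbb R^2}|b_r(x^\perp)|^4\,d^2x^\perp .$$ Define the one-dimensional Gross–Pitaevskii energy $$E^{\rm GP}(1,1,g)=\inf\Big\{\int_{\mathbb R}\Big(|\nabla\sqrt{\rho}|^2+V\rho+\tfrac12 g\rho^2\Big)dz\,:\,\rho\ge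 0,\ \int_{\mathbb R}\rho=1\Big\}$$ and, with $x=(x^\perp,z)\in\mathbb R^3$, the three-dimensional Gross–Pitaevskii energy $$E^{\rm GP}_{\rm 3D}(1,1,r,a)=\inf\Big\{\int_{\mathbb R^3}\Big(|\nabla\Phi|^2+\{V_r^\perp(x^\perp)+V(z)\}|\Phi|^2+4\pi a|\Phi|^4\Big)d^3x\,:\,\int_{\mathbb R^3}|\Phi|^2=1\Big\},$$ the infima being over functions of finite energy (with weak gradients in $L^2$, $\Phi$ complex-valued). Then $$\frac{E^{\rm GP}_{\rm 3D}(1,1,r,a)-e^\perp/r^2}{E^{\rm GP}(1,1,g)}\longrightarrow 1\qquad\text{as } r\to0,\ a\to0,$$ uniformly in $g$ as long as $r^2E^{\rm GP}(1,1,g)\to0$; that is, for every $\varepsilon>0$ there is $\delta>0$ (depending only on $\varepsilon$, $V^\perp$ and $s$) such that for all $r,a\in(0,\delta)$ with $r^2E^{\rm GP}(1,1,g(r,a))<\delta$, $$\left|\frac{E^{\rm GP}_{\rm 3D}(1,1,r,a)-e^\perp/r^2}{E^{\rm GP}(1,1,g(r,a))}-1\right|<\varepsilon .$$ -/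

import Mathlib

open MeasureTheory Filter Topology
open scoped ENNReal ContDiff

/-- The transverse plane `ℝ²`, with variable `x^⊥`. -/
abbrev Plane : Type := EuclideanSpace ℝ (Fin 2)

/-- Three-dimensional space, split as `x = (x^⊥, z)`; its volume is Lebesgue measure on `ℝ³`. -/
abbrev Space : Type := Plane × ℝ

/-- `f'` is the weak (distributional) derivative of `f` in the direction `v`. -/
def HasWeakDeriv {E F : Type*} [NormedAddCommGroup E] [NormedSpace ℝ E] [MeasureSpace E]
    [NormedAddCommGroup F] [NormedSpace ℝ F] (v : E) (f f' : E → F) : Prop :=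
  LocallyIntegrable f ∧ LocallyIntegrable f' ∧
    ∀ η : E → ℝ, ContDiff ℝ ∞ η → HasCompactSupport η →
      ∫ x, (fderiv ℝ η x v) • f x = -∫ x, η x • f' x

/-- The longitudinal potential `V(z) = |z|^s`, homogeneous of order `s`; for `s = ∞` it is the box
with hard walls, `V = 0` on `[-1,1]` and `V = ∞` outside. -/
noncomputable def longPot (s : ℝ≥0∞) (z : ℝ) : ℝ≥0∞ :=
  if s = ⊤ then (if |z| ≤ 1 then 0 else ⊤) else ENNReal.ofReal (|z| ^ s.toReal)

/-- The scaled longitudinal potential `V_L(z) = L⁻² V(z/L)`. -/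
noncomputable def longPotScaled (s : ℝ≥0∞) (L z : ℝ) : ℝ≥0∞ :=
  ENNReal.ofReal (1 / L ^ 2) * longPot s (z / L)

/-- A transverse trap potential: (measurable and) locally bounded, tending to `∞` at infinity,
and polynomially bounded at infinity. -/
structure IsTransverseTrap (W : Plane → ℝ) : Prop where
  measurable : Measurable W
  locallyBounded : ∀ R : ℝ, ∃ C : ℝ, ∀ x : Plane, ‖x‖ ≤ R → |W x| ≤ C
  tendsto_atTop : Tendsto W (cocompact Plane) atTop
  polynomiallyBounded : ∃ (C : ℝ) (k : ℕ), ∀ᶠ x in cocompact Plane, |W x| ≤ C * ‖x‖ ^ k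

/-- The scaled transverse potential `V^⊥_r(x^⊥) = r⁻² V^⊥(x^⊥/r)`. -/
noncomputable def transScaled (W : Plane → ℝ) (r : ℝ) (x : Plane) : ℝ :=
  1 / r ^ 2 * W ((1 / r) • x)

/-- `ψ` is normalized, lies in the form domain of `-Δ^⊥ + W`, and has the weak gradient `G`. -/
structure TransAdmissible {F : Type*} [NormedAddCommGroup F] [NormedSpace ℝ F]
    (W : Plane → ℝ) (ψ : Plane → F) (G : Fin 2 → Plane → F) : Prop where
  memLp : MemLp ψ 2
  grad_memLp : ∀ i, MemLp (G i) 2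
  weakGrad : ∀ i, HasWeakDeriv (EuclideanSpace.single i (1 : ℝ)) ψ (G i)
  potential : Integrable fun x => W x * ‖ψ x‖ ^ 2
  normalized : ∫ x, ‖ψ x‖ ^ 2 = 1

/-- The quadratic form of `-Δ^⊥ + W` at a function `ψ` with gradient `G`. -/
noncomputable def transEnergy {F : Type*} [NormedAddCommGroup F]
    (W : Plane → ℝ) (ψ : Plane → F) (G : Fin 2 → Plane → F) : ℝ :=
  ∫ x, ((∑ i, ‖G i x‖ ^ 2) + W x * ‖ψ x‖ ^ 2)

/-- The ground state energy `e^⊥` of `-Δ^⊥ + W`. -/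
noncomputable def ePerp (W : Plane → ℝ) : ℝ :=
  sInf {e | ∃ (ψ : Plane → ℂ) (G : Fin 2 → Plane → ℂ),
    TransAdmissible W ψ G ∧ transEnergy W ψ G = e}

/-- `b` is the normalized nonnegative ground state wave function of `-Δ^⊥ + W`. -/
def IsTransGroundState (W : Plane → ℝ) (b : Plane → ℝ) : Prop :=
  (∀ᵐ x, 0 ≤ b x) ∧
    ∃ G : Fin 2 → Plane → ℝ, TransAdmissible W b G ∧ transEnergy W b G = ePerp W

/-- The scaled ground state `b_r(x^⊥) = (1/r) b(x^⊥/r)`. -/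
noncomputable def bScaled (b : Plane → ℝ) (r : ℝ) (x : Plane) : ℝ :=
  1 / r * b ((1 / r) • x)

/-- The one-dimensional coupling constant `g = 8πa ∫ |b_r|⁴`. -/
noncomputable def coupling (b : Plane → ℝ) (r a : ℝ) : ℝ :=
  8 * Real.pi * a * ∫ x, |bScaled b r x| ^ 4

/-- `ρ ≥ 0` is a density of total mass `N` with finite one-dimensional Gross-Pitaevskii energy, and
`w` is the weak derivative of `√ρ`. -/
structure GPAdmissible (s : ℝ≥0∞) (N L : ℝ) (ρ w : ℝ → ℝ) : Prop where
  nonneg : ∀ᵐ z, 0 ≤ ρ z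
  integrable : Integrable ρ
  mass : ∫ z, ρ z = N
  weakDeriv : HasWeakDeriv (1 : ℝ) (fun z => √(ρ z)) w
  deriv_memLp : MemLp w 2
  potential : ∫⁻ z, longPotScaled s L z * ENNReal.ofReal (ρ z) ≠ ⊤
  sq_integrable : Integrable fun z => ρ z ^ 2

/-- The one-dimensional Gross-Pitaevskii energy `∫ (|∇√ρ|² + V_L ρ + (g/2) ρ²)`, where `w` is the
derivative of `√ρ`. -/
noncomputable def gpEnergy (s : ℝ≥0∞) (L g : ℝ) (ρ w : ℝ → ℝ) : ℝ :=
  (∫ z, w z ^ 2) + (∫⁻ z, longPotScaled s L z * ENNReal.ofReal (ρ z)).toReal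
    + 1 / 2 * g * ∫ z, ρ z ^ 2

/-- The one-dimensional Gross-Pitaevskii ground state energy `E^GP(N,L,g)`. -/
noncomputable def EGP (s : ℝ≥0∞) (N L g : ℝ) : ℝ :=
  sInf {e | ∃ ρ w : ℝ → ℝ, GPAdmissible s N L ρ w ∧ gpEnergy s L g ρ w = e}

/-- `Φ` has `∫ |Φ|² = N` and finite three-dimensional Gross-Pitaevskii energy, and its weak gradient
has transverse components `G` and longitudinal component `H`. -/
structure GP3DAdmissible (W : Plane → ℝ) (s : ℝ≥0∞) (N L r : ℝ)
    (Φ : Space → ℂ) (G : Fin 2 → Space → ℂ) (H : Space → ℂ) : Prop where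
  memLp : MemLp Φ 2
  normalized : ∫ x, ‖Φ x‖ ^ 2 = N
  weakGradPerp : ∀ i, HasWeakDeriv ((EuclideanSpace.single i (1 : ℝ), 0) : Space) Φ (G i)
  weakGradZ : HasWeakDeriv ((0, 1) : Space) Φ H
  gradPerp_memLp : ∀ i, MemLp (G i) 2
  gradZ_memLp : MemLp H 2
  potentialPerp : Integrable fun x : Space => transScaled W r x.1 * ‖Φ x‖ ^ 2
  potentialZ : ∫⁻ x : Space, longPotScaled s L x.2 * ENNReal.ofReal (‖Φ x‖ ^ 2) ≠ ⊤
  quartic : Integrable fun x => ‖Φ x‖ ^ 4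

/-- The three-dimensional Gross-Pitaevskii energy
`∫ (|∇Φ|² + (V^⊥_r + V_L) |Φ|² + 4πa |Φ|⁴)`, where `G`, `H` are the components of `∇Φ`. -/
noncomputable def gp3DEnergy (W : Plane → ℝ) (s : ℝ≥0∞) (L r a : ℝ)
    (Φ : Space → ℂ) (G : Fin 2 → Space → ℂ) (H : Space → ℂ) : ℝ :=
  (∫ x, ((∑ i, ‖G i x‖ ^ 2) + ‖H x‖ ^ 2))
    + (∫ x : Space, transScaled W r x.1 * ‖Φ x‖ ^ 2)
    + (∫⁻ x : Space, longPotScaled s L x.2 * ENNReal.ofReal (‖Φ x‖ ^ 2)).toReal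
    + 4 * Real.pi * a * ∫ x, ‖Φ x‖ ^ 4

/-- The three-dimensional Gross-Pitaevskii ground state energy `E^GP_3D(N,L,r,a)`. -/
noncomputable def EGP3D (W : Plane → ℝ) (s : ℝ≥0∞) (N L r a : ℝ) : ℝ :=
  sInf {e | ∃ (Φ : Space → ℂ) (G : Fin 2 → Space → ℂ) (H : Space → ℂ),
    GP3DAdmissible W s N L r Φ G H ∧ gp3DEnergy W s L r a Φ G H = e}

/-! Write `E = E^GP(1,1,g)`. The theorem follows from two bounds: `E3D ≤ e^⊥/r² + E`, and `E3D ≥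
e^⊥/r² + (1 - 2η) E` for every fixed `η`, once `r² E` is small enough depending on `η`.

The upper bound is exact on product functions. In `b_r(x^⊥) √ρ(z)` the transverse part contributes
`e^⊥/r²` and the quartic term becomes `(g/2) ∫ ρ²` by the choice of `g` (`exists_product_trial`).

For the lower bound, `Φ` is replaced by `P = |Φ|`, which does not raise the energy, and every slice
is split as `P(·,z) = f(z) b_r + q`, where `f(z)` is the overlap with `b_r`. Let `X` be the
transverse energy above `e^⊥/r²`, integrated over `z`. Two consequences of the spectral gap make `q`
cheap (`exists_scaled_transverse_bound`): the lost mass `1 - ∫ f²` is at most `r² X/κ`, and `κ ∫∫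
b_r² q² ≤ X`. The second one also uses the Ladyzhenskaya inequality in the plane and is invariant
under the scaling.

The quartic term is bounded below by tangents. For any `t ≥ 0`, `P⁴ ≥ 2 t b_r² P² - t² b_r⁴`, which
needs only a lower bound on `P²`. The choice `t = min (f²) M` with `M = 2E/g` keeps the error in `q`
bounded by a multiple of `M X` without a supremum bound on `f` (`integral_pow_four_ge`). The
resulting one-dimensional functional, with `f⁴` continued linearly where `f² > M`, still dominates
`(∫ f²)² E`: the one-dimensional variational principle is applied to `min f √M`, and the linear part
pays exactly `2E` per unit of truncated mass (`sq_mass_mul_EGP_le_truncated`). All errors have the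
form `(constant) · r² E · X`, and are absorbed by the term `X` itself.

The gap (`exists_gap`) is a compactness argument. Mollification gives Rellich's theorem for tight
sequences, and `W → ∞` gives tightness, so normalized functions orthogonal to `b` whose energies
approach `e^⊥` would converge to a second ground state. Uniqueness of the ground state rests on
strict positivity of nonnegative null vectors `u` of the form (`ae_pos_of_excess_eq_zero`). The
truncations `min φ (n u)` have bounded energy and converge to `φ` times the indicator of `{u > 0}`,
so this indicator has zero weak gradient and is constant. -/

set_option linter.unusedSectionVars false

/-! ### Cauchy-Schwarz, Fatou and convergence in `L²`. -/

section SquareIntegrable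

variable {α : Type*} [MeasurableSpace α] {μ : Measure α} {F : Type*} [NormedAddCommGroup F]

theorem integral_comb_two {f g : α → ℝ} (a b : ℝ) (hf : Integrable f μ) (hg : Integrable g μ) :
    ∫ x, (a * f x + b * g x) ∂μ = a * (∫ x, f x ∂μ) + b * ∫ x, g x ∂μ := by
  rw [integral_add (hf.const_mul a) (hg.const_mul b), integral_const_mul, integral_const_mul]

theorem integrable_comb_two {f g : α → ℝ} (a b : ℝ) (hf : Integrable f μ) (hg : Integrable g μ) :
    Integrable (fun x => a * f x + b * g x) μ :=
  (hf.const_mul a).add (hg.const_mul b)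

theorem integral_comb_three {f g h : α → ℝ} (a b c : ℝ) (hf : Integrable f μ)
    (hg : Integrable g μ) (hh : Integrable h μ) :
    ∫ x, (a * f x + b * g x + c * h x) ∂μ
      = a * (∫ x, f x ∂μ) + b * (∫ x, g x ∂μ) + c * ∫ x, h x ∂μ := by
  rw [integral_add (integrable_comb_two a b hf hg) (hh.const_mul c), integral_comb_two a b hf hg,
    integral_const_mul]

theorem integrable_comb_three {f g h : α → ℝ} (a b c : ℝ) (hf : Integrable f μ)
    (hg : Integrable g μ) (hh : Integrable h μ) :
    Integrable (fun x => a * f x + b * g x + c * h x) μ :=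
  (integrable_comb_two a b hf hg).add (hh.const_mul c)

theorem MeasureTheory.MemLp.integrable_normSq {f : α → F} (hf : MemLp f 2 μ) :
    Integrable (fun x => ‖f x‖ ^ 2) μ :=
  (memLp_two_iff_integrable_sq_norm hf.1).1 hf

theorem MeasureTheory.MemLp.integrable_sq_real {f : α → ℝ} (hf : MemLp f 2 μ) :
    Integrable (fun x => f x ^ 2) μ :=
  (memLp_two_iff_integrable_sq hf.1).1 hf

theorem MeasureTheory.MemLp.integrable_norm_mul_norm {F' : Type*} [NormedAddCommGroup F']
    {f : α → F} {g : α → F'} (hf : MemLp f 2 μ) (hg : MemLp g 2 μ) :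
    Integrable (fun x => ‖f x‖ * ‖g x‖) μ :=
  hf.norm.integrable_mul hg.norm

theorem MeasureTheory.MemLp.integrable_mul_real {f g : α → ℝ} (hf : MemLp f 2 μ)
    (hg : MemLp g 2 μ) : Integrable (fun x => f x * g x) μ :=
  hf.integrable_mul hg

/-- The Cauchy-Schwarz inequality for integrals of products. -/
theorem sq_integral_mul_le {f g : α → ℝ} (hf : MemLp f 2 μ) (hg : MemLp g 2 μ) :
    (∫ x, f x * g x ∂μ) ^ 2 ≤ (∫ x, f x ^ 2 ∂μ) * ∫ x, g x ^ 2 ∂μ := by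
  have hf2 := hf.integrable_sq_real
  have hg2 := hg.integrable_sq_real
  have hfg := hf.integrable_mul_real hg
  have key : ∀ t : ℝ, 0 ≤ (∫ x, g x ^ 2 ∂μ) * (t * t) + (2 * ∫ x, f x * g x ∂μ) * t
      + ∫ x, f x ^ 2 ∂μ := by
    intro t
    have h : 0 ≤ ∫ x, (f x + t * g x) ^ 2 ∂μ := integral_nonneg fun x => sq_nonneg _
    have e : ∫ x, (f x + t * g x) ^ 2 ∂μ
        = ∫ x, (1 * f x ^ 2 + (2 * t) * (f x * g x) + t ^ 2 * g x ^ 2) ∂μ :=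
      integral_congr_ae (Eventually.of_forall fun x => by ring)
    rw [e, integral_comb_three _ _ _ hf2 hfg hg2] at h
    linarith
  have := discrim_le_zero key
  rw [discrim] at this
  nlinarith

theorem sq_integral_norm_mul_le {F' : Type*} [NormedAddCommGroup F'] {f : α → F} {g : α → F'}
    (hf : MemLp f 2 μ) (hg : MemLp g 2 μ) :
    (∫ x, ‖f x‖ * ‖g x‖ ∂μ) ^ 2 ≤ (∫ x, ‖f x‖ ^ 2 ∂μ) * ∫ x, ‖g x‖ ^ 2 ∂μ :=
  sq_integral_mul_le hf.norm hg.norm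

theorem integral_normSq_add_le {f g : α → F} (hf : MemLp f 2 μ) (hg : MemLp g 2 μ) :
    ∫ x, ‖f x + g x‖ ^ 2 ∂μ ≤ 2 * (∫ x, ‖f x‖ ^ 2 ∂μ) + 2 * ∫ x, ‖g x‖ ^ 2 ∂μ := by
  rw [← integral_const_mul, ← integral_const_mul,
    ← integral_add (hf.integrable_normSq.const_mul _) (hg.integrable_normSq.const_mul _)]
  refine integral_mono (hf.add hg).integrable_normSq
    ((hf.integrable_normSq.const_mul _).add (hg.integrable_normSq.const_mul _)) fun x => ?_
  have h := norm_add_le (f x) (g x)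
  have h0 := norm_nonneg (f x + g x)
  show ‖f x + g x‖ ^ 2 ≤ 2 * ‖f x‖ ^ 2 + 2 * ‖g x‖ ^ 2
  nlinarith [sq_nonneg (‖f x‖ - ‖g x‖)]

/-- Fatou's lemma for real valued nonnegative functions with bounded integrals. -/
theorem integrable_and_integral_le_of_ae_tendsto {g : ℕ → α → ℝ} {G : α → ℝ} {C : ℝ}
    (hg : ∀ n, Integrable (g n) μ) (h0 : ∀ n x, 0 ≤ g n x)
    (hlim : ∀ᵐ x ∂μ, Tendsto (fun n => g n x) atTop (𝓝 (G x))) (hC : ∀ n, ∫ x, g n x ∂μ ≤ C) :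
    Integrable G μ ∧ ∫ x, G x ∂μ ≤ C := by
  have hC0 : 0 ≤ C := (integral_nonneg (h0 0)).trans (hC 0)
  have hGm : AEStronglyMeasurable G μ :=
    aestronglyMeasurable_of_tendsto_ae atTop (fun n => (hg n).1) hlim
  have hG0 : 0 ≤ᵐ[μ] G := by
    filter_upwards [hlim] with x hx using ge_of_tendsto' hx fun n => h0 n x
  have hb : ∫⁻ x, ENNReal.ofReal (G x) ∂μ ≤ ENNReal.ofReal C := by
    calc ∫⁻ x, ENNReal.ofReal (G x) ∂μ
        = ∫⁻ x, liminf (fun n => ENNReal.ofReal (g n x)) atTop ∂μ := by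
          refine lintegral_congr_ae ?_
          filter_upwards [hlim] with x hx
          exact ((ENNReal.continuous_ofReal.tendsto _).comp hx).liminf_eq.symm
      _ ≤ liminf (fun n => ∫⁻ x, ENNReal.ofReal (g n x) ∂μ) atTop :=
          lintegral_liminf_le' fun n => (hg n).1.aemeasurable.ennreal_ofReal
      _ ≤ ENNReal.ofReal C := by
          refine liminf_le_of_le (by isBoundedDefault) fun b hb => ?_
          obtain ⟨n, hn⟩ := hb.exists
          refine hn.trans ?_
          rw [← ofReal_integral_eq_lintegral_ofReal (hg n) (Eventually.of_forall (h0 n))]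
          exact ENNReal.ofReal_le_ofReal (hC n)
  have hGi : Integrable G μ := by
    refine ⟨hGm, ?_⟩
    rw [hasFiniteIntegral_iff_ofReal hG0]
    exact hb.trans_lt ENNReal.ofReal_lt_top
  refine ⟨hGi, ?_⟩
  rw [← ofReal_integral_eq_lintegral_ofReal hGi hG0] at hb
  exact (ENNReal.ofReal_le_ofReal_iff hC0).1 hb

/-- Almost everywhere convergence without loss of norm gives convergence in `L²`. -/
theorem tendsto_integral_normSq_sub_of_ae_tendsto {f : ℕ → α → F} {f₀ : α → F}
    (hf : ∀ n, MemLp (f n) 2 μ) (hf₀ : MemLp f₀ 2 μ)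
    (hlim : ∀ᵐ x ∂μ, Tendsto (fun n => f n x) atTop (𝓝 (f₀ x)))
    (hle : ∀ n, ∫ x, ‖f n x‖ ^ 2 ∂μ ≤ ∫ x, ‖f₀ x‖ ^ 2 ∂μ) :
    Tendsto (fun n => ∫ x, ‖f n x - f₀ x‖ ^ 2 ∂μ) atTop (𝓝 0) := by
  set d := fun n => ∫ x, ‖f n x - f₀ x‖ ^ 2 ∂μ with hd
  have hd0 : ∀ n, 0 ≤ d n := fun n => integral_nonneg fun x => by positivity
  by_contra hcon
  obtain ⟨ε, hε, hfreq⟩ : ∃ ε > 0, ∃ᶠ n in atTop, ε ≤ d n := by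
    by_contra! h
    refine hcon (Metric.tendsto_atTop'.2 fun ε hε => ?_)
    have := h ε hε
    rw [eventually_atTop] at this
    obtain ⟨N, hN⟩ := this
    refine ⟨N, fun n hn => ?_⟩
    rw [Real.dist_eq, sub_zero, abs_of_nonneg (hd0 n)]
    exact hN n hn.le
  obtain ⟨φ, hφ, hφε⟩ := extraction_of_frequently_atTop hfreq
  have hi := fun n => ((hf n).sub hf₀).integrable_normSq
  -- Fatou applied to `2‖f_n‖² + 2‖f₀‖² - ‖f_n - f₀‖² ≥ 0` along a subsequence whose error stays
  -- above `ε`: the limit has integral `4 ∫ ‖f₀‖²`, while the bound is smaller by `ε`.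
  have key := integrable_and_integral_le_of_ae_tendsto (μ := μ)
    (g := fun n x => 2 * ‖f (φ n) x‖ ^ 2 + 2 * ‖f₀ x‖ ^ 2 - ‖f (φ n) x - f₀ x‖ ^ 2)
    (G := fun x => 4 * ‖f₀ x‖ ^ 2) (C := 4 * (∫ x, ‖f₀ x‖ ^ 2 ∂μ) - ε)
    (fun n => (((hf _).integrable_normSq.const_mul 2).add
      (hf₀.integrable_normSq.const_mul 2)).sub (hi _))
    (fun n x => by
      have h := norm_sub_le (f (φ n) x) (f₀ x)
      have h0 := norm_nonneg (f (φ n) x - f₀ x)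
      nlinarith [sq_nonneg (‖f (φ n) x‖ - ‖f₀ x‖)])
    (by
      filter_upwards [hlim] with x hx
      have hx' := hx.comp hφ.tendsto_atTop
      have h1 := (((hx'.norm.pow 2).const_mul 2).add_const (2 * ‖f₀ x‖ ^ 2)).sub
        ((hx'.sub_const (f₀ x)).norm.pow 2)
      have e : 2 * ‖f₀ x‖ ^ 2 + 2 * ‖f₀ x‖ ^ 2 - ‖f₀ x - f₀ x‖ ^ 2 = 4 * ‖f₀ x‖ ^ 2 := by
        rw [sub_self, norm_zero]; ring
      rw [e] at h1
      exact h1)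
    (fun n => by
      have h1 := hφε n
      have h2 := hle (φ n)
      have e : ∫ x, (2 * ‖f (φ n) x‖ ^ 2 + 2 * ‖f₀ x‖ ^ 2 - ‖f (φ n) x - f₀ x‖ ^ 2) ∂μ
          = 2 * (∫ x, ‖f (φ n) x‖ ^ 2 ∂μ) + 2 * (∫ x, ‖f₀ x‖ ^ 2 ∂μ) - d (φ n) := by
        have := integral_comb_three 2 2 (-1) (hf (φ n)).integrable_normSq
          hf₀.integrable_normSq (hi (φ n))
        simp only [Pi.sub_apply, neg_one_mul, ← sub_eq_add_neg] at this
        exact this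
      rw [e]; linarith)
  have := key.2
  rw [integral_const_mul] at this
  linarith

theorem tendsto_integral_mul_of_tendsto_L2 {u : ℕ → α → ℝ} {u₀ v : α → ℝ}
    (hu : ∀ n, MemLp (u n) 2 μ) (hu₀ : MemLp u₀ 2 μ) (hv : MemLp v 2 μ)
    (hlim : Tendsto (fun n => ∫ x, ‖u n x - u₀ x‖ ^ 2 ∂μ) atTop (𝓝 0)) :
    Tendsto (fun n => ∫ x, u n x * v x ∂μ) atTop (𝓝 (∫ x, u₀ x * v x ∂μ)) := by
  rw [tendsto_iff_norm_sub_tendsto_zero]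
  have hb : ∀ n, ‖(∫ x, u n x * v x ∂μ) - ∫ x, u₀ x * v x ∂μ‖
      ≤ √((∫ x, ‖u n x - u₀ x‖ ^ 2 ∂μ) * ∫ x, v x ^ 2 ∂μ) := fun n => by
    rw [← integral_sub ((hu n).integrable_mul_real hv) (hu₀.integrable_mul_real hv)]
    refine Real.le_sqrt_of_sq_le ?_
    have := sq_integral_mul_le ((hu n).sub hu₀) hv
    simpa [sub_mul, Real.norm_eq_abs, sq_abs] using this
  refine squeeze_zero (fun n => norm_nonneg _) hb ?_
  have := (hlim.mul_const (∫ x, v x ^ 2 ∂μ)).sqrt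
  simpa using this

end SquareIntegrable

/-! ### Mollification of functions in `L²` and of weak derivatives. -/

section Mollification

open scoped Convolution

variable {E F : Type*} [NormedAddCommGroup E] [NormedSpace ℝ E] [FiniteDimensional ℝ E]
  [MeasureSpace E] [BorelSpace E] [(volume : Measure E).IsAddHaarMeasure]
  [NormedAddCommGroup F] [InnerProductSpace ℝ F] [CompleteSpace F]

/-- A sequence of bump functions shrinking to the origin. -/
noncomputable def mollBump (E : Type*) [NormedAddCommGroup E] (n : ℕ) : ContDiffBump (0 : E) where
  rIn := 1 / (n + 1)
  rOut := 2 / (n + 1)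
  rIn_pos := by positivity
  rIn_lt_rOut := by gcongr; norm_num

theorem tendsto_mollBump_rOut : Tendsto (fun n => (mollBump E n).rOut) atTop (𝓝 0) := by
  have := tendsto_one_div_add_atTop_nhds_zero_nat (𝕜 := ℝ)
  have h := this.const_mul 2
  simp only [mul_zero] at h
  refine h.congr fun n => ?_
  show 2 * (1 / ((n : ℝ) + 1)) = 2 / (n + 1)
  ring

/-- The normalized kernel of the `n`-th mollifier. -/
noncomputable def mollKernel (E : Type*) [NormedAddCommGroup E] [NormedSpace ℝ E]
    [FiniteDimensional ℝ E] [MeasureSpace E] (n : ℕ) : E → ℝ :=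
  (mollBump E n).normed volume

/-- The `n`-th mollification of `f`. -/
noncomputable def mollify (n : ℕ) (f : E → F) : E → F :=
  mollKernel E n ⋆[ContinuousLinearMap.lsmul ℝ ℝ, volume] f

theorem contDiff_mollKernel (n : ℕ) : ContDiff ℝ ∞ (mollKernel E n) :=
  (mollBump E n).contDiff_normed

theorem hasCompactSupport_mollKernel (n : ℕ) : HasCompactSupport (mollKernel E n) :=
  (mollBump E n).hasCompactSupport_normed

theorem mollKernel_nonneg (n : ℕ) (x : E) : 0 ≤ mollKernel E n x :=
  (mollBump E n).nonneg_normed x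

theorem integral_mollKernel (n : ℕ) : ∫ x, mollKernel E n x = 1 :=
  (mollBump E n).integral_normed

theorem integrable_mollKernel (n : ℕ) : Integrable (mollKernel E n) :=
  (mollBump E n).integrable_normed

theorem mollify_apply (n : ℕ) (f : E → F) (x : E) :
    mollify n f x = ∫ y, mollKernel E n y • f (x - y) := rfl

theorem mollify_apply' (n : ℕ) (f : E → F) (x : E) :
    mollify n f x = ∫ y, mollKernel E n (x - y) • f y := by
  rw [mollify, convolution_eq_swap]; rfl

theorem MeasureTheory.MemLp.locallyIntegrable_two {f : E → F} (hf : MemLp f 2) :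
    LocallyIntegrable f :=
  hf.locallyIntegrable (by norm_num)

theorem integrable_smul_of_hasCompactSupport {η : E → ℝ} (hη : Continuous η)
    (hc : HasCompactSupport η) {f : E → F} (hf : LocallyIntegrable f) :
    Integrable fun x => η x • f x :=
  hf.integrable_smul_left_of_hasCompactSupport hη hc

theorem ae_tendsto_mollify {f : E → F} (hf : LocallyIntegrable f) :
    ∀ᵐ x, Tendsto (fun n => mollify n f x) atTop (𝓝 (f x)) := by
  -- Lebesgue differentiation requires the ratio of outer to inner radius to stay bounded; for
  -- `mollBump` it is always `2`.
  refine ContDiffBump.ae_convolution_tendsto_right_of_locallyIntegrable (K := 2)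
    tendsto_mollBump_rOut (Eventually.of_forall fun n => ?_) hf
  show (2 : ℝ) / (n + 1) ≤ 2 * (1 / (n + 1))
  rw [mul_one_div]

theorem contDiff_mollify (n : ℕ) {f : E → F} (hf : LocallyIntegrable f) :
    ContDiff ℝ ∞ (mollify n f) :=
  (hasCompactSupport_mollKernel n).contDiff_convolution_left _ (contDiff_mollKernel n) hf

theorem integrable_mollKernel_smul (n : ℕ) {f : E → F} (hf : LocallyIntegrable f) (x : E) :
    Integrable fun y => mollKernel E n y • f (x - y) :=
  (hasCompactSupport_mollKernel n).convolutionExists_left (ContinuousLinearMap.lsmul ℝ ℝ)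
    (contDiff_mollKernel n).continuous hf x

/-- Jensen's inequality for the mollifier. -/
theorem normSq_mollify_le (n : ℕ) {f : E → F} (hf : MemLp f 2) (x : E) :
    ‖mollify n f x‖ ^ 2 ≤ mollify n (fun y => ‖f y‖ ^ 2) x := by
  have i1 : Integrable fun y => mollKernel E n y * ‖f (x - y)‖ := by
    have := (integrable_mollKernel_smul n hf.locallyIntegrable_two x).norm
    refine this.congr (Eventually.of_forall fun y => ?_)
    show ‖mollKernel E n y • f (x - y)‖ = _
    rw [norm_smul, Real.norm_of_nonneg (mollKernel_nonneg n y)]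
  have i2 : Integrable fun y => mollKernel E n y * ‖f (x - y)‖ ^ 2 :=
    integrable_mollKernel_smul n hf.integrable_normSq.locallyIntegrable x
  set c := ∫ y, mollKernel E n y * ‖f (x - y)‖ with hc
  have h1 : ‖mollify n f x‖ ≤ c := by
    rw [mollify_apply]
    refine (norm_integral_le_integral_norm _).trans_eq (integral_congr_ae ?_)
    refine Eventually.of_forall fun y => ?_
    show ‖mollKernel E n y • f (x - y)‖ = _
    rw [norm_smul, Real.norm_of_nonneg (mollKernel_nonneg n y)]
  -- Jensen in the form "the variance is nonnegative", for the probability density `mollKernel E n`.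
  have h2 : 0 ≤ ∫ y, mollKernel E n y * (‖f (x - y)‖ - c) ^ 2 :=
    integral_nonneg fun y => mul_nonneg (mollKernel_nonneg n y) (sq_nonneg _)
  have e : ∫ y, mollKernel E n y * (‖f (x - y)‖ - c) ^ 2
      = ∫ y, (1 * (mollKernel E n y * ‖f (x - y)‖ ^ 2)
          + (-2 * c) * (mollKernel E n y * ‖f (x - y)‖) + c ^ 2 * mollKernel E n y) :=
    integral_congr_ae (Eventually.of_forall fun y => by ring)
  rw [e, integral_comb_three _ _ _ i2 i1 (integrable_mollKernel n), ← hc,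
    integral_mollKernel] at h2
  have h3 : ‖mollify n f x‖ ^ 2 ≤ c ^ 2 := by gcongr
  have h4 : mollify n (fun y => ‖f y‖ ^ 2) x = ∫ y, mollKernel E n y * ‖f (x - y)‖ ^ 2 := rfl
  rw [h4]
  nlinarith

theorem integrable_mollify (n : ℕ) {f : E → F} (hf : Integrable f) : Integrable (mollify n f) :=
  (integrable_mollKernel n).integrable_convolution _ hf

theorem integral_mollify (n : ℕ) {f : E → F} (hf : Integrable f) :
    ∫ x, mollify n f x = ∫ x, f x := by
  have := integral_convolution (ContinuousLinearMap.lsmul ℝ ℝ) (integrable_mollKernel (E := E) n) hf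
  rw [integral_mollKernel] at this
  refine this.trans ?_
  simp

theorem memLp_mollify (n : ℕ) {f : E → F} (hf : MemLp f 2) : MemLp (mollify n f) 2 := by
  have hc := (contDiff_mollify n hf.locallyIntegrable_two).continuous
  rw [memLp_two_iff_integrable_sq_norm hc.aestronglyMeasurable]
  refine (integrable_mollify n hf.integrable_normSq).mono'
    (hc.norm.pow 2).aestronglyMeasurable (Eventually.of_forall fun x => ?_)
  rw [Real.norm_of_nonneg (by positivity)]
  exact normSq_mollify_le n hf x

theorem integral_normSq_mollify_le (n : ℕ) {f : E → F} (hf : MemLp f 2) :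
    ∫ x, ‖mollify n f x‖ ^ 2 ≤ ∫ x, ‖f x‖ ^ 2 := by
  rw [← integral_mollify n hf.integrable_normSq]
  exact integral_mono (memLp_mollify n hf).integrable_normSq
    (integrable_mollify n hf.integrable_normSq) (normSq_mollify_le n hf)

theorem tendsto_mollify {f : E → F} (hf : MemLp f 2) :
    Tendsto (fun n => ∫ x, ‖mollify n f x - f x‖ ^ 2) atTop (𝓝 0) :=
  tendsto_integral_normSq_sub_of_ae_tendsto (fun n => memLp_mollify n hf) hf
    (ae_tendsto_mollify hf.locallyIntegrable_two) fun n => integral_normSq_mollify_le n hf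

/-- Mollification commutes with weak derivatives. -/
theorem HasWeakDeriv.fderiv_mollify {v : E} {f f' : E → F} (h : HasWeakDeriv v f f') (n : ℕ)
    (x : E) : fderiv ℝ (mollify n f) x v = mollify n f' x := by
  have hd := (hasCompactSupport_mollKernel (E := E) n).hasFDerivAt_convolution_left
    (ContinuousLinearMap.lsmul ℝ ℝ (E := F)) ((contDiff_mollKernel n).of_le (by simp)) h.1 x
  have hd' : fderiv ℝ (mollify n f) x = _ := hd.fderiv
  have hcd : HasCompactSupport (fderiv ℝ (mollKernel E n)) :=
    (hasCompactSupport_mollKernel (E := E) n).fderiv ℝ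
  have hex := (hcd.convolutionExists_left
    ((ContinuousLinearMap.lsmul ℝ ℝ (E := F)).precompL E)
    ((contDiff_mollKernel n).continuous_fderiv (by simp)) h.1 x)
  rw [hd', convolution_eq_swap, ContinuousLinearMap.integral_apply hex.integrable_swap]
  simp only [ContinuousLinearMap.precompL_apply, ContinuousLinearMap.lsmul_apply]
  -- The reflected and translated kernel is a legitimate test function; the sign from the reflection
  -- cancels the sign in the definition of the weak derivative.
  have hη : ContDiff ℝ ∞ fun y => mollKernel E n (x - y) :=
    (contDiff_mollKernel n).comp (contDiff_const.sub contDiff_id)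
  have hηc : HasCompactSupport fun y => mollKernel E n (x - y) :=
    (hasCompactSupport_mollKernel (E := E) n).comp_homeomorph (Homeomorph.subLeft x)
  have key := h.2.2 _ hη hηc
  have e : ∀ y, fderiv ℝ (fun y => mollKernel E n (x - y)) y v
      = -(fderiv ℝ (mollKernel E n) (x - y) v) := fun y => by
    have h1 : HasFDerivAt (mollKernel E n) (fderiv ℝ (mollKernel E n) (x - y)) (x - y) :=
      ((contDiff_mollKernel n).differentiable (by simp) _).hasFDerivAt
    have h2 : HasFDerivAt (fun y : E => x - y) (-(ContinuousLinearMap.id ℝ E)) y :=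
      (hasFDerivAt_id y).const_sub x
    have h3 := (h1.comp y h2).fderiv
    rw [show (fun y => mollKernel E n (x - y)) = mollKernel E n ∘ (fun y => x - y) from rfl, h3]
    simp
  simp only [e, neg_smul, integral_neg, neg_inj] at key
  rw [key, mollify_apply']

end Mollification

/-! ### Integration by parts for compositions with mollified functions. -/

section WeakDerivCalculus

variable {E F : Type*} [NormedAddCommGroup E] [NormedSpace ℝ E] [FiniteDimensional ℝ E]
  [MeasureSpace E] [BorelSpace E] [(volume : Measure E).IsAddHaarMeasure]
  [NormedAddCommGroup F] [InnerProductSpace ℝ F] [CompleteSpace F]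

/-- The mollification is smooth and its derivative is the mollified weak derivative, so this is
classical integration by parts with the classical chain rule. The chain rule for weak derivatives is
obtained from it as `n → ∞`. -/
theorem HasWeakDeriv.integral_mollify {v : E} {f f' : E → F} (h : HasWeakDeriv v f f')
    {N : F → ℝ} (hN : ContDiff ℝ 1 N) {η : E → ℝ} (hη : ContDiff ℝ ∞ η)
    (hc : HasCompactSupport η) (n : ℕ) :
    ∫ x, fderiv ℝ η x v * N (mollify n f x)
      = -∫ x, η x * fderiv ℝ N (mollify n f x) (mollify n f' x) := by
  have hm := contDiff_mollify n h.1
  have hcomp : ContDiff ℝ 1 fun x => N (mollify n f x) := hN.comp (hm.of_le (by simp))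
  have hcη : Continuous fun x => fderiv ℝ η x v :=
    (hη.continuous_fderiv (by simp)).clm_apply continuous_const
  have hcd : HasCompactSupport fun x => fderiv ℝ η x v := hc.fderiv_apply ℝ v
  have e : ∀ x, fderiv ℝ (fun x => N (mollify n f x)) x v
      = fderiv ℝ N (mollify n f x) (mollify n f' x) := fun x => by
    have h1 : HasFDerivAt N (fderiv ℝ N (mollify n f x)) (mollify n f x) :=
      (hN.differentiable (by simp) _).hasFDerivAt
    have h2 : HasFDerivAt (mollify n f) (fderiv ℝ (mollify n f) x) x :=
      (hm.differentiable (by simp) _).hasFDerivAt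
    have h3 := (h1.comp x h2).fderiv
    rw [show (fun x => N (mollify n f x)) = N ∘ mollify n f from rfl, h3,
      ContinuousLinearMap.comp_apply, h.fderiv_mollify]
  have key := integral_mul_fderiv_eq_neg_fderiv_mul_of_integrable (μ := (volume : Measure E))
    (𝕜 := ℝ) (f := η) (g := fun x => N (mollify n f x)) (v := v)
    ((hcη.mul hcomp.continuous).integrable_of_hasCompactSupport hcd.mul_right)
    ((hη.continuous.mul ((hcomp.continuous_fderiv (by simp)).clm_apply
      continuous_const)).integrable_of_hasCompactSupport hc.mul_right)
    ((hη.continuous.mul hcomp.continuous).integrable_of_hasCompactSupport hc.mul_right)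
    (fun x _ => hη.differentiable (by simp) x)
    (fun x _ => hcomp.differentiable (by simp) x)
  simp only [e] at key
  rw [key, neg_neg]

end WeakDerivCalculus

/-! ### Chain rule for Lipschitz functions and the weak derivative of a norm. -/

section ChainRule

variable {E F : Type*} [NormedAddCommGroup E] [NormedSpace ℝ E] [FiniteDimensional ℝ E]
  [MeasureSpace E] [BorelSpace E] [(volume : Measure E).IsAddHaarMeasure]
  [NormedAddCommGroup F] [InnerProductSpace ℝ F] [CompleteSpace F]

theorem exists_bound_of_hasCompactSupport {G : Type*} [NormedAddCommGroup G] {η : E → G}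
    (hη : Continuous η) (hc : HasCompactSupport η) : ∃ C, 0 ≤ C ∧ ∀ x, ‖η x‖ ≤ C := by
  obtain ⟨C, hC⟩ := hη.bounded_above_of_compact_support hc
  exact ⟨C, (norm_nonneg _).trans (hC 0), hC⟩

theorem contDiff_fderiv_apply {η : E → ℝ} (hη : ContDiff ℝ ∞ η) (v : E) :
    Continuous fun x => fderiv ℝ η x v :=
  (hη.continuous_fderiv (by simp)).clm_apply continuous_const

theorem memLp_of_hasCompactSupport {G : Type*} [NormedAddCommGroup G] {η : E → G}
    (hη : Continuous η) (hc : HasCompactSupport η) : MemLp η 2 :=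
  hη.memLp_of_hasCompactSupport hc

/-- The chain rule for weak derivatives and `C¹` functions with Lipschitz constant one. -/
theorem HasWeakDeriv.comp_lipschitz {v : E} {f f' : E → F} (h : HasWeakDeriv v f f')
    (hf : MemLp f 2) (hf' : MemLp f' 2) {N : F → ℝ} (hN : ContDiff ℝ 1 N)
    (hL : LipschitzWith 1 N) :
    HasWeakDeriv v (fun x => N (f x)) (fun x => fderiv ℝ N (f x) (f' x)) := by
  have hLn : ∀ y z, |N y - N z| ≤ ‖y - z‖ := fun y z => by
    have := hL.dist_le_mul y z
    simpa [Real.dist_eq, dist_eq_norm] using this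
  have hDN : ∀ y z, |fderiv ℝ N y z| ≤ ‖z‖ := fun y z => by
    have h1 := (fderiv ℝ N y).le_opNorm z
    have h2 : ‖fderiv ℝ N y‖ ≤ 1 := by
      simpa using norm_fderiv_le_of_lipschitz ℝ hL (x₀ := y)
    rw [Real.norm_eq_abs] at h1
    nlinarith [norm_nonneg z]
  have hcD : Continuous fun p : F × F => fderiv ℝ N p.1 p.2 :=
    ((hN.continuous_fderiv (by simp)).comp continuous_fst).clm_apply continuous_snd
  have hmD : ∀ {g : E → F}, AEStronglyMeasurable g →
      AEStronglyMeasurable (fun x => fderiv ℝ N (g x) (f' x)) := fun hg =>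
    hcD.comp_aestronglyMeasurable (hg.prodMk hf'.1)
  have hi : LocallyIntegrable fun x => N (f x) := by
    have hd : LocallyIntegrable fun x => N (f x) - N 0 :=
      h.1.mono ((hN.continuous.comp_aestronglyMeasurable hf.1).sub
        aestronglyMeasurable_const) (Eventually.of_forall fun x => by
          simpa using hLn (f x) 0)
    have e : (fun x => N (f x)) = (fun x => N (f x) - N 0) + fun _ => N 0 := by
      ext x; simp
    rw [e]
    exact hd.add (locallyIntegrable_const (N 0))
  have hi' : LocallyIntegrable fun x => fderiv ℝ N (f x) (f' x) :=
    h.2.1.mono (hmD hf.1) (Eventually.of_forall fun x => hDN _ _)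
  refine ⟨hi, hi', fun η hη hc => ?_⟩
  have hcη := contDiff_fderiv_apply hη v
  have hcd : HasCompactSupport fun x => fderiv ℝ η x v := hc.fderiv_apply ℝ v
  have hηL := memLp_of_hasCompactSupport hη.continuous hc
  have hηL' := memLp_of_hasCompactSupport hcη hcd
  have hmm := fun n => memLp_mollify n hf
  have hmm' := fun n => memLp_mollify n hf'
  have hNm : ∀ n, LocallyIntegrable fun x => N (mollify n f x) := fun n =>
    (hN.continuous.comp (contDiff_mollify n h.1).continuous).locallyIntegrable
  -- the left-hand sides converge
  have lim1 : Tendsto (fun n => ∫ x, fderiv ℝ η x v * N (mollify n f x)) atTop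
      (𝓝 (∫ x, fderiv ℝ η x v * N (f x))) := by
    rw [tendsto_iff_norm_sub_tendsto_zero]
    have hb : ∀ n, ‖(∫ x, fderiv ℝ η x v * N (mollify n f x)) - ∫ x, fderiv ℝ η x v * N (f x)‖
        ≤ √((∫ x, ‖fderiv ℝ η x v‖ ^ 2) * ∫ x, ‖mollify n f x - f x‖ ^ 2) := fun n => by
      have hI1 := integrable_smul_of_hasCompactSupport hcη hcd (hNm n)
      have hI2 := integrable_smul_of_hasCompactSupport hcη hcd hi
      simp only [smul_eq_mul] at hI1 hI2
      rw [← integral_sub hI1 hI2]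
      refine Real.le_sqrt_of_sq_le (le_trans ?_ (sq_integral_norm_mul_le hηL' ((hmm n).sub hf)))
      gcongr
      refine (norm_integral_le_integral_norm _).trans (integral_mono (hI1.sub hI2).norm
        (hηL'.integrable_norm_mul_norm ((hmm n).sub hf)) fun x => ?_)
      show ‖fderiv ℝ η x v * N (mollify n f x) - fderiv ℝ η x v * N (f x)‖
        ≤ ‖fderiv ℝ η x v‖ * ‖mollify n f x - f x‖
      rw [← mul_sub, norm_mul]
      gcongr
      exact hLn _ _
    refine squeeze_zero (fun n => norm_nonneg _) hb ?_
    have := ((tendsto_mollify hf).const_mul (∫ x, ‖fderiv ℝ η x v‖ ^ 2)).sqrt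
    simpa using this
  -- the right-hand sides converge
  have hIm : ∀ {g k : E → F}, AEStronglyMeasurable g → MemLp k 2 →
      Integrable fun x => η x * fderiv ℝ N (g x) (k x) := fun {g k} hg hk =>
    (hηL.integrable_norm_mul_norm hk).mono' (hηL.1.mul
      (hcD.comp_aestronglyMeasurable (hg.prodMk hk.1)))
      (Eventually.of_forall fun x => by
        rw [norm_mul]; gcongr; exact hDN _ _)
  -- The derivative of the composition is split as `DN(f_n)(f_n' - f') + DN(f_n) f'`. The first part
  -- tends to zero by Cauchy-Schwarz, the second converges by dominated convergence since `DN` is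
  -- continuous and bounded by one.
  have lim2a : Tendsto (fun n => ∫ x, η x * fderiv ℝ N (mollify n f x) (mollify n f' x - f' x))
      atTop (𝓝 0) := by
    refine squeeze_zero_norm (a := fun n => √((∫ x, ‖η x‖ ^ 2) *
      ∫ x, ‖mollify n f' x - f' x‖ ^ 2)) (fun n => ?_) ?_
    · refine Real.le_sqrt_of_sq_le (le_trans ?_ (sq_integral_norm_mul_le hηL ((hmm' n).sub hf')))
      gcongr
      refine (norm_integral_le_integral_norm _).trans (integral_mono
        (hIm (hmm n).1 ((hmm' n).sub hf')).norm
        (hηL.integrable_norm_mul_norm ((hmm' n).sub hf')) fun x => ?_)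
      show ‖η x * fderiv ℝ N (mollify n f x) (mollify n f' x - f' x)‖
        ≤ ‖η x‖ * ‖mollify n f' x - f' x‖
      rw [norm_mul]
      gcongr
      exact hDN _ _
    · have := ((tendsto_mollify hf').const_mul (∫ x, ‖η x‖ ^ 2)).sqrt
      simpa using this
  have lim2b : Tendsto (fun n => ∫ x, η x * fderiv ℝ N (mollify n f x) (f' x)) atTop
      (𝓝 (∫ x, η x * fderiv ℝ N (f x) (f' x))) := by
    refine tendsto_integral_of_dominated_convergence (fun x => ‖η x‖ * ‖f' x‖)
      (fun n => (hIm (hmm n).1 hf').1) (hηL.integrable_norm_mul_norm hf')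
      (fun n => Eventually.of_forall fun x => ?_) ?_
    · rw [norm_mul]; gcongr; exact hDN _ _
    · filter_upwards [ae_tendsto_mollify h.1] with x hx
      have : Tendsto (fun n => (mollify n f x, f' x)) atTop (𝓝 (f x, f' x)) :=
        hx.prodMk_nhds tendsto_const_nhds
      exact ((hcD.tendsto _).comp this).const_mul _
  have lim2 : Tendsto (fun n => -∫ x, η x * fderiv ℝ N (mollify n f x) (mollify n f' x)) atTop
      (𝓝 (-∫ x, η x * fderiv ℝ N (f x) (f' x))) := by
    have := (lim2a.add lim2b).neg
    rw [zero_add] at this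
    refine this.congr fun n => ?_
    have hadd := integral_add (hIm (hmm n).1 ((hmm' n).sub hf')) (hIm (hmm n).1 hf')
    simp only [Pi.sub_apply] at hadd
    rw [← hadd]
    congr 1
    refine integral_congr_ae (Eventually.of_forall fun x => ?_)
    show η x * fderiv ℝ N (mollify n f x) (mollify n f' x - f' x)
      + η x * fderiv ℝ N (mollify n f x) (f' x) = _
    rw [map_sub]; ring
  simp only [smul_eq_mul]
  refine tendsto_nhds_unique lim1 (lim2.congr fun n => ?_)
  exact (h.integral_mollify hN hη hc n).symm

/-- The smoothed norm `√(‖y - c‖² + ε²)`. -/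
noncomputable def smoothNorm (c : F) (ε : ℝ) (y : F) : ℝ := √(‖y - c‖ ^ 2 + ε ^ 2)

theorem smoothNorm_pos (c : F) {ε : ℝ} (hε : 0 < ε) (y : F) : 0 < smoothNorm c ε y :=
  Real.sqrt_pos.2 (by positivity)

theorem contDiff_smoothNorm (c : F) {ε : ℝ} (hε : 0 < ε) : ContDiff ℝ 1 (smoothNorm c ε) := by
  refine ContDiff.sqrt ?_ fun y => by positivity
  exact ((contDiff_id.sub contDiff_const).norm_sq ℝ).add contDiff_const

theorem fderiv_smoothNorm (c : F) {ε : ℝ} (hε : 0 < ε) (y z : F) :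
    fderiv ℝ (smoothNorm c ε) y z = inner ℝ (y - c) z / smoothNorm c ε y := by
  have h1 : HasFDerivAt (fun y : F => y - c) (ContinuousLinearMap.id ℝ F) y :=
    (hasFDerivAt_id y).sub_const c
  have h2 := (h1.norm_sq.add_const (ε ^ 2)).sqrt (by positivity)
  have h3 : fderiv ℝ (smoothNorm c ε) y = _ := h2.fderiv
  have h4 := (smoothNorm_pos c hε y).ne'
  rw [h3]
  simp only [_root_.smul_apply, smul_eq_mul, ContinuousLinearMap.comp_apply,
    ContinuousLinearMap.id_apply, innerSL_apply_apply, nsmul_eq_mul]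
  show 1 / (2 * smoothNorm c ε y) * _ = _
  field_simp
  try simp

theorem lipschitzWith_smoothNorm (c : F) {ε : ℝ} (hε : 0 < ε) :
    LipschitzWith 1 (smoothNorm c ε) := by
  refine LipschitzWith.of_le_add fun x y => ?_
  rw [dist_eq_norm]
  refine (Real.sqrt_le_left (by positivity [smoothNorm_pos c hε y])).2 ?_
  have h1 : smoothNorm c ε y ^ 2 = ‖y - c‖ ^ 2 + ε ^ 2 := Real.sq_sqrt (by positivity)
  have h2 : ‖x - c‖ ≤ ‖x - y‖ + ‖y - c‖ := norm_sub_le_norm_sub_add_norm_sub x y c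
  have h3 : ‖y - c‖ ≤ smoothNorm c ε y := Real.le_sqrt_of_sq_le (by nlinarith)
  nlinarith [norm_nonneg (x - y), norm_nonneg (y - c), norm_nonneg (x - c)]

theorem abs_inner_div_norm_le (y z : F) : |inner ℝ y z / ‖y‖| ≤ ‖z‖ := by
  rw [abs_div, abs_norm]
  exact div_le_of_le_mul₀ (norm_nonneg _) (norm_nonneg _)
    ((abs_real_inner_le_norm y z).trans_eq (mul_comm _ _))

theorem aestronglyMeasurable_inner_div_norm {α : Type*} [MeasurableSpace α] {μ : Measure α}
    {f f' : α → F} (hf : AEStronglyMeasurable f μ)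
    (hf' : AEStronglyMeasurable f' μ) :
    AEStronglyMeasurable (fun x => inner ℝ (f x) (f' x) / ‖f x‖) μ :=
  ((hf.inner hf').aemeasurable.div hf.norm.aemeasurable).aestronglyMeasurable

/-- The norm of a weakly differentiable function, shifted by a constant, is weakly
differentiable. -/
theorem HasWeakDeriv.norm_sub_const {v : E} {f f' : E → F} (h : HasWeakDeriv v f f')
    (hf : MemLp f 2) (hf' : MemLp f' 2) (c : F) :
    HasWeakDeriv v (fun x => ‖f x - c‖) (fun x => inner ℝ (f x - c) (f' x) / ‖f x - c‖) := by
  set ε : ℕ → ℝ := fun n => 1 / (n + 1) with hε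
  have hε0 : ∀ n, 0 < ε n := fun n => by positivity
  have hεl : Tendsto ε atTop (𝓝 0) := tendsto_one_div_add_atTop_nhds_zero_nat
  have hε1 : ∀ n, ε n ≤ 1 := fun n => by
    rw [hε]; simp only; rw [div_le_one (by positivity)]; linarith [Nat.cast_nonneg (α := ℝ) n]
  have hmc : AEStronglyMeasurable (fun x => f x - c) := hf.1.sub aestronglyMeasurable_const
  have hlc : LocallyIntegrable fun x => f x - c := h.1.sub (locallyIntegrable_const c)
  have hN := fun n => h.comp_lipschitz hf hf' (contDiff_smoothNorm c (hε0 n))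
    (lipschitzWith_smoothNorm c (hε0 n))
  have hl : LocallyIntegrable fun x => ‖f x - c‖ := fun x => (hlc x).norm
  have hl' : LocallyIntegrable fun x => inner ℝ (f x - c) (f' x) / ‖f x - c‖ :=
    h.2.1.mono (aestronglyMeasurable_inner_div_norm hmc hf'.1)
      (Eventually.of_forall fun x => abs_inner_div_norm_le _ _)
  have hsl : ∀ y : F, Tendsto (fun n => smoothNorm c (ε n) y) atTop (𝓝 ‖y - c‖) := fun y => by
    have : Tendsto (fun n => √(‖y - c‖ ^ 2 + ε n ^ 2)) atTop (𝓝 √(‖y - c‖ ^ 2 + 0 ^ 2)) :=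
      ((hεl.pow 2).const_add _).sqrt
    rw [zero_pow two_ne_zero, add_zero, Real.sqrt_sq (norm_nonneg _)] at this
    exact this
  refine ⟨hl, hl', fun η hη hc => ?_⟩
  have hcη := contDiff_fderiv_apply hη v
  have hcd : HasCompactSupport fun x => fderiv ℝ η x v := hc.fderiv_apply ℝ v
  have lim1 : Tendsto (fun n => ∫ x, fderiv ℝ η x v * smoothNorm c (ε n) (f x)) atTop
      (𝓝 (∫ x, fderiv ℝ η x v * ‖f x - c‖)) := by
    have hb := (integrable_smul_of_hasCompactSupport hcη hcd
      (hl.add (locallyIntegrable_const (1 : ℝ)))).norm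
    refine tendsto_integral_of_dominated_convergence _
      (fun n => (integrable_smul_of_hasCompactSupport hcη hcd (hN n).1).1) hb
      (fun n => Eventually.of_forall fun x => ?_) (Eventually.of_forall fun x => (hsl _).const_mul _)
    rw [norm_mul, norm_smul]
    gcongr
    rw [Real.norm_of_nonneg (smoothNorm_pos c (hε0 n) _).le,
      Real.norm_of_nonneg (by simp only [Pi.add_apply]; positivity)]
    refine (Real.sqrt_le_left (by simp only [Pi.add_apply]; positivity)).2 ?_
    simp only [Pi.add_apply]
    nlinarith [hε1 n, hε0 n, norm_nonneg (f x - c)]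
  have lim2 : Tendsto (fun n => ∫ x, η x * fderiv ℝ (smoothNorm c (ε n)) (f x) (f' x)) atTop
      (𝓝 (∫ x, η x * (inner ℝ (f x - c) (f' x) / ‖f x - c‖))) := by
    refine tendsto_integral_of_dominated_convergence (fun x => ‖η x • f' x‖)
      (fun n => (integrable_smul_of_hasCompactSupport hη.continuous hc (hN n).2.1).1)
      (integrable_smul_of_hasCompactSupport hη.continuous hc h.2.1).norm
      (fun n => Eventually.of_forall fun x => ?_) (Eventually.of_forall fun x => ?_)
    · rw [norm_mul, norm_smul]
      gcongr
      rw [fderiv_smoothNorm c (hε0 n), Real.norm_eq_abs, abs_div,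
        abs_of_pos (smoothNorm_pos c (hε0 n) _)]
      refine div_le_of_le_mul₀ (smoothNorm_pos c (hε0 n) _).le (norm_nonneg _) ?_
      have h1 := abs_real_inner_le_norm (f x - c) (f' x)
      have h2 : ‖f x - c‖ ≤ smoothNorm c (ε n) (f x) :=
        Real.le_sqrt_of_sq_le (by nlinarith [hε0 n])
      nlinarith [norm_nonneg (f' x)]
    · refine Tendsto.const_mul _ ?_
      simp only [fderiv_smoothNorm c (hε0 _)]
      -- Where `f = c` the smoothed derivative is `0 / ε = 0`, and the claimed limit is `0 / 0`,
      -- which is `0` by convention; the formula is therefore correct at such points too.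
      by_cases h0 : f x - c = 0
      · simp [h0]
      · exact (tendsto_const_nhds).div (hsl _) (norm_ne_zero_iff.2 h0)
  simp only [smul_eq_mul]
  refine tendsto_nhds_unique lim1 (lim2.neg.congr fun n => ?_)
  have := (hN n).2.2 η hη hc
  simp only [smul_eq_mul] at this
  exact this.symm

theorem MeasureTheory.MemLp.inner_div_norm {f f' : E → F} (hf : MemLp f 2) (hf' : MemLp f' 2)
    (c : F) : MemLp (fun x => inner ℝ (f x - c) (f' x) / ‖f x - c‖) 2 :=
  hf'.mono (aestronglyMeasurable_inner_div_norm (hf.1.sub aestronglyMeasurable_const) hf'.1)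
    (Eventually.of_forall fun _ => abs_inner_div_norm_le _ _)

end ChainRule

/-! ### Cutoffs and density of test functions in `H¹`. -/

section Cutoff

variable {E : Type*} [NormedAddCommGroup E] [NormedSpace ℝ E] [FiniteDimensional ℝ E]
  [MeasureSpace E] [BorelSpace E] [(volume : Measure E).IsAddHaarMeasure]

/-- A smooth cutoff equal to one on the ball of radius `n + 1`. -/
noncomputable def cutoff (E : Type*) [NormedAddCommGroup E] [NormedSpace ℝ E]
    [FiniteDimensional ℝ E] (n : ℕ) (x : E) : ℝ :=
  (⟨1, 2, one_pos, one_lt_two⟩ : ContDiffBump (0 : E)) ((1 / (n + 1 : ℝ)) • x)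

theorem contDiff_cutoff (n : ℕ) : ContDiff ℝ ∞ (cutoff E n) :=
  (ContDiffBump.contDiff _).comp (contDiff_const.smul contDiff_id)

theorem hasCompactSupport_cutoff (n : ℕ) : HasCompactSupport (cutoff E n) :=
  (ContDiffBump.hasCompactSupport _).comp_homeomorph
    (Homeomorph.smulOfNeZero (1 / (n + 1 : ℝ)) (by positivity))

theorem cutoff_nonneg (n : ℕ) (x : E) : 0 ≤ cutoff E n x := ContDiffBump.nonneg _

theorem cutoff_le_one (n : ℕ) (x : E) : cutoff E n x ≤ 1 := ContDiffBump.le_one _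

theorem cutoff_eq_one {n : ℕ} {x : E} (hx : ‖x‖ ≤ n + 1) : cutoff E n x = 1 := by
  refine ContDiffBump.one_of_mem_closedBall _ ?_
  rw [mem_closedBall_zero_iff, norm_smul, Real.norm_of_nonneg (by positivity)]
  show 1 / ((n : ℝ) + 1) * ‖x‖ ≤ 1
  rw [one_div_mul_eq_div, div_le_one (by positivity)]
  exact hx

theorem eventually_cutoff_eq_one (x : E) : ∀ᶠ n in atTop, cutoff E n x = 1 := by
  obtain ⟨N, hN⟩ := exists_nat_ge ‖x‖
  filter_upwards [eventually_ge_atTop N] with n hn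
  refine cutoff_eq_one ?_
  have : (N : ℝ) ≤ n := by exact_mod_cast hn
  linarith

theorem exists_fderiv_cutoff_le (v : E) :
    ∃ C, 0 ≤ C ∧ ∀ n x, |fderiv ℝ (cutoff E n) x v| ≤ C / (n + 1) := by
  set χ : ContDiffBump (0 : E) := ⟨1, 2, one_pos, one_lt_two⟩ with hχ
  have hχd : ContDiff ℝ ∞ (χ : E → ℝ) := χ.contDiff
  obtain ⟨C, hC0, hC⟩ := exists_bound_of_hasCompactSupport (contDiff_fderiv_apply hχd v)
    (χ.hasCompactSupport.fderiv_apply ℝ v)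
  refine ⟨C, hC0, fun n x => ?_⟩
  have h1 : HasFDerivAt (χ : E → ℝ) (fderiv ℝ χ ((1 / (n + 1 : ℝ)) • x))
      ((1 / (n + 1 : ℝ)) • x) := (hχd.differentiable (by simp) _).hasFDerivAt
  have h2 : HasFDerivAt (fun x : E => (1 / (n + 1 : ℝ)) • x)
      ((1 / (n + 1 : ℝ)) • ContinuousLinearMap.id ℝ E) x := (hasFDerivAt_id x).const_smul _
  have h3 : fderiv ℝ (cutoff E n) x = _ := (h1.comp x h2).fderiv
  rw [h3, ContinuousLinearMap.comp_apply, _root_.smul_apply,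
    ContinuousLinearMap.id_apply, map_smul, smul_eq_mul, abs_mul,
    abs_of_nonneg (by positivity : (0 : ℝ) ≤ 1 / (n + 1)), one_div_mul_eq_div]
  gcongr
  exact hC _

theorem tendsto_cutoff_mul {f : E → ℝ} (hf : MemLp f 2) :
    Tendsto (fun n => ∫ x, ‖(cutoff E n x - 1) * f x‖ ^ 2) atTop (𝓝 0) := by
  have : Tendsto (fun n => ∫ x, ‖(cutoff E n x - 1) * f x‖ ^ 2) atTop (𝓝 (∫ _ : E, (0 : ℝ))) := by
    refine tendsto_integral_of_dominated_convergence (fun x => ‖f x‖ ^ 2) (fun n => ?_)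
      hf.integrable_normSq (fun n => Eventually.of_forall fun x => ?_)
      (Eventually.of_forall fun x => ?_)
    · exact ((((contDiff_cutoff n).continuous.sub continuous_const).aestronglyMeasurable.mul
        hf.1).norm.pow 2)
    · rw [Real.norm_of_nonneg (by positivity), norm_mul]
      have h1 : ‖cutoff E n x - 1‖ ≤ 1 := by
        rw [Real.norm_eq_abs, abs_le]
        constructor <;> linarith [cutoff_nonneg n x, cutoff_le_one n x]
      have h2 : ‖cutoff E n x - 1‖ * ‖f x‖ ≤ ‖f x‖ := by nlinarith [norm_nonneg (f x)]
      gcongr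
    · refine tendsto_const_nhds.congr' ?_
      filter_upwards [eventually_cutoff_eq_one x] with n hn
      simp [hn]
  simpa using this

theorem memLp_cutoff_sub_one_mul (n : ℕ) {f : E → ℝ} (hf : MemLp f 2) :
    MemLp (fun x => (cutoff E n x - 1) * f x) 2 := by
  refine hf.mono (((contDiff_cutoff n).continuous.sub
    continuous_const).aestronglyMeasurable.mul hf.1) (Eventually.of_forall fun x => ?_)
  rw [norm_mul]
  have h1 : ‖cutoff E n x - 1‖ ≤ 1 := by
    rw [Real.norm_eq_abs, abs_le]
    constructor <;> linarith [cutoff_nonneg n x, cutoff_le_one n x]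
  nlinarith [norm_nonneg (f x)]

theorem memLp_cutoff_mul (n : ℕ) {f : E → ℝ} (hf : MemLp f 2) :
    MemLp (fun x => cutoff E n x * f x) 2 := by
  refine hf.mono ((contDiff_cutoff n).continuous.aestronglyMeasurable.mul hf.1)
    (Eventually.of_forall fun x => ?_)
  rw [norm_mul, Real.norm_of_nonneg (cutoff_nonneg n x)]
  nlinarith [norm_nonneg (f x), cutoff_le_one n x]

theorem tendsto_cutoff_mollify {f : E → ℝ} (hf : MemLp f 2) :
    Tendsto (fun n => ∫ x, ‖cutoff E n x * mollify n f x - f x‖ ^ 2) atTop (𝓝 0) := by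
  have hlim := ((tendsto_mollify hf).const_mul 2).add ((tendsto_cutoff_mul hf).const_mul 2)
  rw [mul_zero, add_zero] at hlim
  refine squeeze_zero (fun n => integral_nonneg fun x => by positivity) (fun n => ?_) hlim
  have hm := (memLp_mollify n hf).sub hf
  have h1 := integral_normSq_add_le (memLp_cutoff_mul n hm) (memLp_cutoff_sub_one_mul n hf)
  have e : ∀ x, cutoff E n x * mollify n f x - f x
      = cutoff E n x * (mollify n f - f) x + (cutoff E n x - 1) * f x := fun x => by
    simp only [Pi.sub_apply]; ring
  simp only [e]
  refine h1.trans (add_le_add (mul_le_mul_of_nonneg_left ?_ zero_le_two) le_rfl)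
  refine integral_mono (memLp_cutoff_mul n hm).integrable_normSq hm.integrable_normSq fun x => ?_
  show ‖cutoff E n x * (mollify n f - f) x‖ ^ 2 ≤ ‖(mollify n f - f) x‖ ^ 2
  gcongr
  rw [norm_mul, Real.norm_of_nonneg (cutoff_nonneg n x)]
  nlinarith [norm_nonneg ((mollify n f - f) x), cutoff_le_one n x]

/-- Smooth compactly supported functions are dense for the norm of `H¹`. -/
theorem exists_smooth_approx {ι : Type*} {f : E → ℝ} {v : ι → E} {f' : ι → E → ℝ}
    (hf : MemLp f 2) (hf' : ∀ i, MemLp (f' i) 2) (h : ∀ i, HasWeakDeriv (v i) f (f' i)) :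
    ∃ ψ : ℕ → E → ℝ, (∀ n, ContDiff ℝ ∞ (ψ n)) ∧ (∀ n, HasCompactSupport (ψ n)) ∧
      (∀ᵐ x, Tendsto (fun n => ψ n x) atTop (𝓝 (f x))) ∧
      Tendsto (fun n => ∫ x, ‖ψ n x - f x‖ ^ 2) atTop (𝓝 0) ∧
      ∀ i, Tendsto (fun n => ∫ x, ‖fderiv ℝ (ψ n) x (v i) - f' i x‖ ^ 2) atTop (𝓝 0) := by
  have hm := fun n => contDiff_mollify n hf.locallyIntegrable_two
  refine ⟨fun n x => cutoff E n x * mollify n f x, fun n => (contDiff_cutoff n).mul (hm n),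
    fun n => (hasCompactSupport_cutoff n).mul_right, ?_, tendsto_cutoff_mollify hf, fun i => ?_⟩
  · filter_upwards [ae_tendsto_mollify hf.locallyIntegrable_two] with x hx
    refine hx.congr' ?_
    filter_upwards [eventually_cutoff_eq_one x] with n hn
    simp [hn]
  · obtain ⟨C, hC0, hC⟩ := exists_fderiv_cutoff_le (v i)
    have hlim : Tendsto (fun n : ℕ => 2 * (∫ x, ‖cutoff E n x * mollify n (f' i) x - f' i x‖ ^ 2)
        + 2 * ((C * (1 / ((n : ℝ) + 1))) ^ 2 * ∫ x, ‖f x‖ ^ 2)) atTop (𝓝 0) := by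
      have h1 := (tendsto_cutoff_mollify (hf' i)).const_mul 2
      have h2 := (((((tendsto_one_div_add_atTop_nhds_zero_nat (𝕜 := ℝ)).const_mul C).pow
        2).mul_const (∫ x, ‖f x‖ ^ 2))).const_mul 2
      have h3 := h1.add h2
      simpa using h3
    refine squeeze_zero (fun n => integral_nonneg fun x => by positivity) (fun n => ?_) hlim
    -- Product rule. The term in which the cutoff is differentiated is `O(1/n)` in `L²`, because the
    -- cutoff lives on the scale `n`.
    have e : ∀ x, fderiv ℝ (fun x => cutoff E n x * mollify n f x) x (v i) - f' i x
        = (cutoff E n x * mollify n (f' i) x - f' i x)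
          + fderiv ℝ (cutoff E n) x (v i) * mollify n f x := fun x => by
      have h1 : HasFDerivAt (cutoff E n) (fderiv ℝ (cutoff E n) x) x :=
        ((contDiff_cutoff n).differentiable (by simp) _).hasFDerivAt
      have h2 : HasFDerivAt (mollify n f) (fderiv ℝ (mollify n f) x) x :=
        ((hm n).differentiable (by simp) _).hasFDerivAt
      have h3 : fderiv ℝ (fun x => cutoff E n x * mollify n f x) x = _ := (h1.mul h2).fderiv
      rw [h3]
      simp only [_root_.add_apply, _root_.smul_apply, smul_eq_mul,
        (h i).fderiv_mollify]
      ring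
    have m1 : MemLp (fun x => cutoff E n x * mollify n (f' i) x - f' i x) 2 :=
      (memLp_cutoff_mul n (memLp_mollify n (hf' i))).sub (hf' i)
    have hbd : ∀ x, ‖fderiv ℝ (cutoff E n) x (v i) * mollify n f x‖
        ≤ (C * (1 / ((n : ℝ) + 1))) * ‖mollify n f x‖ := fun x => by
      rw [norm_mul, mul_one_div]
      gcongr
      exact hC n x
    have m2 : MemLp (fun x => fderiv ℝ (cutoff E n) x (v i) * mollify n f x) 2 :=
      (memLp_mollify n hf).of_le_mul ((contDiff_fderiv_apply (contDiff_cutoff n)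
        (v i)).aestronglyMeasurable.mul (memLp_mollify n hf).1) (Eventually.of_forall hbd)
    simp only [e]
    refine (integral_normSq_add_le m1 m2).trans
      (add_le_add le_rfl (mul_le_mul_of_nonneg_left ?_ zero_le_two))
    refine le_trans ?_ (mul_le_mul_of_nonneg_left (integral_normSq_mollify_le n hf) (sq_nonneg _))
    rw [← integral_const_mul]
    refine integral_mono m2.integrable_normSq
      ((memLp_mollify n hf).integrable_normSq.const_mul _) fun x => ?_
    show ‖fderiv ℝ (cutoff E n) x (v i) * mollify n f x‖ ^ 2 ≤ _
    rw [← mul_pow]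
    exact pow_le_pow_left₀ (norm_nonneg _) (hbd x) 2

end Cutoff

/-! ### Weak sequential compactness of balls in `L²`. -/

section WeakCompactness

variable {E : Type*} [NormedAddCommGroup E] [NormedSpace ℝ E] [FiniteDimensional ℝ E]
  [MeasureSpace E] [BorelSpace E] [(volume : Measure E).IsAddHaarMeasure]

theorem inner_toLp {f g : E → ℝ} (hf : MemLp f 2) (hg : MemLp g 2) :
    inner ℝ hf.toLp hg.toLp = ∫ x, f x * g x := by
  rw [L2.inner_def]
  refine integral_congr_ae ?_
  filter_upwards [hf.coeFn_toLp, hg.coeFn_toLp] with x h1 h2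
  rw [h1, h2, real_inner_eq_re_inner, RCLike.re_to_real]
  simp [mul_comm]

theorem normSq_toLp {f : E → ℝ} (hf : MemLp f 2) : ‖hf.toLp‖ ^ 2 = ∫ x, f x ^ 2 := by
  rw [← real_inner_self_eq_norm_sq, inner_toLp]
  simp [sq]

/-- Bounded sequences in `L²` have weakly convergent subsequences. -/
theorem exists_weak_limit {f : ℕ → E → ℝ} (hf : ∀ n, MemLp (f n) 2) {C : ℝ}
    (hC : ∀ n, ∫ x, f n x ^ 2 ≤ C) :
    ∃ (f₀ : E → ℝ) (φ : ℕ → ℕ), MemLp f₀ 2 ∧ StrictMono φ ∧ ∀ g : E → ℝ, MemLp g 2 →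
      Tendsto (fun n => ∫ x, f (φ n) x * g x) atTop (𝓝 (∫ x, f₀ x * g x)) := by
  -- Finiteness of the exponent gives separability of `L²`, on which the sequential form of
  -- Banach-Alaoglu depends.
  have : Fact ((2 : ℝ≥0∞) ≠ ⊤) := ⟨by norm_num⟩
  let T := InnerProductSpace.toDual ℝ (Lp ℝ 2 (volume : Measure E))
  have hb : ∀ n, ‖(hf n).toLp‖ ≤ √C := fun n =>
    Real.le_sqrt_of_sq_le ((normSq_toLp (hf n)).trans_le (hC n))
  obtain ⟨a, -, φ, hφ, hlim⟩ := WeakDual.isSeqCompact_closedBall (𝕜 := ℝ)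
    (E := Lp ℝ 2 (volume : Measure E)) 0 (√C)
    (x := fun n => StrongDual.toWeakDual (T (hf n).toLp)) (fun n => by
      simpa [T] using hb n)
  set y := T.symm (WeakDual.toStrongDual a) with hy
  have hya : ∀ g, a g = inner ℝ y g := fun g => by
    have : T y = WeakDual.toStrongDual a := T.apply_symm_apply _
    rw [← InnerProductSpace.toDual_apply_apply, show InnerProductSpace.toDual ℝ _ y = T y from rfl,
      this]; rfl
  refine ⟨y, φ, Lp.memLp y, hφ, fun g hg => ?_⟩
  have h1 : Tendsto (fun n => inner ℝ (hf (φ n)).toLp hg.toLp) atTop (𝓝 (a hg.toLp)) :=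
    ((WeakDual.eval_continuous hg.toLp).tendsto a).comp hlim
  rw [hya] at h1
  have e : y = (Lp.memLp y).toLp := (Lp.toLp_coeFn y (Lp.memLp y)).symm
  rw [e, inner_toLp] at h1
  simp only [inner_toLp] at h1
  exact h1

end WeakCompactness

/-! ### Algebra, uniqueness and closedness of weak derivatives. -/

section WeakDerivAlgebra

variable {E F : Type*} [NormedAddCommGroup E] [NormedSpace ℝ E] [FiniteDimensional ℝ E]
  [MeasureSpace E] [BorelSpace E] [(volume : Measure E).IsAddHaarMeasure]
  [NormedAddCommGroup F] [InnerProductSpace ℝ F] [CompleteSpace F]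

theorem HasWeakDeriv.congr_ae {v : E} {f f' g g' : E → F} (h : HasWeakDeriv v f f')
    (hg : f =ᵐ[volume] g) (hg' : f' =ᵐ[volume] g') : HasWeakDeriv v g g' := by
  refine ⟨h.1.congr hg, h.2.1.congr hg', fun η hη hc => ?_⟩
  have e1 : ∫ x, fderiv ℝ η x v • f x = ∫ x, fderiv ℝ η x v • g x :=
    integral_congr_ae (by filter_upwards [hg] with x hx using by rw [hx])
  have e2 : ∫ x, η x • f' x = ∫ x, η x • g' x :=
    integral_congr_ae (by filter_upwards [hg'] with x hx using by rw [hx])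
  rw [← e1, ← e2]
  exact h.2.2 η hη hc

theorem HasWeakDeriv.integrable_left {v : E} {f f' : E → F} (h : HasWeakDeriv v f f')
    {η : E → ℝ} (hη : ContDiff ℝ ∞ η) (hc : HasCompactSupport η) :
    Integrable fun x => fderiv ℝ η x v • f x :=
  integrable_smul_of_hasCompactSupport (contDiff_fderiv_apply hη v) (hc.fderiv_apply ℝ v) h.1

theorem HasWeakDeriv.integrable_right {v : E} {f f' : E → F} (h : HasWeakDeriv v f f')
    {η : E → ℝ} (hη : ContDiff ℝ ∞ η) (hc : HasCompactSupport η) :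
    Integrable fun x => η x • f' x :=
  integrable_smul_of_hasCompactSupport hη.continuous hc h.2.1

theorem HasWeakDeriv.add {v : E} {f f' g g' : E → F} (h : HasWeakDeriv v f f')
    (k : HasWeakDeriv v g g') :
    HasWeakDeriv v (fun x => f x + g x) (fun x => f' x + g' x) := by
  refine ⟨h.1.add k.1, h.2.1.add k.2.1, fun η hη hc => ?_⟩
  simp only [smul_add]
  rw [integral_add (h.integrable_left hη hc) (k.integrable_left hη hc),
    integral_add (h.integrable_right hη hc) (k.integrable_right hη hc), h.2.2 η hη hc,
    k.2.2 η hη hc, neg_add]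

theorem HasWeakDeriv.const_smul {v : E} {f f' : E → F} (h : HasWeakDeriv v f f') (c : ℝ) :
    HasWeakDeriv v (fun x => c • f x) (fun x => c • f' x) := by
  refine ⟨h.1.smul c, h.2.1.smul c, fun η hη hc => ?_⟩
  have e1 : ∀ x, fderiv ℝ η x v • c • f x = c • (fderiv ℝ η x v • f x) := fun x => smul_comm _ _ _
  have e2 : ∀ x, η x • c • f' x = c • (η x • f' x) := fun x => smul_comm _ _ _
  simp only [e1, e2]
  rw [integral_smul, integral_smul, h.2.2 η hη hc, smul_neg]

theorem HasWeakDeriv.comb {v : E} {f f' g g' : E → ℝ} (h : HasWeakDeriv v f f')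
    (k : HasWeakDeriv v g g') (a b : ℝ) :
    HasWeakDeriv v (fun x => a * f x + b * g x) (fun x => a * f' x + b * g' x) :=
  (h.const_smul a).add (k.const_smul b)

theorem HasWeakDeriv.unique {v : E} {f f' g g' : E → F} (h : HasWeakDeriv v f f')
    (k : HasWeakDeriv v g g') (e : f =ᵐ[volume] g) : f' =ᵐ[volume] g' := by
  refine ae_eq_of_integral_contDiff_smul_eq h.2.1 k.2.1 fun η hη hc => ?_
  have h1 := h.2.2 η hη hc
  have h2 := k.2.2 η hη hc
  rw [integral_congr_ae (g := fun x => fderiv ℝ η x v • g x)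
    (by filter_upwards [e] with x hx using by rw [hx]), h2, neg_inj] at h1
  exact h1.symm

/-- The weak derivative of a nonnegative function vanishes on its zero set. -/
theorem HasWeakDeriv.eq_zero_of_nonneg {v : E} {f f' : E → ℝ} (h : HasWeakDeriv v f f')
    (hf : MemLp f 2) (hf' : MemLp f' 2) (h0 : 0 ≤ᵐ[volume] f) :
    ∀ᵐ x, f x = 0 → f' x = 0 := by
  have k := h.norm_sub_const hf hf' 0
  -- Since `f = |f|`, uniqueness identifies `f'` with `f f' / |f|`, which is zero on the zero set of
  -- `f`.
  have e : f =ᵐ[volume] fun x => ‖f x - 0‖ := by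
    filter_upwards [h0] with x hx
    rw [sub_zero, Real.norm_of_nonneg hx]
  filter_upwards [h.unique k e] with x hx hx0
  rw [hx, hx0]; simp

theorem hasWeakDeriv_of_contDiff {ψ : E → ℝ} (hψ : ContDiff ℝ 1 ψ) (v : E) :
    HasWeakDeriv v ψ (fun x => fderiv ℝ ψ x v) := by
  have hcψ : Continuous fun x => fderiv ℝ ψ x v :=
    (hψ.continuous_fderiv (by simp)).clm_apply continuous_const
  refine ⟨hψ.continuous.locallyIntegrable, hcψ.locallyIntegrable, fun η hη hc => ?_⟩
  have hcη := contDiff_fderiv_apply hη v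
  have hcd : HasCompactSupport fun x => fderiv ℝ η x v := hc.fderiv_apply ℝ v
  have key := integral_mul_fderiv_eq_neg_fderiv_mul_of_integrable (μ := (volume : Measure E))
    (𝕜 := ℝ) (f := η) (g := ψ) (v := v)
    ((hcη.mul hψ.continuous).integrable_of_hasCompactSupport hcd.mul_right)
    ((hη.continuous.mul hcψ).integrable_of_hasCompactSupport hc.mul_right)
    ((hη.continuous.mul hψ.continuous).integrable_of_hasCompactSupport hc.mul_right)
    (fun x _ => hη.differentiable (by simp) x)
    (fun x _ => hψ.differentiable (by simp) x)
  simp only [smul_eq_mul]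
  rw [key, neg_neg]

/-- Weak derivatives are closed under weak convergence in `L²`. -/
theorem hasWeakDeriv_of_tendsto {v : E} {f f' : ℕ → E → ℝ} {f₀ f₀' : E → ℝ}
    (h : ∀ n, HasWeakDeriv v (f n) (f' n)) (hf₀ : MemLp f₀ 2) (hf₀' : MemLp f₀' 2)
    (hf : ∀ g : E → ℝ, MemLp g 2 →
      Tendsto (fun n => ∫ x, f n x * g x) atTop (𝓝 (∫ x, f₀ x * g x)))
    (hf' : ∀ g : E → ℝ, MemLp g 2 →
      Tendsto (fun n => ∫ x, f' n x * g x) atTop (𝓝 (∫ x, f₀' x * g x))) :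
    HasWeakDeriv v f₀ f₀' := by
  refine ⟨hf₀.locallyIntegrable_two, hf₀'.locallyIntegrable_two, fun η hη hc => ?_⟩
  have h1 := hf _ (memLp_of_hasCompactSupport (contDiff_fderiv_apply hη v) (hc.fderiv_apply ℝ v))
  have h2 := hf' _ (memLp_of_hasCompactSupport hη.continuous hc)
  simp only [smul_eq_mul, mul_comm (fderiv ℝ η _ v), mul_comm (η _)]
  refine tendsto_nhds_unique h1 (h2.neg.congr fun n => ?_)
  have := (h n).2.2 η hη hc
  simp only [smul_eq_mul, mul_comm (fderiv ℝ η _ v), mul_comm (η _)] at this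
  exact this.symm

/-- A function with vanishing weak gradient is constant. -/
theorem ae_eq_const_of_hasWeakDeriv_zero {f : E → ℝ} (hf : LocallyIntegrable f)
    (h : ∀ v : E, HasWeakDeriv v f fun _ => 0) : ∃ c, ∀ᵐ x, f x = c := by
  -- Every mollification has zero classical gradient and is constant; the constants converge at
  -- almost every point to the value of `f` there.
  have hc : ∀ n x, mollify n f x = mollify n f 0 := fun n x => by
    have hd : ∀ y, fderiv ℝ (mollify n f) y = 0 := fun y => by
      ext v
      rw [(h v).fderiv_mollify n y, mollify_apply]
      simp
    exact is_const_of_fderiv_eq_zero ((contDiff_mollify n hf).differentiable (by simp)) hd x 0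
  have hae := ae_tendsto_mollify hf
  obtain ⟨x₀, hx₀⟩ := hae.exists
  refine ⟨f x₀, ?_⟩
  filter_upwards [hae] with x hx
  refine tendsto_nhds_unique hx (hx₀.congr fun n => ?_)
  rw [hc n x, hc n x₀]

end WeakDerivAlgebra

/-! ### Tensor products, partial pairings and slices on a product space. -/

section Products

variable {E₁ E₂ : Type*} [NormedAddCommGroup E₁] [NormedSpace ℝ E₁] [FiniteDimensional ℝ E₁]
  [MeasureSpace E₁] [BorelSpace E₁] [(volume : Measure E₁).IsAddHaarMeasure]
  [NormedAddCommGroup E₂] [NormedSpace ℝ E₂] [FiniteDimensional ℝ E₂]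
  [MeasureSpace E₂] [BorelSpace E₂] [(volume : Measure E₂).IsAddHaarMeasure]

instance : (volume : Measure (E₁ × E₂)).IsAddHaarMeasure :=
  Measure.prod.instIsAddHaarMeasure _ _

theorem memLp_two_tensor {u : E₁ → ℝ} {w : E₂ → ℝ} (hu : MemLp u 2) (hw : MemLp w 2) :
    MemLp (fun x : E₁ × E₂ => u x.1 * w x.2) 2 := by
  have hm : AEStronglyMeasurable (fun x : E₁ × E₂ => u x.1 * w x.2) :=
    hu.1.comp_fst.mul hw.1.comp_snd
  rw [memLp_two_iff_integrable_sq hm]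
  simp only [mul_pow]
  exact hu.integrable_sq_real.mul_prod hw.integrable_sq_real

theorem HasCompactSupport.slice_left {η : E₁ × E₂ → ℝ} (hc : HasCompactSupport η) (z : E₂) :
    HasCompactSupport fun y => η (y, z) :=
  HasCompactSupport.intro (hc.isCompact.image continuous_fst) fun y hy => by
    by_contra h
    exact hy ⟨(y, z), subset_tsupport _ h, rfl⟩

theorem HasCompactSupport.slice_right {η : E₁ × E₂ → ℝ} (hc : HasCompactSupport η) (y : E₁) :
    HasCompactSupport fun z => η (y, z) :=
  HasCompactSupport.intro (hc.isCompact.image continuous_snd) fun z hz => by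
    by_contra h
    exact hz ⟨(y, z), subset_tsupport _ h, rfl⟩

theorem HasCompactSupport.tensor {η : E₁ → ℝ} {ζ : E₂ → ℝ} (hη : HasCompactSupport η)
    (hζ : HasCompactSupport ζ) : HasCompactSupport fun x : E₁ × E₂ => η x.1 * ζ x.2 :=
  HasCompactSupport.intro (hη.isCompact.prod hζ.isCompact) fun x hx => by
    by_contra h
    exact hx ⟨subset_tsupport _ (left_ne_zero_of_mul h), subset_tsupport _ (right_ne_zero_of_mul h)⟩

theorem fderiv_slice_left {η : E₁ × E₂ → ℝ} (hη : ContDiff ℝ ∞ η) (v y : E₁) (z : E₂) :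
    fderiv ℝ (fun y => η (y, z)) y v = fderiv ℝ η (y, z) (v, 0) := by
  have h1 : HasFDerivAt η (fderiv ℝ η (y, z)) (y, z) :=
    (hη.differentiable (by simp) _).hasFDerivAt
  have h2 := hasFDerivAt_prodMk_left (𝕜 := ℝ) y z
  have h3 : fderiv ℝ (fun y => η (y, z)) y = _ := (h1.comp y h2).fderiv
  rw [h3]; simp

theorem fderiv_slice_right {η : E₁ × E₂ → ℝ} (hη : ContDiff ℝ ∞ η) (v : E₂) (y : E₁) (z : E₂) :
    fderiv ℝ (fun z => η (y, z)) z v = fderiv ℝ η (y, z) (0, v) := by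
  have h1 : HasFDerivAt η (fderiv ℝ η (y, z)) (y, z) :=
    (hη.differentiable (by simp) _).hasFDerivAt
  have h2 := hasFDerivAt_prodMk_right (𝕜 := ℝ) y z
  have h3 : fderiv ℝ (fun z => η (y, z)) z = _ := (h1.comp z h2).fderiv
  rw [h3]; simp

theorem contDiff_tensor {η : E₁ → ℝ} {ζ : E₂ → ℝ} (hη : ContDiff ℝ ∞ η) (hζ : ContDiff ℝ ∞ ζ) :
    ContDiff ℝ ∞ fun x : E₁ × E₂ => η x.1 * ζ x.2 :=
  (hη.comp contDiff_fst).mul (hζ.comp contDiff_snd)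

theorem fderiv_tensor_left {η : E₁ → ℝ} {ζ : E₂ → ℝ} (hη : ContDiff ℝ ∞ η)
    (hζ : ContDiff ℝ ∞ ζ) (v : E₁) (x : E₁ × E₂) :
    fderiv ℝ (fun x : E₁ × E₂ => η x.1 * ζ x.2) x (v, 0) = fderiv ℝ η x.1 v * ζ x.2 := by
  rw [← fderiv_slice_left (contDiff_tensor hη hζ) v x.1 x.2]
  simp only
  rw [fderiv_mul_const (hη.differentiable (by simp) _)]
  simp [mul_comm]

theorem fderiv_tensor_right {η : E₁ → ℝ} {ζ : E₂ → ℝ} (hη : ContDiff ℝ ∞ η)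
    (hζ : ContDiff ℝ ∞ ζ) (v : E₂) (x : E₁ × E₂) :
    fderiv ℝ (fun x : E₁ × E₂ => η x.1 * ζ x.2) x (0, v) = η x.1 * fderiv ℝ ζ x.2 v := by
  rw [← fderiv_slice_right (contDiff_tensor hη hζ) v x.1 x.2]
  simp only
  rw [fderiv_const_mul (hζ.differentiable (by simp) _)]
  simp

theorem HasWeakDeriv.tensor_left {v : E₁} {u u' : E₁ → ℝ} {w : E₂ → ℝ} (h : HasWeakDeriv v u u')
    (hu : MemLp u 2) (hu' : MemLp u' 2) (hw : MemLp w 2) :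
    HasWeakDeriv ((v, 0) : E₁ × E₂) (fun x => u x.1 * w x.2) (fun x => u' x.1 * w x.2) := by
  have m1 := memLp_two_tensor hu hw
  have m2 := memLp_two_tensor hu' hw
  refine ⟨m1.locallyIntegrable_two, m2.locallyIntegrable_two, fun η hη hc => ?_⟩
  have i1 : Integrable (fun x : E₁ × E₂ => fderiv ℝ η x (v, 0) • (u x.1 * w x.2)) :=
    integrable_smul_of_hasCompactSupport (contDiff_fderiv_apply hη _) (hc.fderiv_apply ℝ _)
      m1.locallyIntegrable_two
  have i2 : Integrable (fun x : E₁ × E₂ => η x • (u' x.1 * w x.2)) :=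
    integrable_smul_of_hasCompactSupport hη.continuous hc m2.locallyIntegrable_two
  rw [Measure.volume_eq_prod] at i1 i2 ⊢
  rw [integral_prod_symm _ i1, integral_prod_symm _ i2, ← integral_neg]
  congr 1
  ext z
  have key := h.2.2 (fun y => η (y, z)) (hη.comp (contDiff_id.prodMk contDiff_const))
    (hc.slice_left z)
  simp only [fderiv_slice_left hη, smul_eq_mul] at key ⊢
  simp only [← mul_assoc]
  rw [integral_mul_const, integral_mul_const, key, neg_mul]

theorem HasWeakDeriv.tensor_right {v : E₂} {u : E₁ → ℝ} {w w' : E₂ → ℝ} (h : HasWeakDeriv v w w')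
    (hu : MemLp u 2) (hw : MemLp w 2) (hw' : MemLp w' 2) :
    HasWeakDeriv ((0, v) : E₁ × E₂) (fun x => u x.1 * w x.2) (fun x => u x.1 * w' x.2) := by
  have m1 := memLp_two_tensor hu hw
  have m2 := memLp_two_tensor hu hw'
  refine ⟨m1.locallyIntegrable_two, m2.locallyIntegrable_two, fun η hη hc => ?_⟩
  have i1 : Integrable (fun x : E₁ × E₂ => fderiv ℝ η x (0, v) • (u x.1 * w x.2)) :=
    integrable_smul_of_hasCompactSupport (contDiff_fderiv_apply hη _) (hc.fderiv_apply ℝ _)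
      m1.locallyIntegrable_two
  have i2 : Integrable (fun x : E₁ × E₂ => η x • (u x.1 * w' x.2)) :=
    integrable_smul_of_hasCompactSupport hη.continuous hc m2.locallyIntegrable_two
  rw [Measure.volume_eq_prod] at i1 i2 ⊢
  rw [integral_prod _ i1, integral_prod _ i2, ← integral_neg]
  congr 1
  ext y
  have key := h.2.2 (fun z => η (y, z)) (hη.comp (contDiff_const.prodMk contDiff_id))
    (hc.slice_right y)
  simp only [fderiv_slice_right hη, smul_eq_mul] at key ⊢
  simp only [mul_left_comm _ (u y)]
  rw [integral_const_mul, integral_const_mul, key, mul_neg]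

theorem MeasureTheory.MemLp.slice {f : E₁ × E₂ → ℝ} (hf : MemLp f 2) :
    ∀ᵐ z, MemLp (fun y => f (y, z)) 2 := by
  have h1 := hf.integrable_sq_real
  have h2 := hf.1
  rw [Measure.volume_eq_prod] at h1 h2
  filter_upwards [h1.prod_left_ae, h2.prodMk_right] with z hz hz'
  exact (memLp_two_iff_integrable_sq hz').2 hz

theorem MeasureTheory.MemLp.slice' {f : E₁ × E₂ → ℝ} (hf : MemLp f 2) :
    ∀ᵐ y, MemLp (fun z => f (y, z)) 2 := by
  have h1 := hf.integrable_sq_real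
  have h2 := hf.1
  rw [Measure.volume_eq_prod] at h1 h2
  filter_upwards [h1.prod_right_ae, h2.prodMk_left] with z hz hz'
  exact (memLp_two_iff_integrable_sq hz').2 hz

/-- Pairing with a square integrable function of the first variable. -/
theorem memLp_integral_mul_left {β : E₁ → ℝ} {f : E₁ × E₂ → ℝ} (hβ : MemLp β 2)
    (hf : MemLp f 2) : MemLp (fun z => ∫ y, β y * f (y, z)) 2 := by
  have hm : AEStronglyMeasurable (fun z => ∫ y, β y * f (y, z)) := by
    have h : AEStronglyMeasurable (fun x : E₁ × E₂ => β x.1 * f x)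
        ((volume : Measure E₁).prod volume) := hβ.1.comp_fst.mul hf.1
    exact h.prod_swap.integral_prod_right'
  rw [memLp_two_iff_integrable_sq hm]
  have h1 := hf.integrable_sq_real
  rw [Measure.volume_eq_prod] at h1
  refine (h1.integral_prod_right.const_mul (∫ y, β y ^ 2)).mono' (hm.pow 2) ?_
  filter_upwards [hf.slice] with z hz
  rw [Real.norm_of_nonneg (sq_nonneg _)]
  exact sq_integral_mul_le hβ hz

theorem memLp_integral_mul_right {ζ : E₂ → ℝ} {f : E₁ × E₂ → ℝ} (hζ : MemLp ζ 2)
    (hf : MemLp f 2) : MemLp (fun y => ∫ z, ζ z * f (y, z)) 2 := by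
  have hm : AEStronglyMeasurable (fun y => ∫ z, ζ z * f (y, z)) := by
    have h : AEStronglyMeasurable (fun x : E₁ × E₂ => ζ x.2 * f x)
        ((volume : Measure E₁).prod volume) := hζ.1.comp_snd.mul hf.1
    exact h.integral_prod_right'
  rw [memLp_two_iff_integrable_sq hm]
  have h1 := hf.integrable_sq_real
  rw [Measure.volume_eq_prod] at h1
  refine (h1.integral_prod_left.const_mul (∫ z, ζ z ^ 2)).mono' (hm.pow 2) ?_
  filter_upwards [hf.slice'] with y hy
  rw [Real.norm_of_nonneg (sq_nonneg _)]
  exact sq_integral_mul_le hζ hy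

theorem integral_sq_integral_mul_left_le {β : E₁ → ℝ} {f : E₁ × E₂ → ℝ} (hβ : MemLp β 2)
    (hf : MemLp f 2) :
    ∫ z, (∫ y, β y * f (y, z)) ^ 2 ≤ (∫ y, β y ^ 2) * ∫ x, f x ^ 2 := by
  have h1 := hf.integrable_sq_real
  rw [Measure.volume_eq_prod] at h1 ⊢
  rw [integral_prod_symm _ h1, ← integral_const_mul]
  refine integral_mono_ae (memLp_integral_mul_left hβ hf).integrable_sq_real
    (h1.integral_prod_right.const_mul (∫ y, β y ^ 2)) ?_
  filter_upwards [hf.slice] with z hz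
  exact sq_integral_mul_le hβ hz

theorem integral_tensor_mul {β : E₁ → ℝ} {ζ : E₂ → ℝ} {f : E₁ × E₂ → ℝ} (hβ : MemLp β 2)
    (hζ : MemLp ζ 2) (hf : MemLp f 2) :
    ∫ x : E₁ × E₂, (β x.1 * ζ x.2) * f x = ∫ z, ζ z * ∫ y, β y * f (y, z) := by
  have h := (memLp_two_tensor hβ hζ).integrable_mul_real hf
  rw [Measure.volume_eq_prod] at h ⊢
  rw [integral_prod_symm _ h]
  refine integral_congr_ae (Eventually.of_forall fun z => ?_)
  simp only
  rw [← integral_const_mul]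
  congr 1; ext y; ring

theorem integral_tensor_mul' {β : E₁ → ℝ} {ζ : E₂ → ℝ} {f : E₁ × E₂ → ℝ} (hβ : MemLp β 2)
    (hζ : MemLp ζ 2) (hf : MemLp f 2) :
    ∫ x : E₁ × E₂, (β x.1 * ζ x.2) * f x = ∫ y, β y * ∫ z, ζ z * f (y, z) := by
  have h := (memLp_two_tensor hβ hζ).integrable_mul_real hf
  rw [Measure.volume_eq_prod] at h ⊢
  rw [integral_prod _ h]
  refine integral_congr_ae (Eventually.of_forall fun y => ?_)
  simp only
  rw [← integral_const_mul]
  congr 1; ext z; ring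

/-- Pairing with a function of the first variable commutes with weak derivatives in the second. -/
theorem HasWeakDeriv.integral_mul_left {v : E₂} {f f' : E₁ × E₂ → ℝ}
    (h : HasWeakDeriv ((0, v) : E₁ × E₂) f f') (hf : MemLp f 2) (hf' : MemLp f' 2)
    {β : E₁ → ℝ} (hβ : MemLp β 2) :
    HasWeakDeriv v (fun z => ∫ y, β y * f (y, z)) (fun z => ∫ y, β y * f' (y, z)) := by
  refine ⟨(memLp_integral_mul_left hβ hf).locallyIntegrable_two,
    (memLp_integral_mul_left hβ hf').locallyIntegrable_two, fun ζ hζ hc => ?_⟩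
  have mζ := memLp_of_hasCompactSupport hζ.continuous hc
  have mζ' := memLp_of_hasCompactSupport (contDiff_fderiv_apply hζ v) (hc.fderiv_apply ℝ v)
  -- `β` is only in `L²` and cannot serve as a test function. Smooth test functions of `y` give the
  -- identity for almost every `y` with `ζ` fixed, and `β` enters only when this identity is
  -- integrated.
  have hK : ∀ᵐ y, ∫ z, fderiv ℝ ζ z v * f (y, z) = -∫ z, ζ z * f' (y, z) := by
    refine ae_eq_of_integral_contDiff_smul_eq
      (memLp_integral_mul_right mζ' hf).locallyIntegrable_two
      (memLp_integral_mul_right mζ hf').neg.locallyIntegrable_two fun η hη hηc => ?_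
    have mη := memLp_of_hasCompactSupport hη.continuous hηc
    have key := h.2.2 _ (contDiff_tensor hη hζ) (hηc.tensor hc)
    simp only [fderiv_tensor_right hη hζ, smul_eq_mul] at key
    rw [integral_tensor_mul' mη mζ' hf, integral_tensor_mul' mη mζ hf'] at key
    simp only [smul_eq_mul, mul_neg, integral_neg]
    exact key
  simp only [smul_eq_mul]
  rw [← integral_tensor_mul hβ mζ' hf, ← integral_tensor_mul hβ mζ hf',
    integral_tensor_mul' hβ mζ' hf, integral_tensor_mul' hβ mζ hf', ← integral_neg]
  refine integral_congr_ae ?_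
  filter_upwards [hK] with y hy
  rw [hy, mul_neg]

/-- Almost every slice of a weakly differentiable function is weakly differentiable. -/
theorem HasWeakDeriv.slice {v : E₁} {f f' : E₁ × E₂ → ℝ}
    (h : HasWeakDeriv ((v, 0) : E₁ × E₂) f f') (hf : MemLp f 2) (hf' : MemLp f' 2) :
    ∀ᵐ z, HasWeakDeriv v (fun y => f (y, z)) (fun y => f' (y, z)) := by
  have : Fact ((2 : ℝ≥0∞) ≠ ⊤) := ⟨by norm_num⟩
  have m0 : ∀ {η : E₁ → ℝ}, ContDiff ℝ ∞ η → HasCompactSupport η → MemLp η 2 := fun hη hc =>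
    memLp_of_hasCompactSupport hη.continuous hc
  have m1 : ∀ {η : E₁ → ℝ}, ContDiff ℝ ∞ η → HasCompactSupport η →
      MemLp (fun x => fderiv ℝ η x v) 2 := fun hη hc =>
    memLp_of_hasCompactSupport (contDiff_fderiv_apply hη v) (hc.fderiv_apply ℝ v)
  let T := {η : E₁ → ℝ // ContDiff ℝ ∞ η ∧ HasCompactSupport η}
  have : Nonempty T := ⟨⟨0, contDiff_const, HasCompactSupport.zero⟩⟩
  -- For one test function the identity holds off a null set of `z`, and there are uncountably many
  -- test functions. The pairs `(η, ∂_v η)` form a separable subset of `L² × L²`, so a countable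
  -- family suffices, and continuity in the pair (the map `Λ` below) extends the identity to every
  -- test function.
  let J : T → Lp ℝ 2 (volume : Measure E₁) × Lp ℝ 2 (volume : Measure E₁) := fun η =>
    ((m0 η.2.1 η.2.2).toLp, (m1 η.2.1 η.2.2).toLp)
  obtain ⟨d, hd⟩ := TopologicalSpace.exists_dense_seq (Set.range J)
  choose η hη using fun k => (d k).2
  have hk : ∀ k, ∀ᵐ z, ∫ y, fderiv ℝ (η k).1 y v * f (y, z) = -∫ y, (η k).1 y * f' (y, z) := by
    intro k
    have hηd := (η k).2.1
    have hηc := (η k).2.2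
    refine ae_eq_of_integral_contDiff_smul_eq
      (memLp_integral_mul_left (m1 hηd hηc) hf).locallyIntegrable_two
      (memLp_integral_mul_left (m0 hηd hηc) hf').neg.locallyIntegrable_two fun ζ hζ hζc => ?_
    have mζ := memLp_of_hasCompactSupport hζ.continuous hζc
    have key := h.2.2 _ (contDiff_tensor hηd hζ) (hηc.tensor hζc)
    simp only [fderiv_tensor_left hηd hζ, smul_eq_mul] at key
    rw [integral_tensor_mul (m1 hηd hηc) mζ hf, integral_tensor_mul (m0 hηd hηc) mζ hf'] at key
    simp only [smul_eq_mul, mul_neg, integral_neg]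
    exact key
  filter_upwards [ae_all_iff.2 hk, hf.slice, hf'.slice] with z hz mz mz'
  refine ⟨mz.locallyIntegrable_two, mz'.locallyIntegrable_two, fun ξ hξ hξc => ?_⟩
  let Λ : Set.range J → ℝ := fun p => inner ℝ p.1.2 mz.toLp + inner ℝ p.1.1 mz'.toLp
  have hΛ : Continuous Λ := by
    refine Continuous.add ?_ ?_
    · exact (continuous_snd.comp continuous_subtype_val).inner continuous_const
    · exact (continuous_fst.comp continuous_subtype_val).inner continuous_const
  have hJ : ∀ (θ : T) (hθ : J θ ∈ Set.range J), Λ ⟨J θ, hθ⟩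
      = (∫ y, fderiv ℝ θ.1 y v * f (y, z)) + ∫ y, θ.1 y * f' (y, z) := fun θ hθ => by
    show inner ℝ (m1 θ.2.1 θ.2.2).toLp mz.toLp + inner ℝ (m0 θ.2.1 θ.2.2).toLp mz'.toLp = _
    rw [inner_toLp, inner_toLp]
  have hzero : Λ = fun _ => 0 := by
    refine hΛ.ext_on hd continuous_const ?_
    rintro _ ⟨k, rfl⟩
    have e : d k = ⟨J (η k), η k, rfl⟩ := Subtype.ext (hη k).symm
    show Λ (d k) = 0
    rw [e, hJ _ ⟨η k, rfl⟩, hz k]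
    ring
  have := hJ ⟨ξ, hξ, hξc⟩ ⟨_, rfl⟩
  rw [hzero] at this
  simp only [smul_eq_mul]
  linarith

end Products

/-! ### Passing to the limit in integrals, and Jensen's inequality. -/

section Limits

variable {α : Type*} [MeasurableSpace α] {μ : Measure α}

theorem integrable_and_integral_le_of_ae_tendsto_of_tendsto {g : ℕ → α → ℝ} {G : α → ℝ} {C : ℝ}
    {c : ℕ → ℝ} (hg : ∀ n, Integrable (g n) μ) (h0 : ∀ n x, 0 ≤ g n x)
    (hlim : ∀ᵐ x ∂μ, Tendsto (fun n => g n x) atTop (𝓝 (G x)))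
    (hc : ∀ n, ∫ x, g n x ∂μ ≤ c n) (hcC : Tendsto c atTop (𝓝 C)) :
    Integrable G μ ∧ ∫ x, G x ∂μ ≤ C := by
  have key : ∀ ε > 0, Integrable G μ ∧ ∫ x, G x ∂μ ≤ C + ε := fun ε hε => by
    obtain ⟨N, hN⟩ := eventually_atTop.1 (hcC.eventually_le_const (lt_add_of_pos_right C hε))
    refine integrable_and_integral_le_of_ae_tendsto (g := fun n => g (n + N)) (fun n => hg _)
      (fun n x => h0 _ x) ?_ fun n => (hc _).trans (hN _ (Nat.le_add_left _ _))
    filter_upwards [hlim] with x hx using hx.comp (tendsto_add_atTop_nat N)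
  exact ⟨(key 1 one_pos).1, le_of_forall_pos_le_add fun ε hε => (key ε hε).2⟩

theorem tendsto_integral_sq_of_tendsto_L2 {u : ℕ → α → ℝ} {u₀ : α → ℝ}
    (hu : ∀ n, MemLp (u n) 2 μ) (hu₀ : MemLp u₀ 2 μ)
    (hlim : Tendsto (fun n => ∫ x, ‖u n x - u₀ x‖ ^ 2 ∂μ) atTop (𝓝 0)) :
    Tendsto (fun n => ∫ x, u n x ^ 2 ∂μ) atTop (𝓝 (∫ x, u₀ x ^ 2 ∂μ)) := by
  have h1 := tendsto_integral_mul_of_tendsto_L2 hu hu₀ hu₀ hlim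
  have h2 := (hlim.add (h1.const_mul 2)).sub_const (∫ x, u₀ x ^ 2 ∂μ)
  have e : 0 + 2 * (∫ x, u₀ x * u₀ x ∂μ) - ∫ x, u₀ x ^ 2 ∂μ = ∫ x, u₀ x ^ 2 ∂μ := by
    simp only [← sq]; ring
  rw [e] at h2
  refine h2.congr fun n => ?_
  have := integral_comb_three 1 2 (-1) ((hu n).sub hu₀).integrable_normSq
    ((hu n).integrable_mul_real hu₀) hu₀.integrable_sq_real
  simp only [Pi.sub_apply, one_mul, neg_one_mul, ← sub_eq_add_neg] at this
  rw [← this]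
  refine integral_congr_ae (Eventually.of_forall fun x => ?_)
  simp only [Real.norm_eq_abs, sq_abs]
  ring

/-- Jensen's inequality for the square and a probability density. -/
theorem sq_integral_density_mul_le {φ h : α → ℝ} (hφ0 : ∀ x, 0 ≤ φ x) (hφ : Integrable φ μ)
    (hφ1 : ∫ x, φ x ∂μ = 1) (h1 : Integrable (fun x => φ x * h x) μ)
    (h2 : Integrable (fun x => φ x * h x ^ 2) μ) :
    (∫ x, φ x * h x ∂μ) ^ 2 ≤ ∫ x, φ x * h x ^ 2 ∂μ := by
  set c := ∫ x, φ x * h x ∂μ with hc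
  have h3 : 0 ≤ ∫ x, φ x * (h x - c) ^ 2 ∂μ :=
    integral_nonneg fun y => mul_nonneg (hφ0 y) (sq_nonneg _)
  have e : ∫ x, φ x * (h x - c) ^ 2 ∂μ
      = ∫ x, (1 * (φ x * h x ^ 2) + (-2 * c) * (φ x * h x) + c ^ 2 * φ x) ∂μ :=
    integral_congr_ae (Eventually.of_forall fun y => by ring)
  rw [e, integral_comb_three _ _ _ h2 h1 hφ, ← hc, hφ1] at h3
  nlinarith

end Limits

/-! ### The supremum bound on the line. -/

section Agmon

/-- The one-dimensional Sobolev inequality. -/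
theorem ae_sq_le_of_hasWeakDeriv {f w : ℝ → ℝ} (h : HasWeakDeriv (1 : ℝ) f w) (hf : MemLp f 2)
    (hw : MemLp w 2) : ∀ᵐ z, f z ^ 2 ≤ 2 * √((∫ x, f x ^ 2) * ∫ x, w x ^ 2) := by
  obtain ⟨ψ, hψ, hψc, hae, hl, hl'⟩ := exists_smooth_approx (ι := Unit) (v := fun _ => (1 : ℝ))
    (f' := fun _ => w) hf (fun _ => hw) (fun _ => h)
  have m0 := fun n => memLp_of_hasCompactSupport (hψ n).continuous (hψc n)
  have m1 := fun n => memLp_of_hasCompactSupport (contDiff_fderiv_apply (hψ n) 1)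
    ((hψc n).fderiv_apply ℝ 1)
  have hb : ∀ n z, ψ n z ^ 2
      ≤ 2 * √((∫ x, ψ n x ^ 2) * ∫ x, fderiv ℝ (ψ n) x 1 ^ 2) := fun n z => by
    have hd : ContDiff ℝ 1 fun x => ψ n x ^ 2 := ((hψ n).pow 2).of_le (by simp)
    have hcs : HasCompactSupport fun x => ψ n x ^ 2 := by
      simp only [sq]; exact (hψc n).mul_right
    -- `ψ(z)²` is the integral of `2 ψ ψ'` over the half-line ending at `z`. Using only one
    -- half-line yields the constant `2`, which is sufficient here.
    have h1 := hcs.integral_Iic_deriv_eq hd z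
    have e : deriv (fun x => ψ n x ^ 2) = fun x => 2 * (ψ n x * fderiv ℝ (ψ n) x 1) := by
      ext x
      have := ((hψ n).differentiable (by simp) x).hasDerivAt.pow 2
      have h2 : deriv (fun x => ψ n x ^ 2) x = _ := this.deriv
      rw [h2, fderiv_apply_one_eq_deriv]
      simp; ring
    rw [e] at h1
    rw [← h1]
    have i1 : Integrable fun x => ψ n x * fderiv ℝ (ψ n) x 1 := (m0 n).integrable_mul_real (m1 n)
    calc ∫ x in Set.Iic z, 2 * (ψ n x * fderiv ℝ (ψ n) x 1)
        ≤ ∫ x in Set.Iic z, 2 * (‖ψ n x‖ * ‖fderiv ℝ (ψ n) x 1‖) := by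
          refine integral_mono (i1.const_mul 2).integrableOn
            (((m0 n).integrable_norm_mul_norm (m1 n)).const_mul 2).integrableOn fun x => ?_
          show 2 * (ψ n x * fderiv ℝ (ψ n) x 1) ≤ _
          rw [← norm_mul]
          gcongr
          exact Real.le_norm_self _
      _ ≤ ∫ x, 2 * (‖ψ n x‖ * ‖fderiv ℝ (ψ n) x 1‖) :=
          setIntegral_le_integral (((m0 n).integrable_norm_mul_norm (m1 n)).const_mul 2)
            (Eventually.of_forall fun x => by positivity)
      _ ≤ _ := by
          rw [integral_const_mul]
          gcongr
          refine Real.le_sqrt_of_sq_le ?_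
          have := sq_integral_norm_mul_le (m0 n) (m1 n)
          simpa only [Real.norm_eq_abs, sq_abs] using this
  have hlim := ((tendsto_integral_sq_of_tendsto_L2 m0 hf hl).mul
    (tendsto_integral_sq_of_tendsto_L2 m1 hw (hl' ()))).sqrt.const_mul 2
  filter_upwards [hae] with z hz
  exact le_of_tendsto_of_tendsto' (hz.pow 2) hlim fun n => hb n z

end Agmon

/-! ### The quartic Sobolev inequality in the plane. -/

section Ladyzhenskaya

/-- The coordinate directions of the plane. -/
noncomputable abbrev planeBasis (i : Fin 2) : Plane := EuclideanSpace.single i (1 : ℝ)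

theorem plane_functional_apply (L : Plane →L[ℝ] ℝ) (y : Plane) :
    L y = ∑ i, y i * L (planeBasis i) := by
  have h : y = ∑ i, y i • planeBasis i := by
    ext j
    fin_cases j <;> simp [Fin.sum_univ_two]
  conv_lhs => rw [h]
  simp

theorem plane_functional_normSq_le (L : Plane →L[ℝ] ℝ) :
    ‖L‖ ^ 2 ≤ ∑ i, L (planeBasis i) ^ 2 := by
  have h0 : 0 ≤ ∑ i, L (planeBasis i) ^ 2 := Finset.sum_nonneg fun i _ => sq_nonneg _
  have : ‖L‖ ≤ √(∑ i, L (planeBasis i) ^ 2) := by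
    refine L.opNorm_le_bound (Real.sqrt_nonneg _) fun y => ?_
    rw [plane_functional_apply L y, EuclideanSpace.norm_eq, ← Real.sqrt_mul h0]
    refine Real.le_sqrt_of_sq_le ?_
    rw [Real.norm_eq_abs, sq_abs, mul_comm]
    simpa only [Real.norm_eq_abs, sq_abs] using
      Finset.sum_mul_sq_le_sq_mul_sq Finset.univ (fun i => y i) fun i => L (planeBasis i)
  calc ‖L‖ ^ 2 ≤ √(∑ i, L (planeBasis i) ^ 2) ^ 2 := by gcongr
    _ = _ := Real.sq_sqrt h0

/-- The Gagliardo-Nirenberg-Sobolev inequality `‖v‖₂ ≤ K ‖∇v‖₁` in dimension two, applied to `v =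
u²`: here `∇v = 2 u ∇u`, and Cauchy-Schwarz separates the two factors. The quadratic dependence on
each of `u` and `∇u` is what later makes the bound on `∫ b² q²` linear in the excess energy. -/
theorem exists_ladyzhenskaya_smooth : ∃ C, 0 ≤ C ∧ ∀ u : Plane → ℝ, ContDiff ℝ ∞ u →
    HasCompactSupport u → ∫ x, u x ^ 4
      ≤ C * ((∫ x, u x ^ 2) * ∑ i, ∫ x, fderiv ℝ u x (planeBasis i) ^ 2) := by
  set K := eLpNormLESNormFDerivOneConst (volume : Measure Plane) ((2 : NNReal) : ℝ) with hK
  refine ⟨4 * (K : ℝ) ^ 2, by positivity, fun u hu hc => ?_⟩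
  have hfr : Module.finrank ℝ Plane = 2 := by simp
  have hu2 : ContDiff ℝ 1 fun x => u x ^ 2 := (hu.pow 2).of_le (by simp)
  have hc2 : HasCompactSupport fun x => u x ^ 2 := by
    simp only [sq]; exact hc.mul_right
  -- The target exponent is conjugate to the dimension; in the plane both are `2`.
  have hp : NNReal.HolderConjugate (Module.finrank ℝ Plane : NNReal) (2 : NNReal) := by
    rw [hfr, NNReal.holderConjugate_iff]
    refine ⟨by norm_num, ?_⟩
    rw [← NNReal.coe_inj]; push_cast; norm_num
  have key := eLpNorm_le_eLpNorm_fderiv_one (volume : Measure Plane) hu2 hc2 hp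
  have m0 := memLp_of_hasCompactSupport hu.continuous hc
  have cD : Continuous (fderiv ℝ u) := hu.continuous_fderiv (by simp)
  have mD : MemLp (fderiv ℝ u) 2 := memLp_of_hasCompactSupport cD (hc.fderiv ℝ)
  have eD : ∀ x, ‖fderiv ℝ (fun x => u x ^ 2) x‖ = 2 * (‖u x‖ * ‖fderiv ℝ u x‖) := fun x => by
    have := ((hu.differentiable (by simp) x).hasFDerivAt).pow 2
    have h2 : fderiv ℝ (fun x => u x ^ 2) x = _ := this.fderiv
    rw [h2, norm_smul]
    simp [mul_assoc]
  have iD : Integrable fun x => 2 * (‖u x‖ * ‖fderiv ℝ u x‖) :=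
    (m0.integrable_norm_mul_norm mD).const_mul 2
  have m2 : MemLp (fun x => u x ^ 2) 2 := memLp_of_hasCompactSupport hu2.continuous hc2
  have e1 : eLpNorm (fderiv ℝ fun x => u x ^ 2) 1 volume
      = ENNReal.ofReal (∫ x, 2 * (‖u x‖ * ‖fderiv ℝ u x‖)) := by
    rw [eLpNorm_one_eq_lintegral_enorm, ofReal_integral_eq_lintegral_ofReal iD
      (Eventually.of_forall fun x => by positivity)]
    refine lintegral_congr fun x => ?_
    rw [← eD, ofReal_norm]
  have e2 : eLpNorm (fun x => u x ^ 2) ((2 : NNReal) : ℝ≥0∞) volume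
      = ENNReal.ofReal √(∫ x, u x ^ 4) := by
    have h1 := m2.eLpNorm_eq_integral_rpow_norm (by norm_num) (by norm_num)
    have h2 : (((2 : NNReal) : ℝ≥0∞)) = 2 := rfl
    rw [h2, h1, Real.sqrt_eq_rpow]
    congr 1
    simp only [ENNReal.toReal_ofNat, one_div]
    congr 1
    refine integral_congr_ae (Eventually.of_forall fun x => ?_)
    simp only [norm_pow]
    rw [show (2 : ℝ) = ((2 : ℕ) : ℝ) by norm_num, Real.rpow_natCast, ← pow_mul]
    simp only [Real.norm_eq_abs]
    exact (Even.pow_abs ⟨2, rfl⟩ _)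
  rw [e1, e2, ← ENNReal.ofReal_coe_nnreal, ← ENNReal.ofReal_mul (NNReal.coe_nonneg _),
    ENNReal.ofReal_le_ofReal_iff (by positivity), integral_const_mul] at key
  have h4 : 0 ≤ ∫ x, u x ^ 4 := integral_nonneg fun x => by positivity
  have hI0 : 0 ≤ ∫ x, ‖u x‖ * ‖fderiv ℝ u x‖ := integral_nonneg fun x => by positivity
  have h5 : ∫ x, u x ^ 4 ≤ (K * (2 * ∫ x, ‖u x‖ * ‖fderiv ℝ u x‖)) ^ 2 := by
    rw [← Real.sq_sqrt h4]
    gcongr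
  have h6 := sq_integral_norm_mul_le m0 mD
  have h7 : ∫ x, ‖fderiv ℝ u x‖ ^ 2 ≤ ∑ i, ∫ x, fderiv ℝ u x (planeBasis i) ^ 2 := by
    have mi : ∀ i, MemLp (fun x => fderiv ℝ u x (planeBasis i)) 2 := fun i =>
      memLp_of_hasCompactSupport (contDiff_fderiv_apply hu _) (hc.fderiv_apply ℝ _)
    rw [← integral_finsetSum _ fun i _ => (mi i).integrable_sq_real]
    exact integral_mono mD.integrable_normSq
      (integrable_finsetSum _ fun i _ => (mi i).integrable_sq_real)
      fun x => plane_functional_normSq_le _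
  have h8 : 0 ≤ ∫ x, u x ^ 2 := integral_nonneg fun x => sq_nonneg _
  simp only [Real.norm_eq_abs, sq_abs] at h6 h5
  calc ∫ x, u x ^ 4 ≤ _ := h5
    _ = 4 * (K : ℝ) ^ 2 * (∫ x, |u x| * ‖fderiv ℝ u x‖) ^ 2 := by ring
    _ ≤ _ := by
      refine mul_le_mul_of_nonneg_left (h6.trans ?_) (by positivity)
      exact mul_le_mul_of_nonneg_left h7 h8

/-- The Ladyzhenskaya inequality in the plane. -/
theorem exists_ladyzhenskaya : ∃ C, 0 ≤ C ∧ ∀ (f : Plane → ℝ) (G : Fin 2 → Plane → ℝ),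
    MemLp f 2 → (∀ i, MemLp (G i) 2) → (∀ i, HasWeakDeriv (planeBasis i) f (G i)) →
    Integrable (fun x => f x ^ 4) ∧
      ∫ x, f x ^ 4 ≤ C * ((∫ x, f x ^ 2) * ∑ i, ∫ x, G i x ^ 2) := by
  obtain ⟨C, hC0, hC⟩ := exists_ladyzhenskaya_smooth
  refine ⟨C, hC0, fun f G hf hG h => ?_⟩
  obtain ⟨ψ, hψ, hψc, hae, hl, hl'⟩ := exists_smooth_approx hf hG h
  have m0 := fun n => memLp_of_hasCompactSupport (hψ n).continuous (hψc n)
  have m1 := fun i n => memLp_of_hasCompactSupport (contDiff_fderiv_apply (hψ n) (planeBasis i))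
    ((hψc n).fderiv_apply ℝ (planeBasis i))
  have hc4 : ∀ n, HasCompactSupport fun x => ψ n x ^ 4 := fun n =>
    (hψc n).mono fun x hx h => hx (by simp [h])
  have hi : ∀ n, Integrable fun x => ψ n x ^ 4 := fun n =>
    ((hψ n).continuous.pow 4).integrable_of_hasCompactSupport (hc4 n)
  have hlim : ∀ᵐ x, Tendsto (fun n => ψ n x ^ 4) atTop (𝓝 (f x ^ 4)) := by
    filter_upwards [hae] with x hx using hx.pow 4
  have hG' : Tendsto (fun n => ∑ i, ∫ x, fderiv ℝ (ψ n) x (planeBasis i) ^ 2) atTop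
      (𝓝 (∑ i, ∫ x, G i x ^ 2)) := tendsto_finsetSum _ fun i _ =>
    tendsto_integral_sq_of_tendsto_L2 (m1 i) (hG i) (hl' i)
  have hC' := ((tendsto_integral_sq_of_tendsto_L2 m0 hf hl).mul hG').const_mul C
  -- Fatou also supplies the integrability of `f⁴`, which is not known beforehand.
  exact integrable_and_integral_le_of_ae_tendsto_of_tendsto hi (fun n x => by positivity) hlim
    (fun n => hC _ (hψ n) (hψc n)) hC'

end Ladyzhenskaya

/-! ### Translation and mollification errors controlled by the gradient. -/

section Translation

variable {E : Type*} [NormedAddCommGroup E] [NormedSpace ℝ E] [FiniteDimensional ℝ E]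
  [MeasureSpace E] [BorelSpace E] [(volume : Measure E).IsAddHaarMeasure]

/-- The fundamental theorem of calculus along the segment from `x` to `x - y`, followed by Jensen on
the unit interval. -/
theorem sq_sub_le_integral_fderiv {u : E → ℝ} (hu : ContDiff ℝ ∞ u) (x y : E) :
    (u (x - y) - u x) ^ 2 ≤ ∫ t in Set.Ioc (0 : ℝ) 1, fderiv ℝ u (x - t • y) y ^ 2 := by
  have hc : Continuous fun t : ℝ => fderiv ℝ u (x - t • y) y :=
    ((hu.continuous_fderiv (by simp)).comp (by fun_prop)).clm_apply continuous_const
  have hd : ∀ t ∈ Set.uIcc (0 : ℝ) 1,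
      HasDerivAt (fun t : ℝ => u (x - t • y)) (-(fderiv ℝ u (x - t • y) y)) t := fun t _ => by
    have h1 : HasFDerivAt u (fderiv ℝ u (x - t • y)) (x - t • y) :=
      (hu.differentiable (by simp) _).hasFDerivAt
    have h2 : HasDerivAt (fun t : ℝ => x - t • y) (-y) t := by
      simpa using ((hasDerivAt_id t).smul_const y).const_sub x
    have h3 := h1.comp_hasDerivAt t h2
    rw [map_neg] at h3
    exact h3
  have ftc := intervalIntegral.integral_eq_sub_of_hasDerivAt hd (hc.neg.intervalIntegrable 0 1)
  rw [intervalIntegral.integral_of_le zero_le_one] at ftc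
  simp only [one_smul, zero_smul, sub_zero, integral_neg] at ftc
  rw [← ftc, neg_sq]
  have i0 : Integrable (fun _ : ℝ => (1 : ℝ)) (volume.restrict (Set.Ioc (0 : ℝ) 1)) :=
    integrable_const _
  have i1 := (hc.integrableOn_Icc (a := 0) (b := 1)).mono_set Set.Ioc_subset_Icc_self
    (μ := volume)
  have i2 := ((hc.pow 2).integrableOn_Icc (a := 0) (b := 1)).mono_set Set.Ioc_subset_Icc_self
    (μ := volume)
  have := sq_integral_density_mul_le (φ := fun _ => (1 : ℝ)) (fun _ => zero_le_one) i0
    (by simp) (by simp only [one_mul]; exact i1) (by simp only [one_mul]; exact i2)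
  simpa using this

/-- The segment bound is integrated in `x`; after exchanging the integrals, translation invariance
removes the dependence on the position along the segment. With lower integrals no integrability has
to be tracked. -/
theorem lintegral_sq_sub_le {u : E → ℝ} (hu : ContDiff ℝ ∞ u) (y : E) :
    ∫⁻ x, ENNReal.ofReal ((u (x - y) - u x) ^ 2)
      ≤ ENNReal.ofReal (‖y‖ ^ 2) * ∫⁻ x, ENNReal.ofReal (‖fderiv ℝ u x‖ ^ 2) := by
  have hcD := hu.continuous_fderiv (by simp)
  have hc : Continuous fun p : E × ℝ => fderiv ℝ u (p.1 - p.2 • y) y :=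
    (hcD.comp (by fun_prop)).clm_apply continuous_const
  have hc2 : Continuous fun p : E × ℝ => fderiv ℝ u (p.1 - p.2 • y) y ^ 2 := hc.pow 2
  calc ∫⁻ x, ENNReal.ofReal ((u (x - y) - u x) ^ 2)
      ≤ ∫⁻ x, ∫⁻ t in Set.Ioc (0 : ℝ) 1, ENNReal.ofReal (fderiv ℝ u (x - t • y) y ^ 2) := by
        refine lintegral_mono fun x => ?_
        have hct : Continuous fun t : ℝ => fderiv ℝ u (x - t • y) y ^ 2 :=
          ((hcD.comp (by fun_prop)).clm_apply continuous_const).pow 2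
        have i2 := (hct.integrableOn_Icc (a := 0) (b := 1)).mono_set Set.Ioc_subset_Icc_self
          (μ := volume)
        rw [← ofReal_integral_eq_lintegral_ofReal i2 (Eventually.of_forall fun t => sq_nonneg _)]
        exact ENNReal.ofReal_le_ofReal (sq_sub_le_integral_fderiv hu x y)
    _ = ∫⁻ t in Set.Ioc (0 : ℝ) 1, ∫⁻ x, ENNReal.ofReal (fderiv ℝ u (x - t • y) y ^ 2) :=
        lintegral_lintegral_swap (f := fun x t => ENNReal.ofReal (fderiv ℝ u (x - t • y) y ^ 2))
          hc2.measurable.ennreal_ofReal.aemeasurable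
    _ = ∫⁻ _ in Set.Ioc (0 : ℝ) 1, ∫⁻ x, ENNReal.ofReal (fderiv ℝ u x y ^ 2) := by
        refine lintegral_congr fun t => ?_
        exact lintegral_sub_right_eq_self (fun x => ENNReal.ofReal (fderiv ℝ u x y ^ 2)) (t • y)
    _ = ∫⁻ x, ENNReal.ofReal (fderiv ℝ u x y ^ 2) := by simp
    _ ≤ ∫⁻ x, ENNReal.ofReal (‖y‖ ^ 2) * ENNReal.ofReal (‖fderiv ℝ u x‖ ^ 2) := by
        refine lintegral_mono fun x => ?_
        rw [← ENNReal.ofReal_mul (by positivity), ← mul_pow]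
        refine ENNReal.ofReal_le_ofReal ?_
        rw [← sq_abs]
        have := (fderiv ℝ u x).le_opNorm y
        rw [Real.norm_eq_abs, mul_comm] at this
        gcongr
    _ = _ := lintegral_const_mul _ (hcD.norm.pow 2).measurable.ennreal_ofReal

theorem sq_mollify_sub_le {u : E → ℝ} (hu : Continuous u) (n : ℕ) (x : E) :
    (mollify n u x - u x) ^ 2 ≤ ∫ y, mollKernel E n y * (u (x - y) - u x) ^ 2 := by
  have hk := (contDiff_mollKernel (E := E) n).continuous
  have hkc := hasCompactSupport_mollKernel (E := E) n
  have i0 : Integrable fun y => mollKernel E n y * u (x - y) :=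
    (hk.mul (by fun_prop)).integrable_of_hasCompactSupport hkc.mul_right
  have i1 : Integrable fun y => mollKernel E n y * (u (x - y) - u x) :=
    (hk.mul (by fun_prop)).integrable_of_hasCompactSupport hkc.mul_right
  have i2 : Integrable fun y => mollKernel E n y * (u (x - y) - u x) ^ 2 :=
    (hk.mul (by fun_prop)).integrable_of_hasCompactSupport hkc.mul_right
  have := sq_integral_density_mul_le (mollKernel_nonneg n) (integrable_mollKernel n)
    (integral_mollKernel n) i1 i2
  refine le_trans (le_of_eq ?_) this
  congr 1
  simp only [mul_sub]
  rw [integral_sub i0 ((integrable_mollKernel n).mul_const _), integral_mul_const,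
    integral_mollKernel, one_mul]
  rfl

theorem norm_le_of_mollKernel_ne_zero {n : ℕ} {y : E} (h : mollKernel E n y ≠ 0) :
    ‖y‖ ≤ 2 / (n + 1) := by
  have h1 : y ∈ Function.support (mollKernel E n) := h
  rw [mollKernel, ContDiffBump.support_normed_eq] at h1
  exact (mem_ball_zero_iff.1 h1).le

/-- A mollification error is an average of translation errors, and the kernel only sees translations
of length at most `2/(n+1)`. -/
theorem lintegral_sq_mollify_sub_le {u : E → ℝ} (hu : ContDiff ℝ ∞ u) (n : ℕ) :
    ∫⁻ x, ENNReal.ofReal ((mollify n u x - u x) ^ 2)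
      ≤ ENNReal.ofReal ((2 / (n + 1 : ℝ)) ^ 2) * ∫⁻ x, ENNReal.ofReal (‖fderiv ℝ u x‖ ^ 2) := by
  have hk := (contDiff_mollKernel (E := E) n).continuous
  have hkc := hasCompactSupport_mollKernel (E := E) n
  have hu0 := hu.continuous
  set D := ∫⁻ x, ENNReal.ofReal (‖fderiv ℝ u x‖ ^ 2)
  calc ∫⁻ x, ENNReal.ofReal ((mollify n u x - u x) ^ 2)
      ≤ ∫⁻ x, ∫⁻ y, ENNReal.ofReal (mollKernel E n y * (u (x - y) - u x) ^ 2) := by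
        refine lintegral_mono fun x => ?_
        have i2 : Integrable fun y => mollKernel E n y * (u (x - y) - u x) ^ 2 :=
          (hk.mul (by fun_prop)).integrable_of_hasCompactSupport hkc.mul_right
        rw [← ofReal_integral_eq_lintegral_ofReal i2 (Eventually.of_forall fun t =>
          mul_nonneg (mollKernel_nonneg n t) (sq_nonneg _))]
        exact ENNReal.ofReal_le_ofReal (sq_mollify_sub_le hu0 n x)
    _ = ∫⁻ y, ∫⁻ x, ENNReal.ofReal (mollKernel E n y * (u (x - y) - u x) ^ 2) := by
        refine lintegral_lintegral_swap ?_
        have : Continuous fun p : E × E => mollKernel E n p.2 * (u (p.1 - p.2) - u p.1) ^ 2 := by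
          fun_prop
        exact this.measurable.ennreal_ofReal.aemeasurable
    _ ≤ ∫⁻ y, ENNReal.ofReal (mollKernel E n y)
          * (ENNReal.ofReal ((2 / (n + 1 : ℝ)) ^ 2) * D) := by
        refine lintegral_mono fun y => ?_
        simp only
        simp only [ENNReal.ofReal_mul (mollKernel_nonneg n y)]
        rw [lintegral_const_mul _ (by
          have : Continuous fun x => (u (x - y) - u x) ^ 2 := by fun_prop
          exact this.measurable.ennreal_ofReal)]
        by_cases h : mollKernel E n y = 0
        · simp [h]
        · gcongr
          refine (lintegral_sq_sub_le hu y).trans ?_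
          gcongr
          exact norm_le_of_mollKernel_ne_zero h
    _ = _ := by
        rw [lintegral_mul_const _ hk.measurable.ennreal_ofReal,
          ← ofReal_integral_eq_lintegral_ofReal (integrable_mollKernel n)
            (Eventually.of_forall (mollKernel_nonneg n)), integral_mollKernel]
        simp

theorem mollify_sub (n : ℕ) {f g : E → ℝ} (hf : LocallyIntegrable f) (hg : LocallyIntegrable g)
    (x : E) : mollify n (fun x => f x - g x) x = mollify n f x - mollify n g x := by
  simp only [mollify_apply, smul_sub]
  exact integral_sub (integrable_mollKernel_smul n hf x) (integrable_mollKernel_smul n hg x)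

end Translation

/-! ### Compactness of tight sequences bounded in `H¹`. -/

section Rellich

/-- The estimate for smooth functions passes to `H¹` by density. Its use is uniformity: the
mollification error depends on `f` only through the gradient norm, so a single mollifier works for a
whole bounded sequence. -/
theorem integral_sq_mollify_sub_le {f : Plane → ℝ} {G : Fin 2 → Plane → ℝ} (hf : MemLp f 2)
    (hG : ∀ i, MemLp (G i) 2) (h : ∀ i, HasWeakDeriv (planeBasis i) f (G i)) (n : ℕ) :
    ∫ x, (mollify n f x - f x) ^ 2 ≤ (2 / (n + 1 : ℝ)) ^ 2 * ∑ i, ∫ x, G i x ^ 2 := by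
  obtain ⟨ψ, hψ, hψc, -, hl, hl'⟩ := exists_smooth_approx hf hG h
  have m0 := fun n => memLp_of_hasCompactSupport (hψ n).continuous (hψc n)
  have m1 := fun i n => memLp_of_hasCompactSupport (contDiff_fderiv_apply (hψ n) (planeBasis i))
    ((hψc n).fderiv_apply ℝ (planeBasis i))
  have mD := fun k => memLp_of_hasCompactSupport ((hψ k).continuous_fderiv (by simp))
    ((hψc k).fderiv ℝ)
  have mm := fun k => (memLp_mollify n (m0 k)).sub (m0 k)
  have mf := (memLp_mollify n hf).sub hf
  have hb : ∀ k, ∫ x, (mollify n (ψ k) x - ψ k x) ^ 2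
      ≤ (2 / (n + 1 : ℝ)) ^ 2 * ∑ i, ∫ x, fderiv ℝ (ψ k) x (planeBasis i) ^ 2 := fun k => by
    have h1 := lintegral_sq_mollify_sub_le (hψ k) n
    rw [← ofReal_integral_eq_lintegral_ofReal (mD k).integrable_normSq
      (Eventually.of_forall fun t => by positivity), ← ENNReal.ofReal_mul (by positivity)] at h1
    have h2 : ENNReal.ofReal (∫ x, (mollify n (ψ k) x - ψ k x) ^ 2) ≤ _ :=
      (ofReal_integral_eq_lintegral_ofReal (mm k).integrable_sq_real
        (Eventually.of_forall fun t => sq_nonneg _)).trans_le h1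
    rw [ENNReal.ofReal_le_ofReal_iff (mul_nonneg (by positivity)
      (integral_nonneg fun x => by positivity))] at h2
    refine h2.trans (mul_le_mul_of_nonneg_left ?_ (by positivity))
    rw [← integral_finsetSum _ fun i _ => (m1 i k).integrable_sq_real]
    exact integral_mono (mD k).integrable_normSq
      (integrable_finsetSum _ fun i _ => (m1 i k).integrable_sq_real)
      fun x => plane_functional_normSq_le _
  have hlim1 : Tendsto (fun k => ∫ x, ‖(mollify n (ψ k) - ψ k) x - (mollify n f - f) x‖ ^ 2) atTop
      (𝓝 0) := by
    -- Mollification is a contraction in `L²`, so the squared norm of `mollify g - g` is at most `2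
    -- + 2 = 4` times that of `g`.
    have h4 := hl.const_mul 4
    rw [mul_zero] at h4
    refine squeeze_zero (fun k => integral_nonneg fun x => by positivity) (fun k => ?_) h4
    have md := (m0 k).sub hf
    have e : ∀ x, (mollify n (ψ k) - ψ k) x - (mollify n f - f) x
        = mollify n (fun x => ψ k x - f x) x + -(ψ k - f) x := fun x => by
      rw [mollify_sub n (m0 k).locallyIntegrable_two hf.locallyIntegrable_two]
      simp only [Pi.sub_apply]; ring
    simp only [e]
    have h5 := integral_normSq_add_le (memLp_mollify n md) md.neg
    have h6 := integral_normSq_mollify_le n md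
    simp only [Pi.neg_apply, norm_neg, Pi.sub_apply] at h5 h6 ⊢
    refine h5.trans ?_
    have e2 : (ψ k - f) = fun x => ψ k x - f x := rfl
    rw [e2] at h6 ⊢
    linarith
  have hlim2 := tendsto_integral_sq_of_tendsto_L2 mm mf hlim1
  have hlim3 : Tendsto (fun k => ∑ i, ∫ x, fderiv ℝ (ψ k) x (planeBasis i) ^ 2) atTop
      (𝓝 (∑ i, ∫ x, G i x ^ 2)) := tendsto_finsetSum _ fun i _ =>
    tendsto_integral_sq_of_tendsto_L2 (m1 i) (hG i) (hl' i)
  exact le_of_tendsto_of_tendsto' hlim2 (hlim3.const_mul _) hb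

theorem tendsto_setIntegral_compl_closedBall {f : Plane → ℝ} (hf : Integrable f) :
    Tendsto (fun n : ℕ => ∫ x in (Metric.closedBall 0 (n : ℝ))ᶜ, f x) atTop (𝓝 0) := by
  have h : Tendsto (fun n : ℕ => ∫ x in (Metric.closedBall (0 : Plane) (n : ℝ))ᶜ, f x) atTop
      (𝓝 (∫ x in ⋂ n : ℕ, (Metric.closedBall (0 : Plane) (n : ℝ))ᶜ, f x)) := by
    refine tendsto_setIntegral_of_antitone (fun n => measurableSet_closedBall.compl) ?_
      ⟨0, hf.integrableOn⟩
    intro m n hmn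
    exact Set.compl_subset_compl.2 (Metric.closedBall_subset_closedBall (by exact_mod_cast hmn))
  have e : (⋂ n : ℕ, (Metric.closedBall (0 : Plane) (n : ℝ))ᶜ) = ∅ := by
    rw [← Set.compl_iUnion, Metric.iUnion_closedBall_nat, Set.compl_univ]
  rw [e] at h
  simpa using h

/-- Rellich's theorem: a tight sequence bounded in `H¹` has a subsequence converging in `L²`. -/
theorem exists_tendsto_L2_of_tight {f : ℕ → Plane → ℝ} {G : ℕ → Fin 2 → Plane → ℝ} {C : ℝ}
    (hf : ∀ n, MemLp (f n) 2) (hG : ∀ n i, MemLp (G n i) 2)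
    (h : ∀ n i, HasWeakDeriv (planeBasis i) (f n) (G n i)) (hC : ∀ n, ∫ x, f n x ^ 2 ≤ C)
    (hGC : ∀ n, ∑ i, ∫ x, G n i x ^ 2 ≤ C)
    (htight : ∀ ε > 0, ∃ R : ℝ, ∀ n, ∫ x in (Metric.closedBall 0 R)ᶜ, f n x ^ 2 ≤ ε) :
    ∃ (f₀ : Plane → ℝ) (φ : ℕ → ℕ), MemLp f₀ 2 ∧ StrictMono φ ∧
      Tendsto (fun n => ∫ x, ‖f (φ n) x - f₀ x‖ ^ 2) atTop (𝓝 0) := by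
  obtain ⟨f₀, φ, hf₀, hφ, hw⟩ := exists_weak_limit hf hC
  refine ⟨f₀, φ, hf₀, hφ, ?_⟩
  have hC0 : 0 ≤ C := (integral_nonneg fun x => sq_nonneg _).trans (hC 0)
  -- mollifications converge on balls
  have hball : ∀ (m : ℕ) (R : ℝ), Tendsto (fun n => ∫ x in Metric.closedBall (0 : Plane) R,
      (mollify m (f (φ n)) x - mollify m f₀ x) ^ 2) atTop (𝓝 0) := fun m R => by
    -- For fixed `m` and `x` the mollified value is a pairing with a fixed `L²` function, so weak
    -- convergence gives pointwise convergence. The uniform bound `hbd` then allows dominated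
    -- convergence on a ball.
    have hpt : ∀ x, Tendsto (fun n => mollify m (f (φ n)) x) atTop (𝓝 (mollify m f₀ x)) :=
      fun x => by
      have mk : MemLp (fun y => mollKernel Plane m (x - y)) 2 :=
        memLp_of_hasCompactSupport ((contDiff_mollKernel m).continuous.comp (by fun_prop))
          ((hasCompactSupport_mollKernel (E := Plane) m).comp_homeomorph (Homeomorph.subLeft x))
      have := hw _ mk
      simp only [mollify_apply', smul_eq_mul]
      simpa only [mul_comm] using this
    have hbd : ∀ g : Plane → ℝ, MemLp g 2 → ∀ x, mollify m g x ^ 2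
        ≤ (∫ y, mollKernel Plane m y ^ 2) * ∫ y, g y ^ 2 := fun g hg x => by
      have mk : MemLp (fun y => mollKernel Plane m (x - y)) 2 :=
        memLp_of_hasCompactSupport ((contDiff_mollKernel m).continuous.comp (by fun_prop))
          ((hasCompactSupport_mollKernel (E := Plane) m).comp_homeomorph (Homeomorph.subLeft x))
      have := sq_integral_mul_le mk hg
      rw [integral_sub_left_eq_self (fun y => mollKernel Plane m y ^ 2)] at this
      rw [mollify_apply']
      exact this
    set K := ∫ y, mollKernel Plane m y ^ 2
    have hK : 0 ≤ K := integral_nonneg fun x => sq_nonneg _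
    have hcm : ∀ g : Plane → ℝ, MemLp g 2 → Continuous (mollify m g) := fun g hg =>
      (contDiff_mollify m hg.locallyIntegrable_two).continuous
    have : Tendsto (fun n => ∫ x in Metric.closedBall (0 : Plane) R,
        (mollify m (f (φ n)) x - mollify m f₀ x) ^ 2) atTop
        (𝓝 (∫ _ in Metric.closedBall (0 : Plane) R, (0 : ℝ))) := by
      refine tendsto_integral_of_dominated_convergence
        (fun _ => 2 * (K * C) + 2 * (K * ∫ y, f₀ y ^ 2))
        (fun n => (((hcm _ (hf _)).sub (hcm _ hf₀)).pow 2).aestronglyMeasurable) ?_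
        (fun n => Eventually.of_forall fun x => ?_) (Eventually.of_forall fun x => ?_)
      · exact integrableOn_const (hs := (isCompact_closedBall _ _).measure_lt_top.ne)
      · rw [Real.norm_of_nonneg (sq_nonneg _)]
        have h1 := hbd _ (hf (φ n)) x
        have h2 := hbd _ hf₀ x
        have h3 := mul_le_mul_of_nonneg_left (hC (φ n)) hK
        nlinarith [sq_nonneg (mollify m (f (φ n)) x + mollify m f₀ x)]
      · have := ((hpt x).sub_const (mollify m f₀ x)).pow 2
        simpa using this
    simpa using this
  -- Error budget: outside the ball `2 · ε/20 + 2 · ε/20 = ε/5`; inside it three terms, each with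
  -- weight `3` and size `ε/20`, giving `9ε/20`. The sum is below `ε`.
  rw [Metric.tendsto_atTop]
  intro ε hε
  -- choose the radius
  obtain ⟨R₁, hR₁⟩ := htight (ε / 20) (by positivity)
  obtain ⟨R₂, hR₂⟩ := (((tendsto_setIntegral_compl_closedBall hf₀.integrable_sq_real).eventually_lt_const
    (by positivity : (0 : ℝ) < ε / 20)).and (tendsto_natCast_atTop_atTop.eventually_ge_atTop R₁)).exists
  set S := Metric.closedBall (0 : Plane) (R₂ : ℝ) with hS
  -- choose the mollifier
  have hm1 : Tendsto (fun m : ℕ => (2 / ((m : ℝ) + 1)) ^ 2 * C) atTop (𝓝 0) := by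
    have h1 := (((tendsto_one_div_add_atTop_nhds_zero_nat (𝕜 := ℝ)).const_mul 2).pow 2).mul_const C
    simp only [mul_zero, mul_one_div] at h1
    simpa using h1
  obtain ⟨m, hm, hm'⟩ := ((hm1.eventually_lt_const (by positivity : (0 : ℝ) < ε / 20)).and
    ((tendsto_mollify hf₀).eventually_lt_const (by positivity : (0 : ℝ) < ε / 20))).exists
  obtain ⟨N, hN⟩ := eventually_atTop.1
    ((hball m R₂).eventually_lt_const (by positivity : (0 : ℝ) < ε / 20))
  refine ⟨N, fun n hn => ?_⟩
  have md := (hf (φ n)).sub hf₀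
  rw [Real.dist_eq, sub_zero, abs_of_nonneg (integral_nonneg fun x => by positivity)]
  have hsplit := integral_add_compl (measurableSet_closedBall (x := (0 : Plane)) (ε := (R₂ : ℝ)))
    md.integrable_normSq
  simp only [Pi.sub_apply] at hsplit
  rw [← hsplit]
  -- outside
  have hout : ∫ x in Sᶜ, ‖f (φ n) x - f₀ x‖ ^ 2 ≤ ε / 5 := by
    have h1 : ∫ x in Sᶜ, ‖f (φ n) x - f₀ x‖ ^ 2
        ≤ ∫ x in Sᶜ, (2 * f (φ n) x ^ 2 + 2 * f₀ x ^ 2) := by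
      refine integral_mono md.integrable_normSq.integrableOn
        (integrable_comb_two 2 2 (hf _).integrable_sq_real
          hf₀.integrable_sq_real).integrableOn fun x => ?_
      simp only [Real.norm_eq_abs, sq_abs]
      nlinarith [sq_nonneg (f (φ n) x + f₀ x)]
    rw [integral_comb_two 2 2 (hf _).integrable_sq_real.integrableOn
      hf₀.integrable_sq_real.integrableOn] at h1
    have h2 : ∫ x in Sᶜ, f (φ n) x ^ 2 ≤ ε / 20 := by
      refine le_trans ?_ (hR₁ (φ n))
      refine setIntegral_mono_set (hf _).integrable_sq_real.integrableOn
        (Eventually.of_forall fun x => sq_nonneg _) ?_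
      exact (Set.compl_subset_compl.2 (Metric.closedBall_subset_closedBall hR₂.2)).eventuallyLE
    linarith [hR₂.1]
  -- inside
  have hin : ∫ x in S, ‖f (φ n) x - f₀ x‖ ^ 2 ≤ 9 * ε / 20 := by
    have a1 := ((memLp_mollify m (hf (φ n))).sub (hf (φ n))).integrable_sq_real
    have a2 := ((memLp_mollify m (hf (φ n))).sub (memLp_mollify m hf₀)).integrable_sq_real
    have a3 := ((memLp_mollify m hf₀).sub hf₀).integrable_sq_real
    simp only [Pi.sub_apply] at a1 a2 a3
    have h1 : ∫ x in S, ‖f (φ n) x - f₀ x‖ ^ 2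
        ≤ ∫ x in S, (3 * (mollify m (f (φ n)) x - f (φ n) x) ^ 2
          + 3 * (mollify m (f (φ n)) x - mollify m f₀ x) ^ 2
          + 3 * (mollify m f₀ x - f₀ x) ^ 2) := by
      refine integral_mono md.integrable_normSq.integrableOn
        (integrable_comb_three 3 3 3 a1 a2 a3).integrableOn fun x => ?_
      simp only [Real.norm_eq_abs, sq_abs]
      set p := mollify m (f (φ n)) x - f (φ n) x
      set q := mollify m (f (φ n)) x - mollify m f₀ x
      set r := mollify m f₀ x - f₀ x
      have e : f (φ n) x - f₀ x = -p + q + r := by ring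
      rw [e]
      nlinarith [sq_nonneg (p + q), sq_nonneg (p + r), sq_nonneg (q - r)]
    rw [integral_comb_three 3 3 3 a1.integrableOn a2.integrableOn a3.integrableOn] at h1
    have h2 : ∫ x in S, (mollify m (f (φ n)) x - f (φ n) x) ^ 2 ≤ ε / 20 := by
      refine (setIntegral_le_integral a1 (Eventually.of_forall fun x => sq_nonneg _)).trans ?_
      refine (integral_sq_mollify_sub_le (hf _) (hG _) (h _) m).trans (le_trans ?_ hm.le)
      exact mul_le_mul_of_nonneg_left (hGC _) (by positivity)
    have h3 : ∫ x in S, (mollify m f₀ x - f₀ x) ^ 2 ≤ ε / 20 := by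
      refine (setIntegral_le_integral a3 (Eventually.of_forall fun x => sq_nonneg _)).trans ?_
      simpa only [Real.norm_eq_abs, sq_abs] using hm'.le
    have h4 := (hN n hn).le
    linarith
  linarith

end Rellich

/-! ### Lower bounds on the trap potential. -/

section Trap

theorem IsTransverseTrap.exists_lower_bound {W : Plane → ℝ} (hW : IsTransverseTrap W) (K : ℝ) :
    ∃ R : ℝ, ∀ x : Plane, R < ‖x‖ → K ≤ W x := by
  have h := hW.tendsto_atTop.eventually_ge_atTop K
  rw [Filter.eventually_iff, Metric.mem_cocompact_iff_closedBall_compl_subset (0 : Plane)] at h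
  obtain ⟨R, hR⟩ := h
  exact ⟨R, fun x hx => hR (by simpa using hx)⟩

theorem IsTransverseTrap.exists_neg_le {W : Plane → ℝ} (hW : IsTransverseTrap W) :
    ∃ c : ℝ, 0 ≤ c ∧ ∀ x, -c ≤ W x := by
  obtain ⟨R, hR⟩ := hW.exists_lower_bound 0
  obtain ⟨C, hC⟩ := hW.locallyBounded R
  refine ⟨|C|, abs_nonneg C, fun x => ?_⟩
  by_cases hx : ‖x‖ ≤ R
  · have := abs_le.1 ((hC x hx).trans (le_abs_self C))
    exact this.1
  · have := hR x (not_le.1 hx)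
    linarith [abs_nonneg C]

end Trap

/-- Membership of a real function in the form domain of `-Δ^⊥ + W`. -/
structure FormDomain (W : Plane → ℝ) (ψ : Plane → ℝ) (G : Fin 2 → Plane → ℝ) : Prop where
  memLp : MemLp ψ 2
  grad : ∀ i, MemLp (G i) 2
  weak : ∀ i, HasWeakDeriv (planeBasis i) ψ (G i)
  pot : Integrable fun x => W x * ψ x ^ 2

/-- The bilinear form of `-Δ^⊥ + W - e^⊥`. -/
noncomputable def excessForm (W : Plane → ℝ) (ψ : Plane → ℝ) (G : Fin 2 → Plane → ℝ)
    (φ : Plane → ℝ) (H : Fin 2 → Plane → ℝ) : ℝ :=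
  (∑ i, ∫ x, G i x * H i x) + (∫ x, W x * (ψ x * φ x)) - ePerp W * ∫ x, ψ x * φ x

/-- The quadratic form of `-Δ^⊥ + W - e^⊥`. -/
noncomputable def excess (W : Plane → ℝ) (ψ : Plane → ℝ) (G : Fin 2 → Plane → ℝ) : ℝ :=
  (∑ i, ∫ x, G i x ^ 2) + (∫ x, W x * ψ x ^ 2) - ePerp W * ∫ x, ψ x ^ 2

/-! ### The nonnegative quadratic form of `-Δ^⊥ + W - e^⊥` and its null vectors. -/

section FormAlgebra

variable {W : Plane → ℝ} {ψ φ : Plane → ℝ} {G H : Fin 2 → Plane → ℝ}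

theorem FormDomain.integrable_cross (hWm : Measurable W) (hψ : FormDomain W ψ G)
    (hφ : FormDomain W φ H) : Integrable fun x => W x * (ψ x * φ x) := by
  refine (hψ.pot.norm.add hφ.pot.norm).mono' (hWm.aestronglyMeasurable.mul
    (hψ.memLp.1.mul hφ.memLp.1)) (Eventually.of_forall fun x => ?_)
  simp only [Pi.add_apply, norm_mul, norm_pow, Real.norm_eq_abs]
  rw [← mul_add]
  refine mul_le_mul_of_nonneg_left ?_ (abs_nonneg _)
  nlinarith [sq_nonneg (|ψ x| - |φ x|), sq_nonneg (|ψ x|), sq_nonneg (|φ x|)]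

theorem FormDomain.comb (hWm : Measurable W) (hψ : FormDomain W ψ G) (hφ : FormDomain W φ H)
    (s t : ℝ) : FormDomain W (fun x => s * ψ x + t * φ x) (fun i x => s * G i x + t * H i x) where
  memLp := (hψ.memLp.const_mul s).add (hφ.memLp.const_mul t)
  grad i := ((hψ.grad i).const_mul s).add ((hφ.grad i).const_mul t)
  weak i := (hψ.weak i).comb (hφ.weak i) s t
  pot := by
    have := integrable_comb_three (s ^ 2) (2 * s * t) (t ^ 2) hψ.pot
      (hψ.integrable_cross hWm hφ) hφ.pot
    refine this.congr (Eventually.of_forall fun x => ?_)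
    simp only; ring

theorem excess_comb (hWm : Measurable W) (hψ : FormDomain W ψ G) (hφ : FormDomain W φ H)
    (s t : ℝ) :
    excess W (fun x => s * ψ x + t * φ x) (fun i x => s * G i x + t * H i x)
      = s ^ 2 * excess W ψ G + 2 * s * t * excessForm W ψ G φ H + t ^ 2 * excess W φ H := by
  have e1 : ∀ i, ∫ x, (s * G i x + t * H i x) ^ 2 = s ^ 2 * (∫ x, G i x ^ 2)
      + 2 * s * t * (∫ x, G i x * H i x) + t ^ 2 * ∫ x, H i x ^ 2 := fun i => by
    rw [← integral_comb_three _ _ _ (hψ.grad i).integrable_sq_real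
      ((hψ.grad i).integrable_mul_real (hφ.grad i)) (hφ.grad i).integrable_sq_real]
    congr 1; ext x; ring
  have e2 : ∫ x, W x * (s * ψ x + t * φ x) ^ 2 = s ^ 2 * (∫ x, W x * ψ x ^ 2)
      + 2 * s * t * (∫ x, W x * (ψ x * φ x)) + t ^ 2 * ∫ x, W x * φ x ^ 2 := by
    rw [← integral_comb_three _ _ _ hψ.pot (hψ.integrable_cross hWm hφ) hφ.pot]
    congr 1; ext x; ring
  have e3 : ∫ x, (s * ψ x + t * φ x) ^ 2 = s ^ 2 * (∫ x, ψ x ^ 2)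
      + 2 * s * t * (∫ x, ψ x * φ x) + t ^ 2 * ∫ x, φ x ^ 2 := by
    rw [← integral_comb_three _ _ _ hψ.memLp.integrable_sq_real
      (hψ.memLp.integrable_mul_real hφ.memLp) hφ.memLp.integrable_sq_real]
    congr 1; ext x; ring
  simp only [excess, excessForm, e1, e2, e3, Fin.sum_univ_two]
  ring

theorem integral_pot_ge {c : ℝ} (hc : ∀ x, -c ≤ W x) (hψ : FormDomain W ψ G) :
    -c * (∫ x, ψ x ^ 2) ≤ ∫ x, W x * ψ x ^ 2 := by
  rw [← integral_const_mul]
  refine integral_mono (hψ.memLp.integrable_sq_real.const_mul _) hψ.pot fun x => ?_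
  exact mul_le_mul_of_nonneg_right (hc x) (sq_nonneg _)

theorem HasWeakDeriv.ofReal {E : Type*} [NormedAddCommGroup E] [NormedSpace ℝ E] [MeasureSpace E]
    {v : E} {f f' : E → ℝ} (h : HasWeakDeriv v f f') :
    HasWeakDeriv v (fun x => (f x : ℂ)) (fun x => (f' x : ℂ)) := by
  refine ⟨fun x => let ⟨t, ht, hi⟩ := h.1 x; ⟨t, ht, hi.ofReal⟩,
    fun x => let ⟨t, ht, hi⟩ := h.2.1 x; ⟨t, ht, hi.ofReal⟩, fun η hη hc => ?_⟩
  have key := h.2.2 η hη hc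
  have e1 : ∀ (s : ℝ) (t : ℝ), s • (t : ℂ) = ((s • t : ℝ) : ℂ) := fun s t => by simp
  simp only [e1]
  rw [integral_complex_ofReal, integral_complex_ofReal, key]
  simp

theorem bddBelow_transEnergy (hW : IsTransverseTrap W) :
    BddBelow {e | ∃ (ψ : Plane → ℂ) (G : Fin 2 → Plane → ℂ),
      TransAdmissible W ψ G ∧ transEnergy W ψ G = e} := by
  obtain ⟨c, hc0, hc⟩ := hW.exists_neg_le
  refine ⟨-c, ?_⟩
  rintro _ ⟨ψ, G, h, rfl⟩
  have h1 : -c = ∫ x, -c * ‖ψ x‖ ^ 2 := by rw [integral_const_mul, h.normalized, mul_one]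
  rw [h1]
  refine integral_mono (h.memLp.integrable_normSq.const_mul _)
    ((integrable_finsetSum _ fun i _ => (h.grad_memLp i).integrable_normSq).add h.potential)
    fun x => ?_
  have h2 := mul_le_mul_of_nonneg_right (hc x) (sq_nonneg ‖ψ x‖)
  have h3 : 0 ≤ ∑ i, ‖G i x‖ ^ 2 := Finset.sum_nonneg fun i _ => sq_nonneg _
  show -c * ‖ψ x‖ ^ 2 ≤ (∑ i, ‖G i x‖ ^ 2) + W x * ‖ψ x‖ ^ 2
  linarith

/-- After normalization this is the definition of `ePerp` as an infimum; a real function competes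
there through its embedding in the complex ones. A function of zero norm cannot be normalized, but
then only the gradient term remains. -/
theorem FormDomain.excess_nonneg (hW : IsTransverseTrap W) (hψ : FormDomain W ψ G) :
    0 ≤ excess W ψ G := by
  have hG0 : 0 ≤ ∑ i, ∫ x, G i x ^ 2 :=
    Finset.sum_nonneg fun i _ => integral_nonneg fun x => sq_nonneg _
  have hN0 : 0 ≤ ∫ x, ψ x ^ 2 := integral_nonneg fun x => sq_nonneg _
  rcases hN0.eq_or_lt with hN | hN
  · have h1 : ∀ᵐ x, ψ x ^ 2 = 0 :=
      (integral_eq_zero_iff_of_nonneg (fun x => sq_nonneg _) hψ.memLp.integrable_sq_real).1 hN.symm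
    have h2 : ∫ x, W x * ψ x ^ 2 = 0 := by
      rw [integral_eq_zero_of_ae]
      filter_upwards [h1] with x hx
      simp [hx]
    rw [excess, h2, ← hN]
    simpa using hG0
  · set N := ∫ x, ψ x ^ 2 with hNdef
    set s : ℝ := 1 / √N with hs
    have hs2 : s ^ 2 = 1 / N := by rw [hs, div_pow, Real.sq_sqrt hN.le, one_pow]
    have hh := hψ.comb hW.measurable hψ s 0
    simp only [zero_mul, add_zero] at hh
    have hadm : TransAdmissible W (fun x => ((s * ψ x : ℝ) : ℂ))
        (fun i x => ((s * G i x : ℝ) : ℂ)) := by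
      refine ⟨hh.memLp.ofReal, fun i => (hh.grad i).ofReal, fun i => (hh.weak i).ofReal, ?_, ?_⟩
      · simpa only [Complex.norm_real, Real.norm_eq_abs, sq_abs] using hh.pot
      · simp only [Complex.norm_real, Real.norm_eq_abs, sq_abs, mul_pow]
        rw [integral_const_mul, hs2, ← hNdef]
        field_simp
    have hle : ePerp W ≤ _ := csInf_le (bddBelow_transEnergy hW) ⟨_, _, hadm, rfl⟩
    have he : transEnergy W (fun x => ((s * ψ x : ℝ) : ℂ)) (fun i x => ((s * G i x : ℝ) : ℂ))
        = s ^ 2 * ((∑ i, ∫ x, G i x ^ 2) + ∫ x, W x * ψ x ^ 2) := by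
      rw [transEnergy]
      simp only [Complex.norm_real, Real.norm_eq_abs, sq_abs]
      rw [integral_add (integrable_finsetSum _ fun i _ => (hh.grad i).integrable_sq_real) hh.pot,
        integral_finsetSum _ fun i _ => (hh.grad i).integrable_sq_real]
      simp only [mul_pow, integral_const_mul, mul_left_comm (W _)]
      rw [← Finset.mul_sum, mul_add]
    rw [he, hs2, one_div_mul_eq_div, le_div_iff₀ hN] at hle
    rw [excess]
    linarith

/-- Cauchy-Schwarz for a nonnegative form: if `u` is null, the form at `ψ + t u` is affine in `t`
and bounded below, so its slope vanishes. -/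
theorem FormDomain.form_eq_zero (hW : IsTransverseTrap W) {u : Plane → ℝ}
    {U : Fin 2 → Plane → ℝ} (hu : FormDomain W u U) (hu0 : excess W u U = 0)
    (hψ : FormDomain W ψ G) : excessForm W ψ G u U = 0 := by
  have h : ∀ t : ℝ, 0 ≤ excess W ψ G + 2 * t * excessForm W ψ G u U := fun t => by
    have h1 := (hψ.comb hW.measurable hu 1 t).excess_nonneg hW
    rw [excess_comb hW.measurable hψ hu, hu0] at h1
    linarith
  by_contra hne
  -- With this `t` the affine function takes the value `-1`.
  have h1 := h (-(excess W ψ G + 1) / (2 * excessForm W ψ G u U))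
  have e : 2 * (-(excess W ψ G + 1) / (2 * excessForm W ψ G u U)) * excessForm W ψ G u U
      = -(excess W ψ G + 1) := by field_simp
  rw [e] at h1
  linarith

theorem excess_add_null (hW : IsTransverseTrap W) {u : Plane → ℝ}
    {U : Fin 2 → Plane → ℝ} (hu : FormDomain W u U) (hu0 : excess W u U = 0)
    (hψ : FormDomain W ψ G) (s t : ℝ) :
    excess W (fun x => s * ψ x + t * u x) (fun i x => s * G i x + t * U i x)
      = s ^ 2 * excess W ψ G := by
  rw [excess_comb hW.measurable hψ hu, hu0, hu.form_eq_zero hW hu0 hψ]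
  ring

/-- The formula for the weak gradient of `|ψ|` shows that it is pointwise no larger than that of
`ψ`, while potential and mass are unchanged. -/
theorem FormDomain.abs (hψ : FormDomain W ψ G) :
    ∃ H, FormDomain W (fun x => |ψ x|) H ∧ excess W (fun x => |ψ x|) H ≤ excess W ψ G := by
  refine ⟨fun i x => inner ℝ (ψ x - 0) (G i x) / ‖ψ x - 0‖, ⟨hψ.memLp.norm,
    fun i => hψ.memLp.inner_div_norm (hψ.grad i) 0, fun i => ?_, ?_⟩, ?_⟩
  · have := (hψ.weak i).norm_sub_const hψ.memLp (hψ.grad i) 0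
    simp only [sub_zero] at this ⊢
    exact this
  · simpa only [sq_abs] using hψ.pot
  · simp only [excess, sq_abs]
    refine sub_le_sub_right (add_le_add_left (Finset.sum_le_sum fun i _ => ?_) _) _
    refine integral_mono (hψ.memLp.inner_div_norm (hψ.grad i) 0).integrable_sq_real
      (hψ.grad i).integrable_sq_real fun x => ?_
    have := abs_inner_div_norm_le (ψ x - 0) (G i x)
    rw [Real.norm_eq_abs] at this
    exact sq_le_sq.2 this

/-- Local boundedness of `W` makes its product with `η²` integrable. -/
theorem formDomain_of_contDiff (hW : IsTransverseTrap W) {η : Plane → ℝ} (hη : ContDiff ℝ ∞ η)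
    (hc : HasCompactSupport η) :
    FormDomain W η (fun i x => fderiv ℝ η x (planeBasis i)) where
  memLp := memLp_of_hasCompactSupport hη.continuous hc
  grad i := memLp_of_hasCompactSupport (contDiff_fderiv_apply hη _) (hc.fderiv_apply ℝ _)
  weak i := hasWeakDeriv_of_contDiff (hη.of_le (by simp)) _
  pot := by
    obtain ⟨R, hR⟩ := hc.isCompact.isBounded.subset_closedBall (0 : Plane)
    obtain ⟨C, hC⟩ := hW.locallyBounded R
    refine ((memLp_of_hasCompactSupport hη.continuous hc).integrable_sq_real.const_mul C).mono'
      (hW.measurable.aestronglyMeasurable.mul (hη.continuous.pow 2).aestronglyMeasurable)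
      (Eventually.of_forall fun x => ?_)
    rw [norm_mul, Real.norm_of_nonneg (sq_nonneg (η x))]
    by_cases hx : η x = 0
    · simp [hx]
    · refine mul_le_mul_of_nonneg_right (hC x ?_) (sq_nonneg _)
      exact mem_closedBall_zero_iff.1 (hR (subset_tsupport _ hx))

end FormAlgebra

/-! ### Strict positivity of nonnegative null vectors. -/

section Positivity

variable {W : Plane → ℝ} {ψ φ : Plane → ℝ} {G H : Fin 2 → Plane → ℝ}

/-- The parallelogram identity: the forms at `(ψ - φ)/2` and `(ψ + φ)/2` are nonnegative, and their
sum is the mean of the forms at `ψ` and `φ`. -/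
theorem excess_half_sub_le (hW : IsTransverseTrap W) (hψ : FormDomain W ψ G)
    (hφ : FormDomain W φ H) (hle : excess W φ H ≤ excess W ψ G) :
    excess W (fun x => 1 / 2 * ψ x + -1 / 2 * φ x) (fun i x => 1 / 2 * G i x + -1 / 2 * H i x)
      ≤ excess W ψ G := by
  have h0 := (hψ.comb hW.measurable hφ (1 / 2) (1 / 2)).excess_nonneg hW
  rw [excess_comb hW.measurable hψ hφ] at h0 ⊢
  linarith

/-- As `W` is bounded below, the potential can lower the form by at most a multiple of the mass, so
the excess controls the gradient. -/
theorem exists_grad_bound (hW : IsTransverseTrap W) : ∃ c, 0 ≤ c ∧ ∀ (ψ : Plane → ℝ)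
    (G : Fin 2 → Plane → ℝ), FormDomain W ψ G →
      ∑ i, ∫ x, G i x ^ 2 ≤ excess W ψ G + c * ∫ x, ψ x ^ 2 := by
  obtain ⟨c, hc0, hc⟩ := hW.exists_neg_le
  refine ⟨c + |ePerp W|, by positivity, fun ψ G h => ?_⟩
  have h1 := integral_pot_ge hc h
  have h2 : 0 ≤ ∫ x, ψ x ^ 2 := integral_nonneg fun x => sq_nonneg _
  have h3 := mul_le_mul_of_nonneg_right (le_abs_self (ePerp W)) h2
  rw [excess]
  linarith

/-- The minimum of a test function and a multiple of a null vector is bounded in energy. -/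
theorem exists_truncation (hW : IsTransverseTrap W) {u : Plane → ℝ} {U : Fin 2 → Plane → ℝ}
    (hu : FormDomain W u U) (hu0 : excess W u U = 0) (hφ : FormDomain W φ H) (n : ℕ) :
    ∃ M : Fin 2 → Plane → ℝ, FormDomain W (fun x => min (φ x) (n * u x)) M ∧
      excess W (fun x => min (φ x) (n * u x)) M ≤ excess W φ H := by
  -- `min φ (n u) = (φ - |φ - n u|)/2 + (n/2) u`. Adding multiples of the null vector leaves the
  -- form unchanged, taking absolute values does not increase it, and half the difference is handled
  -- by `excess_half_sub_le`. The bound is thus independent of `n`.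
  have h1 := hφ.comb hW.measurable hu 1 (-(n : ℝ))
  have e1 := excess_add_null hW hu hu0 hφ 1 (-(n : ℝ))
  obtain ⟨D, hD, hDle⟩ := h1.abs
  have h2 := excess_half_sub_le hW hφ hD (by rw [e1] at hDle; linarith)
  have h3 := hφ.comb hW.measurable hD (1 / 2) (-1 / 2)
  have h4 := h3.comb hW.measurable hu 1 ((n : ℝ) / 2)
  have e4 := excess_add_null hW hu hu0 h3 1 ((n : ℝ) / 2)
  have e : (fun x => 1 * (1 / 2 * φ x + -1 / 2 * |1 * φ x + -(n : ℝ) * u x|) + (n : ℝ) / 2 * u x)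
      = fun x => min (φ x) (n * u x) := by
    ext x
    rcases le_total (φ x) (n * u x) with h | h
    · rw [min_eq_left h, abs_of_nonpos (by linarith)]; ring
    · rw [min_eq_right h, abs_of_nonneg (by linarith)]; ring
  rw [e] at h4 e4
  exact ⟨_, h4, by linarith⟩

/-- Multiplication by the indicator of the positivity set commutes with the weak gradient, so no
derivative sits on the boundary of that set. The truncations `min η (n u)` are bounded in `H¹`
uniformly in `n` and converge to the product, which therefore has an `L²` weak derivative. -/
theorem exists_weakDeriv_indicator (hW : IsTransverseTrap W) {u : Plane → ℝ}
    {U : Fin 2 → Plane → ℝ} (hu : FormDomain W u U) (hu0 : excess W u U = 0)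
    (hupos : 0 ≤ᵐ[volume] u) {A : Set Plane} (hA : MeasurableSet A)
    (huA : ∀ᵐ x, x ∈ A ↔ 0 < u x) {η : Plane → ℝ} (hη : ContDiff ℝ ∞ η)
    (hc : HasCompactSupport η) (hη0 : ∀ x, 0 ≤ η x) (i : Fin 2) :
    HasWeakDeriv (planeBasis i) (A.indicator η)
      (A.indicator fun x => fderiv ℝ η x (planeBasis i)) := by
  have hφ := formDomain_of_contDiff hW hη hc
  choose M hM hMle using fun n => exists_truncation hW hu hu0 hφ n
  set m : ℕ → Plane → ℝ := fun n x => min (η x) (n * u x) with hm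
  have hbd : ∀ n, ∀ᵐ x, |m n x| ≤ η x := fun n => by
    filter_upwards [hupos] with x hx
    rw [abs_of_nonneg (le_min (hη0 x) (mul_nonneg (Nat.cast_nonneg n) hx))]
    exact min_le_left _ _
  have hlim : ∀ᵐ x, Tendsto (fun n => m n x) atTop (𝓝 (A.indicator η x)) := by
    filter_upwards [hupos, huA] with x hx hxA
    by_cases h : x ∈ A
    · rw [Set.indicator_of_mem h]
      have hpos := hxA.1 h
      refine tendsto_const_nhds.congr' ?_
      have := (tendsto_natCast_atTop_atTop (R := ℝ)).eventually_ge_atTop (η x / u x)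
      filter_upwards [this] with n hn
      rw [div_le_iff₀ hpos] at hn
      exact (min_eq_left hn).symm
    · rw [Set.indicator_of_notMem h]
      have hx0 : u x = 0 := le_antisymm (not_lt.1 fun h' => h (hxA.2 h')) hx
      have : ∀ n, m n x = 0 := fun n => by simp [hm, hx0, hη0 x]
      simp [this]
  obtain ⟨c, hc0, hcb⟩ := exists_grad_bound hW
  have hMb : ∀ n, ∫ x, M n i x ^ 2 ≤ excess W η (fun i x => fderiv ℝ η x (planeBasis i))
      + c * ∫ x, η x ^ 2 := fun n => by
    have h1 := hcb _ _ (hM n)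
    have h2 : ∫ x, m n x ^ 2 ≤ ∫ x, η x ^ 2 := by
      refine integral_mono_ae (hM n).memLp.integrable_sq_real hφ.memLp.integrable_sq_real ?_
      filter_upwards [hbd n] with x hx
      exact sq_le_sq.2 (hx.trans (le_abs_self _))
    have h3 : ∫ x, M n i x ^ 2 ≤ ∑ i, ∫ x, M n i x ^ 2 :=
      Finset.single_le_sum (f := fun i => ∫ x, M n i x ^ 2)
        (fun i _ => integral_nonneg fun x => sq_nonneg _) (Finset.mem_univ i)
    have h4 := mul_le_mul_of_nonneg_left h2 hc0
    linarith [hMle n]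
  obtain ⟨g, φ, hg, hφm, hw⟩ := exists_weak_limit (fun n => (hM n).grad i) hMb
  have hind : MemLp (A.indicator η) 2 := hφ.memLp.indicator hA
  have hwd : HasWeakDeriv (planeBasis i) (A.indicator η) g := by
    refine hasWeakDeriv_of_tendsto (f := fun n => m (φ n)) (fun n => (hM (φ n)).weak i) hind hg
      (fun k hk => ?_) hw
    refine Tendsto.comp (g := fun n => ∫ x, m n x * k x) ?_ hφm.tendsto_atTop
    refine tendsto_integral_of_dominated_convergence (fun x => ‖η x‖ * ‖k x‖)
      (fun n => (hM n).memLp.1.mul hk.1) (hφ.memLp.integrable_norm_mul_norm hk) (fun n => ?_) ?_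
    · filter_upwards [hbd n] with x hx
      rw [norm_mul]
      exact mul_le_mul_of_nonneg_right (hx.trans (Real.le_norm_self _)) (norm_nonneg _)
    · filter_upwards [hlim] with x hx using hx.mul_const _
  -- The derivative `g` is identified by two nonnegative functions: the indicator of `A` times `η`
  -- vanishes off `A`, so `g = 0` there; the remainder of `η` vanishes on `A`, so `g` agrees with
  -- the derivative of `η` there.
  have hz1 := hwd.eq_zero_of_nonneg hind hg
    (Eventually.of_forall fun x => Set.indicator_nonneg (fun x _ => hη0 x) x)
  have hwd2 := (hφ.weak i).comb hwd 1 (-1)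
  have hz2 := hwd2.eq_zero_of_nonneg ((hφ.memLp.const_mul 1).add (hind.const_mul (-1)))
    (((hφ.grad i).const_mul 1).add (hg.const_mul (-1))) (Eventually.of_forall fun x => by
      by_cases h : x ∈ A
      · simp [h]
      · simpa [h] using hη0 x)
  refine hwd.congr_ae ae_eq_rfl ?_
  filter_upwards [hz1, hz2] with x h1 h2
  by_cases h : x ∈ A
  · simp only [Set.indicator_of_mem h] at h2 ⊢
    have := h2 (by ring)
    linarith
  · simp only [Set.indicator_of_notMem h] at h1 ⊢
    exact h1 trivial

/-- A nonnegative null vector of the quadratic form is positive almost everywhere. -/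
theorem ae_pos_of_excess_eq_zero (hW : IsTransverseTrap W) {u : Plane → ℝ}
    {U : Fin 2 → Plane → ℝ} (hu : FormDomain W u U) (hu0 : excess W u U = 0)
    (hupos : 0 ≤ᵐ[volume] u) (hne : ¬ u =ᵐ[volume] 0) : ∀ᵐ x, 0 < u x := by
  -- A measurable representative of `u` is used so that `A` is a measurable set.
  set A := {x | 0 < hu.memLp.1.mk u x} with hAdef
  have hA : MeasurableSet A :=
    measurableSet_lt measurable_const hu.memLp.1.stronglyMeasurable_mk.measurable
  have huA : ∀ᵐ x, x ∈ A ↔ 0 < u x := by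
    filter_upwards [hu.memLp.1.ae_eq_mk] with x hx
    rw [hx]; rfl
  set χ : Plane → ℝ := A.indicator fun _ => 1 with hχ
  have hχl : LocallyIntegrable χ := (locallyIntegrable_const (1 : ℝ)).indicator hA
  -- The indicator of `A` alone is not covered by `exists_weakDeriv_indicator`; on the support of
  -- the test function it agrees with its product with a cutoff equal to one near that support,
  -- whose derivative vanishes there.
  have hbasis : ∀ i, ∀ η : Plane → ℝ, ContDiff ℝ ∞ η → HasCompactSupport η →
      ∫ x, fderiv ℝ η x (planeBasis i) * χ x = 0 := fun i η hη hc => by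
    obtain ⟨R, hR⟩ := hc.isCompact.isBounded.subset_closedBall (0 : Plane)
    obtain ⟨n, hn⟩ := exists_nat_gt R
    have hsub : ∀ x ∈ tsupport η, ‖x‖ < n + 1 := fun x hx => by
      have := mem_closedBall_zero_iff.1 (hR hx)
      linarith
    have hone : ∀ x ∈ tsupport η, cutoff Plane n x = 1 := fun x hx =>
      cutoff_eq_one (hsub x hx).le
    have hflat : ∀ x ∈ tsupport η, fderiv ℝ (cutoff Plane n) x = 0 := fun x hx => by
      have : cutoff Plane n =ᶠ[𝓝 x] fun _ => 1 := by
        filter_upwards [(isOpen_lt continuous_norm continuous_const).mem_nhds (hsub x hx)]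
          with y hy
        exact cutoff_eq_one (le_of_lt hy)
      rw [this.fderiv_eq, fderiv_const_apply]
    have key := (exists_weakDeriv_indicator hW hu hu0 hupos hA huA (contDiff_cutoff n)
      (hasCompactSupport_cutoff n) (cutoff_nonneg n) i).2.2 η hη hc
    have e1 : ∀ x, fderiv ℝ η x (planeBasis i) * χ x
        = fderiv ℝ η x (planeBasis i) • A.indicator (cutoff Plane n) x := fun x => by
      by_cases hx : x ∈ tsupport η
      · by_cases hxA : x ∈ A
        · simp [hχ, hxA, hone x hx]
        · simp [hχ, hxA]
      · have : fderiv ℝ η x = 0 := by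
          by_contra h
          exact hx (support_fderiv_subset ℝ h)
        simp [this]
    have e2 : ∀ x, η x • A.indicator (fun x => fderiv ℝ (cutoff Plane n) x (planeBasis i)) x
        = 0 := fun x => by
      by_cases hx : x ∈ tsupport η
      · by_cases hxA : x ∈ A
        · simp [hxA, hflat x hx]
        · simp [hxA]
      · simp [image_eq_zero_of_notMem_tsupport hx]
    simp only [e2, integral_zero, neg_zero] at key
    simp only [e1]
    exact key
  obtain ⟨c, hc⟩ := ae_eq_const_of_hasWeakDeriv_zero hχl fun v =>
    ⟨hχl, locallyIntegrable_const 0, fun η hη hηc => by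
      have hi : ∀ i, Integrable fun x => v i * (fderiv ℝ η x (planeBasis i) * χ x) := fun i =>
        (integrable_smul_of_hasCompactSupport (contDiff_fderiv_apply hη _)
          (hηc.fderiv_apply ℝ _) hχl).const_mul _
      simp only [smul_eq_mul, mul_zero, integral_zero, neg_zero]
      simp only [plane_functional_apply (fderiv ℝ η _) v, Finset.sum_mul, mul_assoc]
      rw [integral_finsetSum _ fun i _ => hi i]
      simp only [integral_const_mul, hbasis _ η hη hηc, mul_zero, Finset.sum_const_zero]⟩
  by_cases h0 : c = 0
  · refine absurd ?_ hne
    filter_upwards [hc, huA, hupos] with x h1 h2 h3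
    have h4 : x ∉ A := fun h => by simp [hχ, h, h0] at h1
    exact le_antisymm (not_lt.1 fun h => h4 (h2.2 h)) h3
  · filter_upwards [hc, huA] with x h1 h2
    refine h2.1 (by_contra fun h => h0 ?_)
    rw [← h1]; simp [hχ, h]

end Positivity

/-! ### Completeness of `L²` and almost everywhere convergent subsequences. -/

section CompletenessL2

variable {E : Type*} [NormedAddCommGroup E] [NormedSpace ℝ E] [FiniteDimensional ℝ E]
  [MeasureSpace E] [BorelSpace E] [(volume : Measure E).IsAddHaarMeasure]

theorem normSq_toLp_sub {f g : E → ℝ} (hf : MemLp f 2 (volume : Measure E))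
    (hg : MemLp g 2 (volume : Measure E)) :
    ‖hf.toLp f - hg.toLp g‖ ^ 2 = ∫ x, (f x - g x) ^ 2 := by
  have e : hf.toLp f - hg.toLp g = (hf.sub hg).toLp (f - g) := (MemLp.toLp_sub hf hg).symm
  rw [e, normSq_toLp]
  rfl

theorem memLp_sq_of_integrable_pow_four {f : E → ℝ} (hf : AEStronglyMeasurable f)
    (h : Integrable fun x => f x ^ 4) : MemLp (fun x => f x ^ 2) 2 := by
  have hm : AEStronglyMeasurable fun x => f x ^ 2 := hf.pow 2
  rw [memLp_two_iff_integrable_sq hm]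
  simpa only [← pow_mul] using h

theorem exists_tendsto_L2_of_cauchy {u : ℕ → E → ℝ} (hu : ∀ n, MemLp (u n) 2)
    (hc : ∀ ε > 0, ∃ N, ∀ m ≥ N, ∀ n ≥ N, ∫ x, (u m x - u n x) ^ 2 < ε) :
    ∃ u₀ : E → ℝ, MemLp u₀ 2 ∧ Tendsto (fun n => ∫ x, ‖u n x - u₀ x‖ ^ 2) atTop (𝓝 0) := by
  have hcs : CauchySeq fun n => (hu n).toLp := by
    refine Metric.cauchySeq_iff.2 fun ε hε => ?_
    obtain ⟨N, hN⟩ := hc (ε ^ 2) (by positivity)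
    refine ⟨N, fun m hm n hn => ?_⟩
    have := hN m hm n hn
    rw [← normSq_toLp_sub (hu m) (hu n)] at this
    rw [dist_eq_norm]
    exact lt_of_pow_lt_pow_left₀ 2 hε.le this
  obtain ⟨y, hy⟩ := cauchySeq_tendsto_of_complete hcs
  refine ⟨y, Lp.memLp y, ?_⟩
  have h1 := ((tendsto_iff_norm_sub_tendsto_zero.1 hy).pow 2)
  rw [zero_pow two_ne_zero] at h1
  refine h1.congr fun n => ?_
  have e : y = (Lp.memLp y).toLp := (Lp.toLp_coeFn y (Lp.memLp y)).symm
  conv_lhs => rw [e, normSq_toLp_sub]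
  simp only [Real.norm_eq_abs, sq_abs]

theorem exists_subseq_ae_tendsto {u : ℕ → E → ℝ} {u₀ : E → ℝ} (hu : ∀ n, MemLp (u n) 2)
    (hu₀ : MemLp u₀ 2) (h : Tendsto (fun n => ∫ x, ‖u n x - u₀ x‖ ^ 2) atTop (𝓝 0)) :
    ∃ φ : ℕ → ℕ, StrictMono φ ∧ ∀ᵐ x, Tendsto (fun n => u (φ n) x) atTop (𝓝 (u₀ x)) := by
  have h1 : Tendsto (fun n => eLpNorm (u n - u₀) 2 volume) atTop (𝓝 0) := by
    have h2 : Tendsto (fun n => ENNReal.ofReal √(∫ x, ‖u n x - u₀ x‖ ^ 2)) atTop (𝓝 0) := by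
      have := (ENNReal.continuous_ofReal.tendsto _).comp h.sqrt
      simpa [Function.comp_def] using this
    refine h2.congr fun n => ?_
    have hm := (hu n).sub hu₀
    have e : √(∫ x, ‖u n x - u₀ x‖ ^ 2) = ‖hm.toLp‖ := by
      rw [← Real.sqrt_sq (norm_nonneg hm.toLp), normSq_toLp]
      simp only [Real.norm_eq_abs, sq_abs, Pi.sub_apply]
    rw [e, Lp.norm_toLp, ENNReal.ofReal_toReal hm.2.ne]
  exact (tendstoInMeasure_of_tendsto_eLpNorm (by norm_num) (fun n => (hu n).1) hu₀.1
    h1).exists_seq_tendsto_ae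

end CompletenessL2

/-! ### Uniqueness of the ground state and the spectral gap. -/

section Gap

variable {W : Plane → ℝ} {ψ φ b : Plane → ℝ} {G H B : Fin 2 → Plane → ℝ}

theorem IsTransGroundState.exists_grad (hb : IsTransGroundState W b) :
    ∃ B, FormDomain W b B ∧ excess W b B = 0 ∧ ∫ x, b x ^ 2 = 1 := by
  obtain ⟨-, B, h, hE⟩ := hb
  have hp := h.potential
  have hn := h.normalized
  simp only [Real.norm_eq_abs, sq_abs] at hp hn
  refine ⟨B, ⟨h.memLp, h.grad_memLp, h.weakGrad, hp⟩, ?_, hn⟩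
  rw [transEnergy] at hE
  simp only [Real.norm_eq_abs, sq_abs] at hE
  rw [integral_add (integrable_finsetSum _ fun i _ => (h.grad_memLp i).integrable_sq_real) hp,
    integral_finsetSum _ fun i _ => (h.grad_memLp i).integrable_sq_real] at hE
  rw [excess, hE, hn]
  ring

theorem IsTransGroundState.ae_pos (hW : IsTransverseTrap W) (hb : IsTransGroundState W b) :
    ∀ᵐ x, 0 < b x := by
  obtain ⟨B, hB, hB0, hn⟩ := hb.exists_grad
  refine ae_pos_of_excess_eq_zero hW hB hB0 hb.1 fun h => ?_
  have : ∫ x, b x ^ 2 = 0 := by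
    rw [integral_eq_zero_of_ae]
    filter_upwards [h] with x hx
    simp [hx]
  linarith

/-- Uniqueness of the ground state. -/
theorem ae_eq_zero_of_excess_eq_zero (hW : IsTransverseTrap W) (hb : IsTransGroundState W b)
    (hψ : FormDomain W ψ G) (hψ0 : excess W ψ G = 0) (horth : ∫ x, b x * ψ x = 0) :
    ψ =ᵐ[volume] 0 := by
  obtain ⟨B, hB, -, -⟩ := hb.exists_grad
  obtain ⟨H, hH, hHle⟩ := hψ.abs
  have hH0 : excess W (fun x => |ψ x|) H = 0 :=
    le_antisymm (hHle.trans hψ0.le) (hH.excess_nonneg hW)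
  -- The positive part of `ψ` is again a null vector. It vanishes or is positive almost everywhere,
  -- so `ψ` has a sign, and orthogonality to the positive `b` forces `ψ = 0`.
  have hp := hH.comb hW.measurable hψ (1 / 2) (1 / 2)
  have hp0 := excess_add_null hW hψ hψ0 hH (1 / 2) (1 / 2)
  rw [hH0, mul_zero] at hp0
  have hi : Integrable fun x => b x * ψ x := hB.memLp.integrable_mul_real hψ.memLp
  have hbpos := hb.ae_pos hW
  by_cases h : (fun x => 1 / 2 * |ψ x| + 1 / 2 * ψ x) =ᵐ[volume] 0
  · have h1 : 0 ≤ᵐ[volume] fun x => -(b x * ψ x) := by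
      filter_upwards [h, hbpos] with x hx hbx
      simp only [Pi.zero_apply] at hx
      have : ψ x ≤ 0 := by linarith [abs_nonneg (ψ x)]
      show 0 ≤ -(b x * ψ x)
      nlinarith
    have h2 := (integral_eq_zero_iff_of_nonneg_ae h1 hi.neg).1 (by rw [integral_neg, horth, neg_zero])
    filter_upwards [h2, hbpos] with x hx hbx
    simpa [hbx.ne'] using hx
  · have hpos := ae_pos_of_excess_eq_zero hW hp hp0
      (Eventually.of_forall fun x => by
        show 0 ≤ 1 / 2 * |ψ x| + 1 / 2 * ψ x
        linarith [neg_abs_le (ψ x)]) h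
    have h1 : 0 ≤ᵐ[volume] fun x => b x * ψ x := by
      filter_upwards [hpos, hbpos] with x hx hbx
      have : 0 ≤ ψ x := by
        by_contra hneg
        rw [abs_of_neg (not_le.1 hneg)] at hx
        linarith
      show 0 ≤ b x * ψ x
      positivity
    have h2 := (integral_eq_zero_iff_of_nonneg_ae h1 hi).1 horth
    filter_upwards [h2, hbpos] with x hx hbx
    simpa [hbx.ne'] using hx

theorem tendsto_cauchy_of_tendsto_L2 {u : ℕ → Plane → ℝ} {u₀ : Plane → ℝ}
    (hu : ∀ n, MemLp (u n) 2) (hu₀ : MemLp u₀ 2)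
    (h : Tendsto (fun n => ∫ x, ‖u n x - u₀ x‖ ^ 2) atTop (𝓝 0)) {ε : ℝ} (hε : 0 < ε) :
    ∃ N, ∀ m ≥ N, ∀ n ≥ N, ∫ x, (u m x - u n x) ^ 2 < ε := by
  obtain ⟨N, hN⟩ := eventually_atTop.1 (h.eventually_lt_const (by positivity : 0 < ε / 4))
  refine ⟨N, fun m hm n hn => ?_⟩
  have h1 := integral_normSq_add_le ((hu m).sub hu₀) ((hu n).sub hu₀).neg
  have h2 := hN m hm
  have h3 := hN n hn
  simp only [Pi.sub_apply, Pi.neg_apply, norm_neg] at h1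
  have e : ∫ x, (u m x - u n x) ^ 2 = ∫ x, ‖u m x - u₀ x + -(u n x - u₀ x)‖ ^ 2 := by
    refine integral_congr_ae (Eventually.of_forall fun x => ?_)
    simp only [Real.norm_eq_abs, sq_abs]
    ring
  rw [e]
  linarith

/-- Minimizing sequences converge to null vectors. -/
theorem exists_limit_of_minimizing (hW : IsTransverseTrap W) {f : ℕ → Plane → ℝ}
    {G : ℕ → Fin 2 → Plane → ℝ} (hf : ∀ n, FormDomain W (f n) (G n))
    (hf1 : ∀ n, ∫ x, f n x ^ 2 = 1)
    (hfe : ∀ n, excess W (f n) (G n) ≤ 1 / ((n : ℝ) + 1)) :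
    ∃ (f₀ : Plane → ℝ) (G₀ : Fin 2 → Plane → ℝ) (φ : ℕ → ℕ), FormDomain W f₀ G₀ ∧
      excess W f₀ G₀ = 0 ∧ StrictMono φ ∧
      Tendsto (fun n => ∫ x, ‖f (φ n) x - f₀ x‖ ^ 2) atTop (𝓝 0) := by
  obtain ⟨c, hc0, hc⟩ := hW.exists_neg_le
  obtain ⟨d, hd0, hd⟩ := exists_grad_bound hW
  have hfe1 : ∀ n, excess W (f n) (G n) ≤ 1 := fun n => (hfe n).trans (by
    rw [div_le_one (by positivity)]; linarith [Nat.cast_nonneg (α := ℝ) n])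
  have hgr : ∀ n, ∑ i, ∫ x, G n i x ^ 2 ≤ 1 + d := fun n => by
    have := hd _ _ (hf n)
    rw [hf1 n] at this
    linarith [hfe1 n]
  have hG0 : ∀ n, 0 ≤ ∑ i, ∫ x, G n i x ^ 2 := fun n =>
    Finset.sum_nonneg fun i _ => integral_nonneg fun x => sq_nonneg _
  have hip : ∀ n, Integrable fun x => (W x + c) * f n x ^ 2 := fun n => by
    simp only [add_mul]
    exact (hf n).pot.add ((hf n).memLp.integrable_sq_real.const_mul c)
  have hpe : ∀ n, ∫ x, (W x + c) * f n x ^ 2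
      = excess W (f n) (G n) + (ePerp W + c) - ∑ i, ∫ x, G n i x ^ 2 := fun n => by
    simp only [add_mul]
    rw [integral_add (hf n).pot ((hf n).memLp.integrable_sq_real.const_mul c),
      integral_const_mul, excess, hf1 n]
    ring
  have hWc : ∀ x, 0 ≤ W x + c := fun x => by linarith [hc x]
  have htight : ∀ ε > 0, ∃ R : ℝ, ∀ n, ∫ x in (Metric.closedBall 0 R)ᶜ, f n x ^ 2 ≤ ε := by
    intro ε hε
    -- `T` bounds the integral of `(W + c) f_n²` uniformly in `n`. Outside a ball where `W ≥ T/ε`,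
    -- the mass of `f_n` is at most `ε`.
    set T := 1 + |ePerp W| + c with hT
    have hT0 : 0 < T := by positivity
    obtain ⟨R, hR⟩ := hW.exists_lower_bound (T / ε)
    refine ⟨R, fun n => ?_⟩
    have h1 : ∫ x in (Metric.closedBall 0 R)ᶜ, T / ε * f n x ^ 2
        ≤ ∫ x in (Metric.closedBall 0 R)ᶜ, (W x + c) * f n x ^ 2 := by
      refine setIntegral_mono_on ((hf n).memLp.integrable_sq_real.const_mul _).integrableOn
        (hip n).integrableOn measurableSet_closedBall.compl fun x hx => ?_
      have := hR x (by simpa using hx)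
      exact mul_le_mul_of_nonneg_right (by linarith) (sq_nonneg _)
    have h2 : ∫ x in (Metric.closedBall 0 R)ᶜ, (W x + c) * f n x ^ 2
        ≤ ∫ x, (W x + c) * f n x ^ 2 :=
      setIntegral_le_integral (hip n) (Eventually.of_forall fun x =>
        mul_nonneg (hWc x) (sq_nonneg _))
    rw [integral_const_mul] at h1
    rw [hpe n] at h2
    have h3 : T / ε * ∫ x in (Metric.closedBall 0 R)ᶜ, f n x ^ 2 ≤ T := by
      linarith [hfe1 n, hG0 n, le_abs_self (ePerp W)]
    have h4 : 0 < T / ε := by positivity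
    have h5 : T / ε * ε = T := by field_simp
    exact le_of_mul_le_mul_left (by linarith) h4
  obtain ⟨f₁, φ₁, hf₁, hφ₁, hl₁⟩ := exists_tendsto_L2_of_tight (C := 1 + d)
    (fun n => (hf n).memLp) (fun n i => (hf n).grad i) (fun n i => (hf n).weak i)
    (fun n => by rw [hf1 n]; linarith) hgr htight
  obtain ⟨φ₂, hφ₂, hae⟩ := exists_subseq_ae_tendsto (fun n => (hf (φ₁ n)).memLp) hf₁ hl₁
  set φ := fun n => φ₁ (φ₂ n) with hφdef
  have hφ : StrictMono φ := hφ₁.comp hφ₂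
  have hl : Tendsto (fun n => ∫ x, ‖f (φ n) x - f₁ x‖ ^ 2) atTop (𝓝 0) :=
    hl₁.comp hφ₂.tendsto_atTop
  have hex : Tendsto (fun n => excess W (f (φ n)) (G (φ n))) atTop (𝓝 0) := by
    refine squeeze_zero (fun n => (hf _).excess_nonneg hW) (fun n => hfe (φ n)) ?_
    exact (tendsto_one_div_add_atTop_nhds_zero_nat (𝕜 := ℝ)).comp hφ.tendsto_atTop
  -- The gradients converge strongly: by the parallelogram identity the excess of `f_m - f_n` is at
  -- most twice the sum of the two excesses, hence at most `ε/2`, and the mass term of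
  -- `exists_grad_bound` contributes at most `ε/4`.
  have hcauchy : ∀ i, ∀ ε > 0, ∃ N, ∀ m ≥ N, ∀ n ≥ N,
      ∫ x, (G (φ m) i x - G (φ n) i x) ^ 2 < ε := fun i ε hε => by
    obtain ⟨N₁, hN₁⟩ := eventually_atTop.1
      (hex.eventually_lt_const (by positivity : 0 < ε / 8))
    obtain ⟨N₂, hN₂⟩ := tendsto_cauchy_of_tendsto_L2 (fun n => (hf (φ n)).memLp) hf₁ hl
      (by positivity : 0 < ε / (4 * (d + 1)))
    refine ⟨max N₁ N₂, fun m hm n hn => ?_⟩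
    have a1 := hN₁ m ((le_max_left _ _).trans hm)
    have a2 := hN₁ n ((le_max_left _ _).trans hn)
    have a3 := hN₂ m ((le_max_right _ _).trans hm) n ((le_max_right _ _).trans hn)
    have b1 := ((hf (φ m)).comb hW.measurable (hf (φ n)) 1 1).excess_nonneg hW
    have b2 := excess_comb hW.measurable (hf (φ m)) (hf (φ n)) 1 1
    have b3 := excess_comb hW.measurable (hf (φ m)) (hf (φ n)) 1 (-1)
    have b4 := hd _ _ ((hf (φ m)).comb hW.measurable (hf (φ n)) 1 (-1))
    simp only [one_mul, neg_one_mul, ← sub_eq_add_neg] at b1 b2 b3 b4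
    have b5 : ∫ x, (G (φ m) i x - G (φ n) i x) ^ 2
        ≤ ∑ i, ∫ x, (G (φ m) i x - G (φ n) i x) ^ 2 :=
      Finset.single_le_sum (f := fun i => ∫ x, (G (φ m) i x - G (φ n) i x) ^ 2)
        (fun i _ => integral_nonneg fun x => sq_nonneg _) (Finset.mem_univ i)
    have b6 : d * ∫ x, (f (φ m) x - f (φ n) x) ^ 2 ≤ ε / 4 := by
      have : 0 ≤ ∫ x, (f (φ m) x - f (φ n) x) ^ 2 := integral_nonneg fun x => sq_nonneg _
      rw [lt_div_iff₀ (by positivity)] at a3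
      nlinarith
    nlinarith
  choose G₀ hG₀ hGl using fun i =>
    exists_tendsto_L2_of_cauchy (fun n => (hf (φ n)).grad i) (hcauchy i)
  have hsum : Tendsto (fun n => ∑ i, ∫ x, G (φ n) i x ^ 2) atTop (𝓝 (∑ i, ∫ x, G₀ i x ^ 2)) :=
    tendsto_finsetSum _ fun i _ =>
      tendsto_integral_sq_of_tendsto_L2 (fun n => (hf (φ n)).grad i) (hG₀ i) (hGl i)
  -- Only the potential energy is treated by Fatou, with `W` shifted by `c` to be nonnegative. The
  -- gradient terms converge, so the limit has nonpositive excess.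
  have hfat := integrable_and_integral_le_of_ae_tendsto_of_tendsto
    (g := fun n x => (W x + c) * f (φ n) x ^ 2) (G := fun x => (W x + c) * f₁ x ^ 2)
    (fun n => hip (φ n)) (fun n x => mul_nonneg (hWc x) (sq_nonneg _))
    (by filter_upwards [hae] with x hx using (hx.pow 2).const_mul _)
    (fun n => (hpe (φ n)).le) ((hex.add_const (ePerp W + c)).sub hsum)
  have hpot : Integrable fun x => W x * f₁ x ^ 2 := by
    refine (hfat.1.sub (hf₁.integrable_sq_real.const_mul c)).congr
      (Eventually.of_forall fun x => ?_)
    simp only [Pi.sub_apply]; ring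
  have hdom : FormDomain W f₁ G₀ := ⟨hf₁, hG₀, fun i => hasWeakDeriv_of_tendsto
    (fun n => (hf (φ n)).weak i) hf₁ (hG₀ i)
    (fun g hg => tendsto_integral_mul_of_tendsto_L2 (fun n => (hf (φ n)).memLp) hf₁ hg hl)
    (fun g hg => tendsto_integral_mul_of_tendsto_L2 (fun n => (hf (φ n)).grad i) (hG₀ i) hg
      (hGl i)), hpot⟩
  have hnorm : ∫ x, f₁ x ^ 2 = 1 := by
    have := tendsto_integral_sq_of_tendsto_L2 (fun n => (hf (φ n)).memLp) hf₁ hl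
    simp only [hf1] at this
    exact (tendsto_nhds_unique this tendsto_const_nhds)
  refine ⟨f₁, G₀, φ, hdom, le_antisymm ?_ (hdom.excess_nonneg hW), hφ, hl⟩
  have h1 := hfat.2
  simp only [add_mul] at h1
  rw [integral_add hpot (hf₁.integrable_sq_real.const_mul c), integral_const_mul, hnorm] at h1
  rw [excess, hnorm]
  linarith

/-- The spectral gap above the ground state. -/
theorem exists_gap (hW : IsTransverseTrap W) (hb : IsTransGroundState W b) :
    ∃ γ : ℝ, 0 < γ ∧ ∀ (ψ : Plane → ℝ) (G : Fin 2 → Plane → ℝ), FormDomain W ψ G →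
      ∫ x, b x * ψ x = 0 → γ * ∫ x, ψ x ^ 2 ≤ excess W ψ G := by
  obtain ⟨B, hB, -, -⟩ := hb.exists_grad
  by_contra! hcon
  have hseq : ∀ n : ℕ, ∃ (f : Plane → ℝ) (G : Fin 2 → Plane → ℝ), FormDomain W f G ∧
      ∫ x, b x * f x = 0 ∧ ∫ x, f x ^ 2 = 1 ∧ excess W f G ≤ 1 / ((n : ℝ) + 1) := fun n => by
    obtain ⟨ψ, G, hψ, horth, hlt⟩ := hcon (1 / ((n : ℝ) + 1)) (by positivity)
    have h0 := hψ.excess_nonneg hW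
    have hN : 0 < ∫ x, ψ x ^ 2 := by
      by_contra hN
      have : 1 / ((n : ℝ) + 1) * ∫ x, ψ x ^ 2 ≤ 0 :=
        mul_nonpos_of_nonneg_of_nonpos (by positivity) (not_lt.1 hN)
      linarith
    set N := ∫ x, ψ x ^ 2 with hNdef
    set s : ℝ := 1 / √N with hs
    have hs2 : s ^ 2 = 1 / N := by rw [hs, div_pow, Real.sq_sqrt hN.le, one_pow]
    have hh := hψ.comb hW.measurable hψ s 0
    have he := excess_comb hW.measurable hψ hψ s 0
    simp only [zero_mul, add_zero, mul_zero, zero_pow two_ne_zero] at hh he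
    refine ⟨_, _, hh, ?_, ?_, ?_⟩
    · simp only [mul_left_comm (b _)]
      rw [integral_const_mul, horth, mul_zero]
    · simp only [mul_pow]
      rw [integral_const_mul, hs2, ← hNdef]
      field_simp
    · rw [he, hs2, one_div_mul_eq_div, div_le_iff₀ hN]
      exact hlt.le
  choose f G hf horth hf1 hfe using hseq
  obtain ⟨f₀, G₀, φ, hdom, hex, -, hl⟩ := exists_limit_of_minimizing hW hf hf1 hfe
  have hm := fun n => (hf (φ n)).memLp
  have hnorm : ∫ x, f₀ x ^ 2 = 1 := by
    have := tendsto_integral_sq_of_tendsto_L2 hm hdom.memLp hl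
    simp only [hf1] at this
    exact (tendsto_nhds_unique this tendsto_const_nhds)
  have horth₀ : ∫ x, b x * f₀ x = 0 := by
    have := tendsto_integral_mul_of_tendsto_L2 hm hdom.memLp hB.memLp hl
    simp only [mul_comm _ (b _), horth] at this
    exact (tendsto_nhds_unique this tendsto_const_nhds)
  have hz := ae_eq_zero_of_excess_eq_zero hW hb hdom hex horth₀
  have : ∫ x, f₀ x ^ 2 = 0 := by
    rw [integral_eq_zero_of_ae]
    filter_upwards [hz] with x hx
    simp [hx]
  linarith

theorem IsTransGroundState.integrable_pow_four (hb : IsTransGroundState W b) :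
    Integrable fun x => b x ^ 4 := by
  obtain ⟨B, hB, -, -⟩ := hb.exists_grad
  obtain ⟨C, -, hC⟩ := exists_ladyzhenskaya
  exact (hC b B hB.memLp hB.grad hB.weak).1

theorem IsTransGroundState.integral_pow_four_pos (hb : IsTransGroundState W b) :
    0 < ∫ x, b x ^ 4 := by
  obtain ⟨B, hB, -, hn⟩ := hb.exists_grad
  refine (integral_nonneg fun x => by positivity).lt_of_ne fun h => ?_
  have h1 := (integral_eq_zero_iff_of_nonneg (fun x => by positivity) hb.integrable_pow_four).1 h.symm
  have : ∫ x, b x ^ 2 = 0 := by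
    rw [integral_eq_zero_of_ae]
    filter_upwards [h1] with x hx
    have : b x = 0 := by simpa using hx
    simp [this]
  linarith

/-- Control of the component orthogonal to the ground state by the excess energy. -/
theorem exists_transverse_bound (hW : IsTransverseTrap W) (hb : IsTransGroundState W b) :
    ∃ κ : ℝ, 0 < κ ∧ ∀ (ψ : Plane → ℝ) (G : Fin 2 → Plane → ℝ), FormDomain W ψ G →
      κ * ((∫ x, ψ x ^ 2) - (∫ x, b x * ψ x) ^ 2) ≤ excess W ψ G ∧
      Integrable (fun x => b x ^ 2 * (ψ x - (∫ y, b y * ψ y) * b x) ^ 2) ∧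
      κ * ∫ x, b x ^ 2 * (ψ x - (∫ y, b y * ψ y) * b x) ^ 2 ≤ excess W ψ G := by
  obtain ⟨B, hB, hB0, hn⟩ := hb.exists_grad
  obtain ⟨γ, hγ, hgap⟩ := exists_gap hW hb
  obtain ⟨d, hd0, hd⟩ := exists_grad_bound hW
  obtain ⟨C, hC0, hC⟩ := exists_ladyzhenskaya
  -- With `q = ψ - f b`, Cauchy-Schwarz gives `(∫ b² q²)² ≤ ∫ b⁴ · ∫ q⁴`, and the Ladyzhenskaya
  -- inequality bounds `∫ q⁴` by `C` times mass times gradient norm. The gap bounds the mass by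
  -- `X/γ` and the gradient by `(1 + d/γ) X`. The excess of `q` equals that of `ψ` because `b` is a
  -- null vector.
  set K := √((∫ x, b x ^ 4) * (C * (1 / γ * (1 + d / γ)))) with hK
  have hK0 : 0 ≤ K := Real.sqrt_nonneg _
  -- `K + 1` instead of `K` keeps the quotient meaningful without a proof that `K` is nonzero.
  refine ⟨min γ (1 / (K + 1)), by positivity, fun ψ G hψ => ?_⟩
  set f := ∫ y, b y * ψ y with hf
  have hq := hψ.comb hW.measurable hB 1 (-f)
  have he := excess_add_null hW hB hB0 hψ 1 (-f)
  simp only [one_mul, neg_mul, ← sub_eq_add_neg, one_pow] at hq he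
  have hbψ := hB.memLp.integrable_mul_real hψ.memLp
  have horth : ∫ x, b x * (ψ x - f * b x) = 0 := by
    have := integral_comb_two 1 (-f) hbψ hB.memLp.integrable_sq_real
    rw [hn, ← hf] at this
    rw [show (fun x => b x * (ψ x - f * b x)) = fun x => 1 * (b x * ψ x) + -f * b x ^ 2 by
      ext x; ring, this]
    ring
  have hsq : ∫ x, (ψ x - f * b x) ^ 2 = (∫ x, ψ x ^ 2) - f ^ 2 := by
    have := integral_comb_three 1 (-2 * f) (f ^ 2) hψ.memLp.integrable_sq_real hbψ
      hB.memLp.integrable_sq_real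
    rw [hn, ← hf] at this
    rw [show (fun x => (ψ x - f * b x) ^ 2)
      = fun x => 1 * ψ x ^ 2 + -2 * f * (b x * ψ x) + f ^ 2 * b x ^ 2 by ext x; ring, this]
    ring
  have hex0 := hψ.excess_nonneg hW
  have h1 := hgap _ _ hq horth
  rw [he, hsq] at h1
  have hN0 : 0 ≤ (∫ x, ψ x ^ 2) - f ^ 2 := by
    rw [← hsq]; exact integral_nonneg fun x => sq_nonneg _
  have hgr := hd _ _ hq
  rw [he, hsq] at hgr
  set N := (∫ x, ψ x ^ 2) - f ^ 2
  set X := excess W ψ G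
  obtain ⟨i4, h4⟩ := hC _ _ hq.memLp hq.grad hq.weak
  rw [hsq] at h4
  have mb : MemLp (fun x => b x ^ 2) 2 :=
    memLp_sq_of_integrable_pow_four hB.memLp.1 hb.integrable_pow_four
  have mq : MemLp (fun x => (ψ x - f * b x) ^ 2) 2 :=
    memLp_sq_of_integrable_pow_four hq.memLp.1 i4
  refine ⟨le_trans (mul_le_mul_of_nonneg_right (min_le_left _ _) hN0) h1,
    mb.integrable_mul_real mq, ?_⟩
  have hcs := sq_integral_mul_le mb mq
  simp only [← pow_mul, Nat.reduceMul] at hcs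
  have hN1 : N ≤ 1 / γ * X := by
    rw [one_div_mul_eq_div, le_div_iff₀ hγ, mul_comm]; exact h1
  have hgr2 : ∑ i, ∫ x, (G i x - f * B i x) ^ 2 ≤ (1 + d / γ) * X := by
    have := mul_le_mul_of_nonneg_left hN1 hd0
    have e : (1 + d / γ) * X = X + d * (1 / γ * X) := by ring
    rw [e]; linarith
  have hgr0 : 0 ≤ ∑ i, ∫ x, (G i x - f * B i x) ^ 2 :=
    Finset.sum_nonneg fun i _ => integral_nonneg fun x => sq_nonneg _
  have h5 : N * ∑ i, ∫ x, (G i x - f * B i x) ^ 2 ≤ (1 / γ * X) * ((1 + d / γ) * X) :=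
    mul_le_mul hN1 hgr2 hgr0 (by positivity)
  have h6 : (∫ x, b x ^ 2 * (ψ x - f * b x) ^ 2) ^ 2 ≤ (K * X) ^ 2 := by
    rw [mul_pow, hK, Real.sq_sqrt (by positivity)]
    refine hcs.trans ?_
    have h7 := mul_le_mul_of_nonneg_left h5 hC0
    have h8 := mul_le_mul_of_nonneg_left (h4.trans h7) hb.integral_pow_four_pos.le
    refine h8.trans (le_of_eq ?_)
    ring
  have h9 : ∫ x, b x ^ 2 * (ψ x - f * b x) ^ 2 ≤ K * X :=
    (abs_le_of_sq_le_sq' h6 (by positivity)).2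
  have hI0 : 0 ≤ ∫ x, b x ^ 2 * (ψ x - f * b x) ^ 2 := integral_nonneg fun x => by positivity
  calc min γ (1 / (K + 1)) * ∫ x, b x ^ 2 * (ψ x - f * b x) ^ 2
      ≤ 1 / (K + 1) * (K * X) := by
        refine mul_le_mul (min_le_right _ _) h9 hI0 (by positivity)
    _ ≤ X := by
        rw [one_div_mul_eq_div, div_le_iff₀ (by positivity)]
        nlinarith

end Gap

/-! ### Weak derivatives under dilations. -/

section Dilation

variable {E : Type*} [NormedAddCommGroup E] [NormedSpace ℝ E] [FiniteDimensional ℝ E]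
  [MeasureSpace E] [BorelSpace E] [(volume : Measure E).IsAddHaarMeasure]

theorem quasiMeasurePreserving_const_smul {c : ℝ} (hc : c ≠ 0) :
    Measure.QuasiMeasurePreserving (fun x : E => c • x) := by
  refine ⟨measurable_const_smul c, ?_⟩
  rw [Measure.map_addHaar_smul _ hc]
  exact Measure.smul_absolutelyContinuous

theorem MeasureTheory.MemLp.comp_const_smul {f : E → ℝ} (hf : MemLp f 2) {c : ℝ} (hc : c ≠ 0) :
    MemLp (fun x => f (c • x)) 2 := by
  have hm : AEStronglyMeasurable fun x => f (c • x) :=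
    hf.1.comp_quasiMeasurePreserving (quasiMeasurePreserving_const_smul hc)
  rw [memLp_two_iff_integrable_sq hm]
  exact (integrable_comp_smul_iff volume (fun x => f x ^ 2) hc).2 hf.integrable_sq_real

theorem HasWeakDeriv.comp_const_smul {v : E} {f f' : E → ℝ} (h : HasWeakDeriv v f f')
    (hf : MemLp f 2) (hf' : MemLp f' 2) {c : ℝ} (hc : c ≠ 0) :
    HasWeakDeriv v (fun x => f (c • x)) (fun x => c * f' (c • x)) := by
  refine ⟨(hf.comp_const_smul hc).locallyIntegrable_two,
    ((hf'.comp_const_smul hc).const_mul c).locallyIntegrable_two, fun η hη hcs => ?_⟩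
  have hη' : ContDiff ℝ ∞ fun x : E => η (c⁻¹ • x) := hη.comp (contDiff_const_smul _)
  have hcs' : HasCompactSupport fun x : E => η (c⁻¹ • x) :=
    hcs.comp_homeomorph (Homeomorph.smulOfNeZero c⁻¹ (inv_ne_zero hc))
  have hd : ∀ x, fderiv ℝ (fun x : E => η (c⁻¹ • x)) x v = c⁻¹ * fderiv ℝ η (c⁻¹ • x) v := by
    intro x
    rw [fderiv_comp_smul]
    simp
  have key := h.2.2 _ hη' hcs'
  simp only [hd, smul_eq_mul] at key ⊢
  have e1 := Measure.integral_comp_smul volume (fun x => c⁻¹ * fderiv ℝ η (c⁻¹ • x) v * f x) c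
  have e2 := Measure.integral_comp_smul volume (fun x => η (c⁻¹ • x) * f' x) c
  simp only [smul_smul, inv_mul_cancel₀ hc, one_smul] at e1 e2
  rw [key, smul_neg, ← e2] at e1
  have e3 : ∫ x, fderiv ℝ η x v * f (c • x) = c * ∫ x, c⁻¹ * fderiv ℝ η x v * f (c • x) := by
    rw [← integral_const_mul]
    congr 1; ext x; field_simp
  rw [e3, e1, mul_neg, ← integral_const_mul]
  congr 2; ext x; ring

end Dilation

/-! ### Scaling of the transverse problem by `r`. -/

section Scaling

variable {W : Plane → ℝ} {b ψ φ : Plane → ℝ} {G : Fin 2 → Plane → ℝ} {r : ℝ}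

theorem bScaled_inv (hr : 0 < r) (ψ : Plane → ℝ) : bScaled (bScaled ψ (1 / r)) r = ψ := by
  ext x
  simp only [bScaled, smul_smul]
  field_simp
  simp

theorem transScaled_inv (hr : 0 < r) (W : Plane → ℝ) :
    transScaled (transScaled W r) (1 / r) = W := by
  ext x
  simp only [transScaled, smul_smul]
  field_simp
  simp

theorem integral_comp_one_div_smul (hr : 0 < r) (F : Plane → ℝ) :
    ∫ x, F ((1 / r) • x) = r ^ 2 * ∫ x, F x := by
  rw [Measure.integral_comp_smul_of_nonneg _ _ _ (hR := by positivity)]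
  simp

theorem MeasureTheory.MemLp.bScaled (hψ : MemLp ψ 2) (hr : 0 < r) : MemLp (bScaled ψ r) 2 :=
  (hψ.comp_const_smul (by positivity)).const_mul _

theorem integral_bScaled_mul (hr : 0 < r) (ψ φ : Plane → ℝ) :
    ∫ x, bScaled ψ r x * bScaled φ r x = ∫ x, ψ x * φ x := by
  have h := integral_comp_one_div_smul hr fun x => 1 / r * ψ x * (1 / r * φ x)
  simp only [bScaled]
  rw [h, ← integral_const_mul]
  congr 1; ext x; field_simp

theorem integral_bScaled_sq (hr : 0 < r) (ψ : Plane → ℝ) :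
    ∫ x, bScaled ψ r x ^ 2 = ∫ x, ψ x ^ 2 := by
  simp only [sq]
  exact integral_bScaled_mul hr ψ ψ

theorem FormDomain.bScaled (h : FormDomain W ψ G) (hr : 0 < r) :
    FormDomain (transScaled W r) (bScaled ψ r) (fun i x => 1 / r * bScaled (G i) r x) where
  memLp := h.memLp.bScaled hr
  grad i := ((h.grad i).bScaled hr).const_mul _
  weak i := by
    have h1 := ((h.weak i).comp_const_smul h.memLp (h.grad i) (c := 1 / r)
      (by positivity)).const_smul (1 / r)
    exact h1
  pot := by
    have h1 := ((integrable_comp_smul_iff volume (fun x => W x * ψ x ^ 2)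
      (one_div_pos.2 hr).ne').2 h.pot).const_mul (1 / r ^ 4)
    refine h1.congr (Eventually.of_forall fun x => ?_)
    simp only [transScaled, _root_.bScaled]
    field_simp

/-- The quadratic form of `-Δ^⊥ + V^⊥_r - e^⊥ / r²`. -/
noncomputable def excessScaled (W : Plane → ℝ) (r : ℝ) (p : Plane → ℝ) (G : Fin 2 → Plane → ℝ) :
    ℝ :=
  (∑ i, ∫ x, G i x ^ 2) + (∫ x, transScaled W r x * p x ^ 2) - ePerp W / r ^ 2 * ∫ x, p x ^ 2

theorem excessScaled_bScaled (hr : 0 < r) (W ψ : Plane → ℝ) (G : Fin 2 → Plane → ℝ) :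
    excessScaled W r (bScaled ψ r) (fun i x => 1 / r * bScaled (G i) r x)
      = 1 / r ^ 2 * excess W ψ G := by
  have h1 : ∀ i, ∫ x, (1 / r * bScaled (G i) r x) ^ 2 = 1 / r ^ 2 * ∫ x, G i x ^ 2 := fun i => by
    simp only [mul_pow]
    rw [integral_const_mul, integral_bScaled_sq hr, one_div_pow]
  have h2 : ∫ x, transScaled W r x * bScaled ψ r x ^ 2 = 1 / r ^ 2 * ∫ x, W x * ψ x ^ 2 := by
    have h := integral_comp_one_div_smul hr fun x => 1 / r ^ 2 * W x * (1 / r * ψ x) ^ 2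
    simp only [bScaled, transScaled]
    rw [h, ← integral_const_mul, ← integral_const_mul]
    congr 1; ext x; field_simp
  rw [excessScaled, excess, h2, integral_bScaled_sq hr]
  simp only [h1, Fin.sum_univ_two]
  ring

theorem integral_bScaled_pow_four (hr : 0 < r) (b : Plane → ℝ) :
    ∫ x, bScaled b r x ^ 4 = 1 / r ^ 2 * ∫ x, b x ^ 4 := by
  have h := integral_comp_one_div_smul hr fun x => (1 / r * b x) ^ 4
  simp only [bScaled]
  rw [h]
  simp only [mul_pow, integral_const_mul]
  field_simp

theorem IsTransGroundState.integrable_bScaled_pow_four (hb : IsTransGroundState W b) (hr : 0 < r) :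
    Integrable fun x => bScaled b r x ^ 4 := by
  have := ((integrable_comp_smul_iff volume (fun x => b x ^ 4)
    (one_div_pos.2 hr).ne').2 hb.integrable_pow_four).const_mul ((1 / r) ^ 4)
  simpa only [bScaled, mul_pow] using this

theorem coupling_eq (hr : 0 < r) (b : Plane → ℝ) (a : ℝ) :
    coupling b r a = 8 * Real.pi * a * (1 / r ^ 2 * ∫ x, b x ^ 4) := by
  have : ∀ x : ℝ, |x| ^ 4 = x ^ 4 := fun x => by
    rw [show (4 : ℕ) = 2 * 2 from rfl, pow_mul, sq_abs, ← pow_mul]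
  simp only [coupling, this, integral_bScaled_pow_four hr]

theorem IsTransGroundState.exists_grad_scaled (hb : IsTransGroundState W b) (hr : 0 < r) :
    ∃ B, FormDomain (transScaled W r) (bScaled b r) B ∧ excessScaled W r (bScaled b r) B = 0 ∧
      ∫ x, bScaled b r x ^ 2 = 1 := by
  obtain ⟨B, hB, hB0, hn⟩ := hb.exists_grad
  refine ⟨_, hB.bScaled hr, ?_, by rw [integral_bScaled_sq hr, hn]⟩
  rw [excessScaled_bScaled hr, hB0, mul_zero]

/-- Unitary dilation reduces this to `r = 1`. The excess scales like `r⁻²` and the mass is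
invariant, so the mass defect gains the factor `1/r²`; the integral of `b_r² q²` scales like `r⁻²`
as well, so its constant does not depend on `r`. -/
theorem exists_scaled_transverse_bound (hW : IsTransverseTrap W) (hb : IsTransGroundState W b) :
    ∃ κ : ℝ, 0 < κ ∧ ∀ r : ℝ, 0 < r → ∀ (p : Plane → ℝ) (G : Fin 2 → Plane → ℝ),
      FormDomain (transScaled W r) p G →
      κ / r ^ 2 * ((∫ x, p x ^ 2) - (∫ x, bScaled b r x * p x) ^ 2) ≤ excessScaled W r p G ∧
      Integrable (fun x => bScaled b r x ^ 2 *
        (p x - (∫ y, bScaled b r y * p y) * bScaled b r x) ^ 2) ∧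
      κ * ∫ x, bScaled b r x ^ 2 * (p x - (∫ y, bScaled b r y * p y) * bScaled b r x) ^ 2
        ≤ excessScaled W r p G := by
  obtain ⟨κ, hκ, hbd⟩ := exists_transverse_bound hW hb
  refine ⟨κ, hκ, fun r hr p G hp => ?_⟩
  have hr' : 0 < 1 / r := by positivity
  obtain ⟨ψ, hψ⟩ : ∃ ψ, ψ = bScaled p (1 / r) := ⟨_, rfl⟩
  obtain ⟨K, hK⟩ : ∃ K : Fin 2 → Plane → ℝ, K = fun i x => 1 / (1 / r) * bScaled (G i) (1 / r) x :=
    ⟨_, rfl⟩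
  have hpψ : p = bScaled ψ r := by rw [hψ, bScaled_inv hr]
  have hGK : G = fun i x => 1 / r * bScaled (K i) r x := by
    ext i x
    have := congrFun (bScaled_inv hr (G i)) x
    rw [hK, ← this]
    simp only [bScaled]
    field_simp
  have hdom : FormDomain W ψ K := by
    have := hp.bScaled hr'
    rwa [transScaled_inv hr, ← hψ, ← hK] at this
  obtain ⟨h1, h2, h3⟩ := hbd ψ K hdom
  rw [hGK, hpψ, excessScaled_bScaled hr, integral_bScaled_sq hr, integral_bScaled_mul hr]
  set f := ∫ x, b x * ψ x
  have e : ∀ x, bScaled b r x ^ 2 * (bScaled ψ r x - f * bScaled b r x) ^ 2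
      = (1 / r ^ 4) * (b ((1 / r) • x) ^ 2 * (ψ ((1 / r) • x) - f * b ((1 / r) • x)) ^ 2) := by
    intro x
    simp only [bScaled]
    field_simp
  simp only [e]
  have hr2 : 0 < 1 / r ^ 2 := by positivity
  refine ⟨?_, ((integrable_comp_smul_iff volume (fun x => b x ^ 2 * (ψ x - f * b x) ^ 2)
    hr'.ne').2 h2).const_mul _, ?_⟩
  · have := mul_le_mul_of_nonneg_left h1 hr2.le
    refine le_trans (le_of_eq ?_) this
    ring
  · have h4 := integral_comp_one_div_smul hr fun x => b x ^ 2 * (ψ x - f * b x) ^ 2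
    rw [integral_const_mul, h4]
    have := mul_le_mul_of_nonneg_left h3 hr2.le
    generalize ∫ x, b x ^ 2 * (ψ x - f * b x) ^ 2 = I at this ⊢
    refine le_trans (le_of_eq ?_) this
    field_simp

end Scaling

/-! ### Elementary bounds on `|z|^s`, with the box included. -/

section LongitudinalPotential

variable {s : ℝ≥0∞}

theorem longPotScaled_one (s : ℝ≥0∞) (z : ℝ) : longPotScaled s 1 z = longPot s z := by
  simp [longPotScaled]

theorem one_le_longPotScaled {z : ℝ} (hz : 1 < |z|) : 1 ≤ longPotScaled s 1 z := by
  rw [longPotScaled_one, longPot]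
  split_ifs with h1 h2
  · exact absurd hz (not_lt.2 h2)
  · exact le_top
  · exact ENNReal.one_le_ofReal.2 (Real.one_le_rpow hz.le ENNReal.toReal_nonneg)

theorem longPotScaled_le_one {z : ℝ} (hz : |z| ≤ 1) : longPotScaled s 1 z ≤ 1 := by
  rw [longPotScaled_one, longPot]
  split_ifs
  · exact zero_le_one
  · exact ENNReal.ofReal_le_one.2 (Real.rpow_le_one (abs_nonneg z) hz ENNReal.toReal_nonneg)

theorem measurable_longPotScaled (s : ℝ≥0∞) (L : ℝ) : Measurable (longPotScaled s L) := by
  have h : Measurable (longPot s) := by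
    unfold longPot
    split_ifs
    · exact Measurable.ite (measurableSet_le measurable_id.abs measurable_const)
        measurable_const measurable_const
    · exact (measurable_id.abs.pow_const _).ennreal_ofReal
  exact (h.comp (measurable_id.div_const L)).const_mul _

end LongitudinalPotential

/-! ### The one-dimensional Gross-Pitaevskii functional. -/

section GrossPitaevskii

variable {s : ℝ≥0∞} {g : ℝ}

theorem gpEnergy_nonneg (hg : 0 ≤ g) (s : ℝ≥0∞) (L : ℝ) (ρ w : ℝ → ℝ) : 0 ≤ gpEnergy s L g ρ w := by
  have h1 : 0 ≤ ∫ z, w z ^ 2 := integral_nonneg fun z => sq_nonneg _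
  have h2 : 0 ≤ ∫ z, ρ z ^ 2 := integral_nonneg fun z => sq_nonneg _
  have h3 : 0 ≤ (∫⁻ z, longPotScaled s L z * ENNReal.ofReal (ρ z)).toReal := ENNReal.toReal_nonneg
  rw [gpEnergy]
  positivity

theorem bddBelow_gpEnergy (hg : 0 ≤ g) (s : ℝ≥0∞) (N L : ℝ) :
    BddBelow {e | ∃ ρ w : ℝ → ℝ, GPAdmissible s N L ρ w ∧ gpEnergy s L g ρ w = e} := by
  refine ⟨0, ?_⟩
  rintro _ ⟨ρ, w, -, rfl⟩
  exact gpEnergy_nonneg hg _ _ _ _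

theorem lintegral_longPotScaled_const_mul (s : ℝ≥0∞) {c : ℝ} (hc : 0 ≤ c) (F : ℝ → ℝ) :
    ∫⁻ z, longPotScaled s 1 z * ENNReal.ofReal (c * F z)
      = ENNReal.ofReal c * ∫⁻ z, longPotScaled s 1 z * ENNReal.ofReal (F z) := by
  rw [← lintegral_const_mul' _ _ ENNReal.ofReal_ne_top]
  congr 1; ext z
  rw [ENNReal.ofReal_mul hc, mul_left_comm]

theorem gpAdmissible_of_sq {u k : ℝ → ℝ} (hu0 : ∀ᵐ z, 0 ≤ u z) (hu : MemLp u 2) (hk : MemLp k 2)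
    (hd : HasWeakDeriv (1 : ℝ) u k)
    (hV : ∫⁻ z, longPotScaled s 1 z * ENNReal.ofReal (u z ^ 2) ≠ ⊤)
    (h4 : Integrable fun z => u z ^ 4) (hμ : 0 < ∫ z, u z ^ 2) :
    GPAdmissible s 1 1 (fun z => 1 / (∫ z, u z ^ 2) * u z ^ 2)
      (fun z => 1 / √(∫ z, u z ^ 2) * k z) := by
  set μ := ∫ z, u z ^ 2 with hμd
  refine ⟨Eventually.of_forall fun z => by positivity, hu.integrable_sq_real.const_mul _, ?_, ?_,
    hk.const_mul _, ?_, ?_⟩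
  · rw [integral_const_mul, ← hμd, one_div_mul_cancel hμ.ne']
  · refine (hd.const_smul (1 / √μ)).congr_ae ?_ ?_
    · filter_upwards [hu0] with z hz
      rw [Real.sqrt_mul (by positivity), Real.sqrt_sq hz, Real.sqrt_div zero_le_one, Real.sqrt_one]
      rfl
    · exact Eventually.of_forall fun z => rfl
  · rw [lintegral_longPotScaled_const_mul s (by positivity)]
    exact ENNReal.mul_ne_top ENNReal.ofReal_ne_top hV
  · refine (h4.const_mul (1 / μ ^ 2)).congr (Eventually.of_forall fun z => ?_)
    simp only
    ring

/-- Normalizing `u²` to unit mass divides the quadratic terms by the mass `μ` and the quartic term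
by `μ²`. After multiplication by `μ²` the quadratic terms carry a factor `μ ≤ 1`, which is dropped.
The degenerate case `μ = 0` is trivial. -/
theorem sq_mass_mul_EGP_le {u k : ℝ → ℝ} (hg : 0 ≤ g) (hu0 : ∀ᵐ z, 0 ≤ u z) (hu : MemLp u 2)
    (hk : MemLp k 2) (hd : HasWeakDeriv (1 : ℝ) u k)
    (hV : ∫⁻ z, longPotScaled s 1 z * ENNReal.ofReal (u z ^ 2) ≠ ⊤)
    (h4 : Integrable fun z => u z ^ 4) (h1 : ∫ z, u z ^ 2 ≤ 1) :
    (∫ z, u z ^ 2) ^ 2 * EGP s 1 1 g ≤ (∫ z, k z ^ 2)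
      + (∫⁻ z, longPotScaled s 1 z * ENNReal.ofReal (u z ^ 2)).toReal + g / 2 * ∫ z, u z ^ 4 := by
  have hK : 0 ≤ ∫ z, k z ^ 2 := integral_nonneg fun z => sq_nonneg _
  have hQ : 0 ≤ ∫ z, u z ^ 4 := integral_nonneg fun z => by positivity
  have hP : 0 ≤ (∫⁻ z, longPotScaled s 1 z * ENNReal.ofReal (u z ^ 2)).toReal :=
    ENNReal.toReal_nonneg
  have hμ0 : 0 ≤ ∫ z, u z ^ 2 := integral_nonneg fun z => sq_nonneg _
  rcases hμ0.eq_or_lt with hμ | hμ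
  · rw [← hμ]
    simp only [ne_eq, OfNat.ofNat_ne_zero, not_false_eq_true, zero_pow, zero_mul]
    positivity
  · have hadm := gpAdmissible_of_sq hu0 hu hk hd hV h4 hμ
    have hle : EGP s 1 1 g ≤ _ := csInf_le (bddBelow_gpEnergy hg s 1 1) ⟨_, _, hadm, rfl⟩
    set μ := ∫ z, u z ^ 2
    have e : gpEnergy s 1 g (fun z => 1 / μ * u z ^ 2) (fun z => 1 / √μ * k z)
        = 1 / μ * (∫ z, k z ^ 2)
          + 1 / μ * (∫⁻ z, longPotScaled s 1 z * ENNReal.ofReal (u z ^ 2)).toReal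
          + 1 / μ ^ 2 * (g / 2 * ∫ z, u z ^ 4) := by
      rw [gpEnergy, lintegral_longPotScaled_const_mul s (by positivity), ENNReal.toReal_mul,
        ENNReal.toReal_ofReal (by positivity)]
      simp only [mul_pow, integral_const_mul, ← pow_mul, Nat.reduceMul]
      rw [div_pow, Real.sq_sqrt hμ.le]
      ring
    rw [e] at hle
    have hm := mul_le_mul_of_nonneg_left hle (sq_nonneg μ)
    refine hm.trans ?_
    generalize (∫⁻ z, longPotScaled s 1 z * ENNReal.ofReal (u z ^ 2)).toReal = P at hP ⊢
    generalize ∫ z, k z ^ 2 = K at hK ⊢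
    generalize ∫ z, u z ^ 4 = Q at hQ ⊢
    have e2 : μ ^ 2 * (1 / μ * K + 1 / μ * P + 1 / μ ^ 2 * (g / 2 * Q))
        = μ * K + μ * P + g / 2 * Q := by field_simp
    rw [e2]
    have := mul_le_of_le_one_left hK h1
    have := mul_le_of_le_one_left hP h1
    linarith

/-- A bump function supported in `[-1,1]` works for all `s` at once, the box included. Infima over
nonempty sets are needed for the lower bounds on `EGP` and `EGP3D`. -/
theorem exists_gpAdmissible (s : ℝ≥0∞) : ∃ ρ w : ℝ → ℝ, GPAdmissible s 1 1 ρ w := by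
  let φ : ContDiffBump (0 : ℝ) := ⟨1 / 2, 1, by norm_num, by norm_num⟩
  have hφ : ContDiff ℝ ∞ φ := φ.contDiff
  have hc : HasCompactSupport φ := φ.hasCompactSupport
  have m0 := memLp_of_hasCompactSupport hφ.continuous hc
  have m4 : MemLp (fun z => φ z ^ 2) 2 :=
    memLp_of_hasCompactSupport (hφ.continuous.pow 2) (by simp only [sq]; exact hc.mul_right)
  refine ⟨_, _, gpAdmissible_of_sq (u := φ) (Eventually.of_forall fun z => φ.nonneg) m0
    (memLp_of_hasCompactSupport (contDiff_fderiv_apply hφ 1) (hc.fderiv_apply ℝ 1))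
    (hasWeakDeriv_of_contDiff (hφ.of_le (by simp)) 1) ?_ ?_ ?_⟩
  · have h1 : ∫⁻ z, longPotScaled s 1 z * ENNReal.ofReal (φ z ^ 2)
        ≤ ∫⁻ z, ENNReal.ofReal (φ z ^ 2) := by
      refine lintegral_mono fun z => ?_
      by_cases hz : |z| ≤ 1
      · exact mul_le_of_le_one_left' (longPotScaled_le_one hz)
      · have : φ z = 0 := φ.zero_of_le_dist (by simpa [φ] using (not_le.1 hz).le)
        simp [this]
    refine (h1.trans_lt ?_).ne
    exact m0.integrable_sq_real.lintegral_lt_top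
  · simpa only [← pow_mul] using m4.integrable_sq_real
  · refine (integral_nonneg fun z => sq_nonneg _).lt_of_ne fun h => ?_
    have h1 := (integral_eq_zero_iff_of_nonneg (fun z => sq_nonneg _) m0.integrable_sq_real).1 h.symm
    have h2 : (fun z => φ z ^ 2) = 0 := by
      refine (Continuous.ae_eq_iff_eq volume (hφ.continuous.pow 2) continuous_zero).1 h1
    have h3 := congrFun h2 0
    rw [φ.one_of_mem_closedBall (by simp [φ])] at h3
    norm_num at h3

/-- Uncertainty principle: small kinetic energy forces a small supremum of `ρ`, so a fixed part of
the mass lies outside `[-1,1]`, where the potential is at least one. -/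
theorem EGP_pos (hg : 0 ≤ g) (s : ℝ≥0∞) : 0 < EGP s 1 1 g := by
  obtain ⟨ρ₀, w₀, h₀⟩ := exists_gpAdmissible s
  -- Kinetic energy below `1/64` gives `ρ ≤ 2 √(1/64) = 1/4`, hence at most half of the mass in an
  -- interval of length `2`.
  refine lt_of_lt_of_le (by norm_num : (0 : ℝ) < 1 / 64) (le_csInf ⟨_, ρ₀, w₀, h₀, rfl⟩ ?_)
  rintro _ ⟨ρ, w, h, rfl⟩
  have hK : 0 ≤ ∫ z, w z ^ 2 := integral_nonneg fun z => sq_nonneg _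
  have hQ : 0 ≤ 1 / 2 * g * ∫ z, ρ z ^ 2 :=
    mul_nonneg (by positivity) (integral_nonneg fun z => by positivity)
  have hP : 0 ≤ (∫⁻ z, longPotScaled s 1 z * ENNReal.ofReal (ρ z)).toReal :=
    ENNReal.toReal_nonneg
  rw [gpEnergy]
  by_cases hw : 1 / 64 ≤ ∫ z, w z ^ 2
  · linarith
  · have hsq : (fun z => √(ρ z) ^ 2) =ᵐ[volume] ρ := by
      filter_upwards [h.nonneg] with z hz using Real.sq_sqrt hz
    have hm : MemLp (fun z => √(ρ z)) 2 := by
      rw [memLp_two_iff_integrable_sq h.weakDeriv.1.aestronglyMeasurable]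
      exact h.integrable.congr hsq.symm
    have hag := ae_sq_le_of_hasWeakDeriv h.weakDeriv hm h.deriv_memLp
    have hmass : ∫ z, √(ρ z) ^ 2 = 1 := by rw [integral_congr_ae hsq, h.mass]
    have h8 : √(1 / 64) = 1 / 8 := by
      rw [show (1 / 64 : ℝ) = (1 / 8) ^ 2 by norm_num, Real.sqrt_sq (by norm_num)]
    have hb : ∀ᵐ z, ρ z ≤ 1 / 4 := by
      filter_upwards [hag, hsq] with z hz hz'
      rw [hz', hmass, one_mul] at hz
      have := Real.sqrt_le_sqrt (not_le.1 hw).le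
      rw [h8] at this
      linarith
    set S := Set.Icc (-1 : ℝ) 1
    have hin : ∫ z in S, ρ z ≤ 1 / 2 := by
      have h1 : ∫ z in S, ρ z ≤ ∫ z in S, (1 / 4 : ℝ) :=
        setIntegral_mono_ae h.integrable.integrableOn (integrableOn_const (by simp [S])) hb
      refine h1.trans (le_of_eq ?_)
      simp [S]
      norm_num
    have hout : 1 / 2 ≤ ∫ z in Sᶜ, ρ z := by
      have := integral_add_compl (measurableSet_Icc : MeasurableSet S) h.integrable
      rw [h.mass] at this
      linarith
    have hlow : ENNReal.ofReal (∫ z in Sᶜ, ρ z)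
        ≤ ∫⁻ z, longPotScaled s 1 z * ENNReal.ofReal (ρ z) := by
      rw [ofReal_integral_eq_lintegral_ofReal h.integrable.integrableOn
        (ae_restrict_of_ae h.nonneg)]
      refine le_trans (setLIntegral_mono' measurableSet_Icc.compl fun z hz => ?_)
        (setLIntegral_le_lintegral Sᶜ _)
      refine le_mul_of_one_le_left' (one_le_longPotScaled ?_)
      by_contra hcon
      exact hz (abs_le.1 (not_lt.1 hcon))
    have := (ENNReal.ofReal_le_iff_le_toReal h.potential).1 hlow
    linarith

/-- A lower bound for the Gross-Pitaevskii functional with the quartic term linearized where the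
density exceeds `2E/g`. -/
theorem sq_mass_mul_EGP_le_truncated {f h : ℝ → ℝ} (hg : 0 < g) (hf0 : ∀ᵐ z, 0 ≤ f z)
    (hf : MemLp f 2) (hh : MemLp h 2) (hd : HasWeakDeriv (1 : ℝ) f h)
    (hV : ∫⁻ z, longPotScaled s 1 z * ENNReal.ofReal (f z ^ 2) ≠ ⊤) (h1 : ∫ z, f z ^ 2 ≤ 1)
    {t : ℝ → ℝ} (ht : t = fun z => min (f z ^ 2) (2 * EGP s 1 1 g / g)) :
    Integrable (fun z => 2 * f z ^ 2 * t z - t z ^ 2) ∧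
    (∫ z, f z ^ 2) ^ 2 * EGP s 1 1 g ≤ (∫ z, h z ^ 2)
      + (∫⁻ z, longPotScaled s 1 z * ENNReal.ofReal (f z ^ 2)).toReal
      + g / 2 * ∫ z, (2 * f z ^ 2 * t z - t z ^ 2) := by
  have hE := EGP_pos hg.le s
  set E := EGP s 1 1 g
  set M := 2 * E / g with hM
  have hM0 : 0 < M := by positivity
  set m := √M
  have hm2 : m ^ 2 = M := Real.sq_sqrt hM0.le
  have hm0 : 0 < m := Real.sqrt_pos.2 hM0
  -- `u = min f m` is written as `(f + m)/2 - |f - m|/2`, so that its weak derivative `k` comes from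
  -- `norm_sub_const`; pointwise `|k| ≤ |h|`.
  set k : ℝ → ℝ := fun z => 1 / 2 * (1 * h z + 1 * fderiv ℝ (fun _ : ℝ => m) z 1)
    + -(1 / 2) * (inner ℝ (f z - m) (h z) / ‖f z - m‖) with hk
  set u : ℝ → ℝ := fun z => 1 / 2 * (1 * f z + 1 * m) + -(1 / 2) * ‖f z - m‖ with hu
  have hdu : HasWeakDeriv (1 : ℝ) u k :=
    ((hd.comb (hasWeakDeriv_of_contDiff (contDiff_const (c := m)) 1) 1 1).comb
      (hd.norm_sub_const hf hh m) (1 / 2) (-(1 / 2)))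
  have hmin : ∀ z, u z = min (f z) m := fun z => by
    rw [min_def]
    simp only [hu, Real.norm_eq_abs]
    split_ifs with hc
    · rw [abs_of_nonpos (by linarith)]; ring
    · rw [abs_of_nonneg (by linarith)]; ring
  have hkb : ∀ z, k z ^ 2 ≤ h z ^ 2 := fun z => by
    have h2 := abs_inner_div_norm_le (f z - m) (h z)
    rw [Real.norm_eq_abs (h z)] at h2
    refine sq_le_sq.2 ?_
    have h3 : k z = 1 / 2 * h z - 1 / 2 * (inner ℝ (f z - m) (h z) / ‖f z - m‖) := by
      simp only [hk, fderiv_fun_const, Pi.zero_apply, _root_.zero_apply]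
      ring
    rw [h3]
    refine (abs_sub _ _).trans ?_
    rw [abs_mul, abs_mul, abs_of_pos (by norm_num : (0 : ℝ) < 1 / 2)]
    linarith
  have hum : AEStronglyMeasurable u := hdu.1.aestronglyMeasurable
  have hkm : AEStronglyMeasurable k := hdu.2.1.aestronglyMeasurable
  have hu0 : ∀ᵐ z, 0 ≤ u z := by
    filter_upwards [hf0] with z hz
    rw [hmin]; exact le_min hz hm0.le
  have ht0 : ∀ z, 0 ≤ t z := fun z => by rw [ht]; exact le_min (sq_nonneg _) hM0.le
  have htf : ∀ z, t z ≤ f z ^ 2 := fun z => by rw [ht]; exact min_le_left _ _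
  have htM : ∀ z, t z ≤ M := fun z => by rw [ht]; exact min_le_right _ _
  have hut : ∀ᵐ z, u z ^ 2 = t z := by
    filter_upwards [hf0] with z hz
    rw [hmin, ht]
    simp only
    rcases le_total (f z) m with hc | hc
    · rw [min_eq_left hc, min_eq_left (by rw [← hm2]; gcongr)]
    · rw [min_eq_right hc, min_eq_right (by rw [← hm2]; gcongr), hm2]
  have htm : AEStronglyMeasurable t := (hum.pow 2).congr hut
  have hti : Integrable t := hf.integrable_sq_real.mono' htm (Eventually.of_forall fun z => by
    rw [Real.norm_of_nonneg (ht0 z)]; exact htf z)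
  have hti2 : Integrable fun z => t z ^ 2 :=
    (hti.const_mul M).mono' (htm.pow 2) (Eventually.of_forall fun z => by
      rw [Real.norm_of_nonneg (sq_nonneg _), sq]
      exact mul_le_mul_of_nonneg_right (htM z) (ht0 z))
  have hmu : MemLp u 2 := (memLp_two_iff_integrable_sq hum).2
    (hti.congr (hut.mono fun z hz => hz.symm))
  have hmk : MemLp k 2 := (memLp_two_iff_integrable_sq hkm).2
    (hh.integrable_sq_real.mono' (hkm.pow 2) (Eventually.of_forall fun z => by
      rw [Real.norm_of_nonneg (sq_nonneg _)]; exact hkb z))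
  have hu4 : ∀ᵐ z, u z ^ 4 = t z ^ 2 := by
    filter_upwards [hut] with z hz
    rw [← hz]; ring
  have hVle : ∫⁻ z, longPotScaled s 1 z * ENNReal.ofReal (u z ^ 2)
      ≤ ∫⁻ z, longPotScaled s 1 z * ENNReal.ofReal (f z ^ 2) := by
    refine lintegral_mono_ae ?_
    filter_upwards [hut] with z hz
    rw [hz]
    exact mul_le_mul_right (ENNReal.ofReal_le_ofReal (htf z)) _
  have hμe : ∫ z, u z ^ 2 = ∫ z, t z := integral_congr_ae hut
  have hμle : ∫ z, t z ≤ ∫ z, f z ^ 2 := integral_mono hti hf.integrable_sq_real htf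
  have hμ0 : 0 ≤ ∫ z, t z := integral_nonneg ht0
  have hmain := sq_mass_mul_EGP_le (s := s) hg.le hu0 hmu hmk hdu (hVle.trans_lt hV.lt_top).ne
    (hti2.congr (hu4.mono fun z hz => hz.symm)) (by rw [hμe]; exact hμle.trans h1)
  rw [hμe, integral_congr_ae hu4] at hmain
  have hkle : ∫ z, k z ^ 2 ≤ ∫ z, h z ^ 2 :=
    integral_mono hmk.integrable_sq_real hh.integrable_sq_real hkb
  have hVr := ENNReal.toReal_mono hV hVle
  -- Equivalent to `(f² - t)(t - M) = 0`, which holds because `t` is one of the two entries of the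
  -- minimum.
  have hpt : ∀ z, 2 * f z ^ 2 * t z - t z ^ 2 = 1 * t z ^ 2 + 2 * M * f z ^ 2 + -(2 * M) * t z := by
    intro z
    rw [ht]
    simp only
    rcases le_total (f z ^ 2) M with hc | hc
    · rw [min_eq_left hc]; ring
    · rw [min_eq_right hc]; ring
  simp only [hpt]
  refine ⟨integrable_comb_three _ _ _ hti2 hf.integrable_sq_real hti, ?_⟩
  rw [integral_comb_three _ _ _ hti2 hf.integrable_sq_real hti]
  have hgM : g * M = 2 * E := by rw [hM]; field_simp
  set μ := ∫ z, t z
  set l := ∫ z, f z ^ 2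
  -- Since `μ ≤ l ≤ 1`, `l² - μ² ≤ 2 (l - μ)`. The choice `M = 2E/g` makes the linear part of the
  -- quartic term equal to `2E (l - μ)`, exactly what truncation costs.
  have h5 : l ^ 2 * E ≤ μ ^ 2 * E + 2 * E * (l - μ) := by
    have : 0 ≤ E * ((l - μ) * (2 - (l + μ))) :=
      mul_nonneg hE.le (mul_nonneg (by linarith) (by linarith))
    linarith
  have h6 : g / 2 * (1 * (∫ z, t z ^ 2) + 2 * M * l + -(2 * M) * μ)
      = g / 2 * (∫ z, t z ^ 2) + g * M * (l - μ) := by ring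
  rw [h6, hgM]
  linarith

end GrossPitaevskii

/-! ### The product trial function. -/

section UpperBound

variable {W : Plane → ℝ} {b : Plane → ℝ} {s : ℝ≥0∞} {r a : ℝ}

theorem Real.abs_pow_four (x : ℝ) : |x| ^ 4 = x ^ 4 := by
  rw [show (4 : ℕ) = 2 * 2 from rfl, pow_mul, sq_abs, ← pow_mul]

theorem coupling_eq_scaled (b : Plane → ℝ) (r a : ℝ) :
    coupling b r a = 8 * Real.pi * a * ∫ x, bScaled b r x ^ 4 := by
  simp only [coupling, Real.abs_pow_four]

theorem coupling_pos (hb : IsTransGroundState W b) (hr : 0 < r) (ha : 0 < a) :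
    0 < coupling b r a := by
  have := hb.integral_pow_four_pos
  have := Real.pi_pos
  rw [coupling_eq hr]
  positivity

/-- Every integral factorizes for `b_r(x^⊥) √ρ(z)`. Both factors are normalized, `b_r` being a null
vector of the scaled form produces `e^⊥/r²`, and `4πa ∫ b_r⁴ = g/2`, so the energy is given by an
equality. -/
theorem exists_product_trial (hb : IsTransGroundState W b) (hr : 0 < r)
    {ρ w : ℝ → ℝ} (h : GPAdmissible s 1 1 ρ w) :
    ∃ (Φ : Space → ℂ) (G : Fin 2 → Space → ℂ) (H : Space → ℂ),
      GP3DAdmissible W s 1 1 r Φ G H ∧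
      gp3DEnergy W s 1 r a Φ G H = ePerp W / r ^ 2 + gpEnergy s 1 (coupling b r a) ρ w := by
  obtain ⟨B, hB, hB0, hn⟩ := hb.exists_grad_scaled hr
  have i4 := hb.integrable_bScaled_pow_four hr
  have hcoup := coupling_eq_scaled b r a
  set β := bScaled b r
  set u : ℝ → ℝ := fun z => √(ρ z) with hu
  have hsq : ∀ᵐ z, u z ^ 2 = ρ z := by
    filter_upwards [h.nonneg] with z hz using Real.sq_sqrt hz
  have hum : MemLp u 2 := by
    rw [memLp_two_iff_integrable_sq h.weakDeriv.1.aestronglyMeasurable]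
    exact h.integrable.congr (hsq.mono fun z hz => hz.symm)
  have hmass : ∫ z, u z ^ 2 = 1 := by rw [integral_congr_ae hsq, h.mass]
  have hu4 : ∀ᵐ z, u z ^ 4 = ρ z ^ 2 := by
    filter_upwards [hsq] with z hz
    rw [← hz]; ring
  have iu4 : Integrable fun z => u z ^ 4 :=
    h.sq_integrable.congr (hu4.mono fun z hz => hz.symm)
  have hVu : ∫⁻ z, longPotScaled s 1 z * ENNReal.ofReal (u z ^ 2)
      = ∫⁻ z, longPotScaled s 1 z * ENNReal.ofReal (ρ z) :=
    lintegral_congr_ae (hsq.mono fun z hz => by simp only [hz])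
  have hV3 : ∫⁻ x : Space, longPotScaled s 1 x.2 * ENNReal.ofReal (β x.1 ^ 2 * u x.2 ^ 2)
      = ∫⁻ z, longPotScaled s 1 z * ENNReal.ofReal (ρ z) := by
    have e : ∀ x : Space, longPotScaled s 1 x.2 * ENNReal.ofReal (β x.1 ^ 2 * u x.2 ^ 2)
        = ENNReal.ofReal (β x.1 ^ 2) * (longPotScaled s 1 x.2 * ENNReal.ofReal (u x.2 ^ 2)) :=
      fun x => by rw [ENNReal.ofReal_mul (sq_nonneg _), mul_left_comm]
    simp only [e]
    rw [Measure.volume_eq_prod, lintegral_prod_mul (f := fun y => ENNReal.ofReal (β y ^ 2))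
      (g := fun z => longPotScaled s 1 z * ENNReal.ofReal (u z ^ 2))
      (hB.memLp.1.pow 2).aemeasurable.ennreal_ofReal
      ((measurable_longPotScaled s 1).aemeasurable.mul
        (hum.1.pow 2).aemeasurable.ennreal_ofReal), hVu,
      ← ofReal_integral_eq_lintegral_ofReal hB.memLp.integrable_sq_real
        (Eventually.of_forall fun y => sq_nonneg _), hn, ENNReal.ofReal_one, one_mul]
  have hprod : ∀ (F : Plane → ℝ) (K : ℝ → ℝ),
      ∫ x : Space, F x.1 * K x.2 = (∫ y, F y) * ∫ z, K z := fun F K => by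
    rw [Measure.volume_eq_prod, integral_prod_mul]
  have iW : Integrable fun x : Space => transScaled W r x.1 * β x.1 ^ 2 * u x.2 ^ 2 :=
    hB.pot.mul_prod hum.integrable_sq_real
  refine ⟨fun x => ((β x.1 * u x.2 : ℝ) : ℂ), fun i x => ((B i x.1 * u x.2 : ℝ) : ℂ),
    fun x => ((β x.1 * w x.2 : ℝ) : ℂ), ⟨(memLp_two_tensor hB.memLp hum).ofReal, ?_,
    fun i => ((hB.weak i).tensor_left hB.memLp (hB.grad i) hum).ofReal,
    (h.weakDeriv.tensor_right hB.memLp hum h.deriv_memLp).ofReal,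
    fun i => (memLp_two_tensor (hB.grad i) hum).ofReal,
    (memLp_two_tensor hB.memLp h.deriv_memLp).ofReal, ?_, ?_, ?_⟩, ?_⟩
  · simp only [Complex.norm_real, Real.norm_eq_abs, sq_abs, mul_pow]
    rw [hprod (fun y => β y ^ 2) fun z => u z ^ 2, hn, hmass, one_mul]
  · simpa only [Complex.norm_real, Real.norm_eq_abs, sq_abs, mul_pow, mul_assoc] using iW
  · simp only [Complex.norm_real, Real.norm_eq_abs, sq_abs, mul_pow]
    rw [hV3]
    exact h.potential
  · simp only [Complex.norm_real, Real.norm_eq_abs, Real.abs_pow_four, mul_pow]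
    exact i4.mul_prod iu4
  · rw [gp3DEnergy, gpEnergy]
    simp only [Complex.norm_real, Real.norm_eq_abs, Real.abs_pow_four, sq_abs, mul_pow]
    rw [hV3, hprod (fun y => β y ^ 4) fun z => u z ^ 4, integral_congr_ae hu4, hcoup]
    have e1 : ∫ x : Space, ((∑ i, B i x.1 ^ 2 * u x.2 ^ 2) + β x.1 ^ 2 * w x.2 ^ 2)
        = (∑ i, ∫ y, B i y ^ 2) + ∫ z, w z ^ 2 := by
      have i1 : ∀ i, Integrable fun x : Space => B i x.1 ^ 2 * u x.2 ^ 2 := fun i =>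
        (hB.grad i).integrable_sq_real.mul_prod hum.integrable_sq_real
      have i2 : Integrable fun x : Space => β x.1 ^ 2 * w x.2 ^ 2 :=
        hB.memLp.integrable_sq_real.mul_prod h.deriv_memLp.integrable_sq_real
      rw [integral_add (integrable_finsetSum _ fun i _ => i1 i) i2,
        integral_finsetSum _ fun i _ => i1 i,
        hprod (fun y => β y ^ 2) fun z => w z ^ 2, hn, one_mul]
      congr 1
      refine Finset.sum_congr rfl fun i _ => ?_
      rw [hprod (fun y => B i y ^ 2) fun z => u z ^ 2, hmass, mul_one]
    have e2 : ∫ x : Space, transScaled W r x.1 * (β x.1 ^ 2 * u x.2 ^ 2)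
        = ∫ y, transScaled W r y * β y ^ 2 := by
      simp only [← mul_assoc]
      rw [hprod (fun y => transScaled W r y * β y ^ 2) fun z => u z ^ 2, hmass, mul_one]
    rw [e1, e2]
    rw [excessScaled, hn] at hB0
    linarith

end UpperBound

/-- Membership of a real function on `ℝ³` in the form domain of `-Δ^⊥ + W`, where `W` acts on the
transverse variable. -/
structure SpaceFormDomain (W : Plane → ℝ) (P : Space → ℝ) (G : Fin 2 → Space → ℝ) : Prop where
  memLp : MemLp P 2
  grad : ∀ i, MemLp (G i) 2
  weak : ∀ i, HasWeakDeriv ((planeBasis i, 0) : Space) P (G i)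
  pot : Integrable fun x : Space => W x.1 * P x ^ 2

/-! ### Reduction of the three-dimensional energy to transverse slices. -/

section Slices

theorem integrable_integral_slice {F : Space → ℝ} (hF : Integrable F) :
    Integrable fun z => ∫ y, F (y, z) := by
  rw [Measure.volume_eq_prod] at hF
  exact hF.integral_prod_right

theorem integral_integral_slice {F : Space → ℝ} (hF : Integrable F) :
    ∫ z, ∫ y, F (y, z) = ∫ x, F x := by
  rw [Measure.volume_eq_prod] at hF ⊢
  exact (integral_prod_symm _ hF).symm

theorem ae_integrable_slice {F : Space → ℝ} (hF : Integrable F) :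
    ∀ᵐ z, Integrable fun y => F (y, z) := by
  rw [Measure.volume_eq_prod] at hF
  exact hF.prod_left_ae

variable {W : Plane → ℝ} {P : Space → ℝ} {G : Fin 2 → Space → ℝ} {r : ℝ}

theorem SpaceFormDomain.slice (h : SpaceFormDomain W P G) :
    ∀ᵐ z, FormDomain W (fun y => P (y, z)) fun i y => G i (y, z) := by
  filter_upwards [h.memLp.slice, ae_all_iff.2 fun i => (h.grad i).slice,
    ae_all_iff.2 fun i => (h.weak i).slice h.memLp (h.grad i), ae_integrable_slice h.pot]
    with z h1 h2 h3 h4 using ⟨h1, h2, h3, h4⟩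

theorem SpaceFormDomain.integrable_excessScaled (h : SpaceFormDomain (transScaled W r) P G) :
    Integrable fun z => excessScaled W r (fun y => P (y, z)) fun i y => G i (y, z) :=
  ((integrable_finsetSum _ fun i _ =>
    integrable_integral_slice (h.grad i).integrable_sq_real).add
    (integrable_integral_slice h.pot)).sub
    ((integrable_integral_slice h.memLp.integrable_sq_real).const_mul _)

theorem SpaceFormDomain.integral_excessScaled (h : SpaceFormDomain (transScaled W r) P G) :
    ∫ z, excessScaled W r (fun y => P (y, z)) (fun i y => G i (y, z))
      = (∑ i, ∫ x, G i x ^ 2) + (∫ x : Space, transScaled W r x.1 * P x ^ 2)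
        - ePerp W / r ^ 2 * ∫ x, P x ^ 2 := by
  have hG : ∀ i, Integrable fun z => ∫ y, G i (y, z) ^ 2 := fun i =>
    integrable_integral_slice (h.grad i).integrable_sq_real
  have hp : Integrable fun z => ∫ y, transScaled W r y * P (y, z) ^ 2 :=
    integrable_integral_slice h.pot
  have hGp : Integrable fun z => (∑ i, ∫ y, G i (y, z) ^ 2) + ∫ y, transScaled W r y * P (y, z) ^ 2 :=
    (integrable_finsetSum _ fun i _ => hG i).add hp
  have epot := integral_integral_slice h.pot
  have hP := integrable_integral_slice h.memLp.integrable_sq_real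
  simp only [excessScaled]
  rw [integral_sub hGp (hP.const_mul _),
    integral_add (integrable_finsetSum _ fun i _ => hG i) hp,
    integral_finsetSum _ fun i _ => hG i, integral_const_mul,
    epot, integral_integral_slice h.memLp.integrable_sq_real]
  congr 2
  exact Finset.sum_congr rfl fun i _ => integral_integral_slice (h.grad i).integrable_sq_real

/-- The longitudinal potential depends on `z` only, and Cauchy-Schwarz in the transverse variable
bounds the squared overlap by the mass of the slice. -/
theorem lintegral_longPotScaled_projection_le {β : Plane → ℝ} (hβ : MemLp β 2)
    (hn : ∫ y, β y ^ 2 = 1) (hP : MemLp P 2) (s : ℝ≥0∞) :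
    ∫⁻ z, longPotScaled s 1 z * ENNReal.ofReal ((∫ y, β y * P (y, z)) ^ 2)
      ≤ ∫⁻ x : Space, longPotScaled s 1 x.2 * ENNReal.ofReal (P x ^ 2) := by
  have hm : AEMeasurable (fun x : Space => longPotScaled s 1 x.2 * ENNReal.ofReal (P x ^ 2))
      ((volume : Measure Plane).prod volume) :=
    ((measurable_longPotScaled s 1).comp measurable_snd).aemeasurable.mul
      (hP.1.pow 2).aemeasurable.ennreal_ofReal
  rw [Measure.volume_eq_prod, lintegral_prod_symm _ hm]
  refine lintegral_mono_ae ?_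
  filter_upwards [hP.slice] with z hz
  have hmz : AEMeasurable fun y => ENNReal.ofReal (P (y, z) ^ 2) :=
    (hz.1.pow 2).aemeasurable.ennreal_ofReal
  rw [lintegral_const_mul'' _ hmz,
    ← ofReal_integral_eq_lintegral_ofReal hz.integrable_sq_real
      (Eventually.of_forall fun y => sq_nonneg _)]
  refine mul_le_mul_right (ENNReal.ofReal_le_ofReal ?_) _
  simpa [hn] using sq_integral_mul_le hβ hz

/-- A lower bound for the quartic term on a transverse slice by its value on the ground state. -/
theorem integral_pow_four_ge {β p : Plane → ℝ} {f t M η κ Q : ℝ} (hκ : 0 < κ) (hη : 0 < η)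
    (hβ4 : Integrable fun y => β y ^ 4) (hp4 : Integrable fun y => p y ^ 4)
    (hq : Integrable fun y => β y ^ 2 * (p y - f * β y) ^ 2)
    (hQ : κ * ∫ y, β y ^ 2 * (p y - f * β y) ^ 2 ≤ Q)
    (ht0 : 0 ≤ t) (htM : t ≤ M) (htf : t ≤ f ^ 2) :
    (∫ y, β y ^ 4) * ((1 - 2 * η) * (2 * f ^ 2 * t - t ^ 2)) + -(2 * M / (η * κ)) * Q
      ≤ ∫ y, p y ^ 4 := by
  have hB0 : 0 ≤ ∫ y, β y ^ 4 := integral_nonneg fun y => by positivity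
  have hI0 : 0 ≤ ∫ y, β y ^ 2 * (p y - f * β y) ^ 2 := integral_nonneg fun y => by positivity
  have h1 : ∫ y, ((2 * (1 - η) * f ^ 2 * t - t ^ 2) * β y ^ 4
      + -(2 * t / η) * (β y ^ 2 * (p y - f * β y) ^ 2)) ≤ ∫ y, p y ^ 4 := by
    refine integral_mono (integrable_comb_two _ _ hβ4 hq) hp4 fun y => ?_
    simp only
    -- Tangent bound `p⁴ ≥ 2 t β² p² - t² β⁴`. With `q = p - f β`, the cross term in `p²` is then
    -- estimated by `2 f β q ≥ -η f² β² - q²/η`, and the remaining nonnegative `q²` is dropped.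
    have e1 : 0 ≤ (p y ^ 2 - β y ^ 2 * t) ^ 2 := sq_nonneg _
    have e2 : 0 ≤ 2 * t * β y ^ 2 * (1 / η * (η * (f * β y) + (p y - f * β y)) ^ 2) := by positivity
    have e3 : 1 / η * (η * (f * β y) + (p y - f * β y)) ^ 2
        = η * (f * β y) ^ 2 + 2 * (f * β y) * (p y - f * β y)
          + 1 / η * (p y - f * β y) ^ 2 := by field_simp; ring
    rw [e3] at e2
    have e4 : 0 ≤ 2 * t * β y ^ 2 * (p y - f * β y) ^ 2 := by positivity
    have e5 : -(2 * t / η) * (β y ^ 2 * (p y - f * β y) ^ 2)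
        = -(2 * t * β y ^ 2 * (1 / η * (p y - f * β y) ^ 2)) := by ring
    rw [e5]
    linarith
  rw [integral_comb_two _ _ hβ4 hq] at h1
  refine le_trans (add_le_add ?_ ?_) h1
  · rw [mul_comm]
    refine mul_le_mul_of_nonneg_right ?_ hB0
    -- The loss `1 - η` in front of `f² t` alone is traded for a common factor `1 - 2η` in front of
    -- `2 f² t - t²`; the difference is this nonnegative quantity.
    have : 0 ≤ 2 * η * (t * (f ^ 2 - t)) := by
      have := sub_nonneg.2 htf
      positivity
    linarith
  · generalize ∫ y, β y ^ 2 * (p y - f * β y) ^ 2 = I at hQ hI0 ⊢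
    rw [neg_mul, neg_mul, neg_le_neg_iff]
    have hM : 0 ≤ M := ht0.trans htM
    calc 2 * t / η * I ≤ 2 * M / η * I := by gcongr
      _ = 2 * M / (η * κ) * (κ * I) := by field_simp
      _ ≤ 2 * M / (η * κ) * Q := by gcongr

end Slices

/-! ### The lower bound and the comparison of the two energies. -/

section LowerBound

variable {W : Plane → ℝ} {b : Plane → ℝ} {s : ℝ≥0∞}

theorem IsTransGroundState.ae_nonneg_bScaled (hb : IsTransGroundState W b) {r : ℝ} (hr : 0 < r) :
    ∀ᵐ x, 0 ≤ bScaled b r x := by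
  filter_upwards [(quasiMeasurePreserving_const_smul (E := Plane) (one_div_pos.2 hr).ne').ae hb.1]
    with x hx
  exact mul_nonneg (one_div_pos.2 hr).le hx

/-- The lower bound for the three-dimensional functional at nonnegative functions. -/
theorem exists_lower_bound_of_nonneg (hW : IsTransverseTrap W) (hb : IsTransGroundState W b) :
    ∃ κ : ℝ, 0 < κ ∧ ∀ (η r a : ℝ), 0 < η → η ≤ 1 / 2 → 0 < r → 0 < a →
      2 * (r ^ 2 * EGP s 1 1 (coupling b r a)) / ((∫ y, b y ^ 4) * η * κ) ≤ 1 / 2 →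
      2 * (r ^ 2 * EGP s 1 1 (coupling b r a)) / κ ≤ 1 / 2 →
      ∀ (P : Space → ℝ) (G : Fin 2 → Space → ℝ) (H : Space → ℝ), (∀ x, 0 ≤ P x) →
        SpaceFormDomain (transScaled W r) P G → MemLp H 2 →
        HasWeakDeriv ((0, 1) : Space) P H → ∫ x, P x ^ 2 = 1 →
        ∫⁻ x : Space, longPotScaled s 1 x.2 * ENNReal.ofReal (P x ^ 2) ≠ ⊤ →
        Integrable (fun x => P x ^ 4) →
        (1 - 2 * η) * EGP s 1 1 (coupling b r a) ≤
          (∑ i, ∫ x, G i x ^ 2) + (∫ x, H x ^ 2) + (∫ x : Space, transScaled W r x.1 * P x ^ 2)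
            + (∫⁻ x : Space, longPotScaled s 1 x.2 * ENNReal.ofReal (P x ^ 2)).toReal
            + 4 * Real.pi * a * (∫ x, P x ^ 4) - ePerp W / r ^ 2 := by
  obtain ⟨κ, hκ, hbd⟩ := exists_scaled_transverse_bound hW hb
  refine ⟨κ, hκ, fun η r a hη hη2 hr ha hc1 hc2 P G H hP0 hdom hH hdH hn hV hP4 => ?_⟩
  obtain ⟨B, hB, -, hβn⟩ := hb.exists_grad_scaled hr
  have hg := coupling_pos hb hr ha
  have hE := EGP_pos hg.le s
  have hgB := coupling_eq_scaled b r a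
  have hB4 := integral_bScaled_pow_four hr b
  have hβ4 := hb.integrable_bScaled_pow_four hr
  have hb4 := hb.integral_pow_four_pos
  have hβ0 := hb.ae_nonneg_bScaled hr
  have hbd' := hbd r hr
  set g := coupling b r a
  set E := EGP s 1 1 g
  set β := bScaled b r
  set f : ℝ → ℝ := fun z => ∫ y, β y * P (y, z) with hf
  set h : ℝ → ℝ := fun z => ∫ y, β y * H (y, z) with hh
  have mf : MemLp f 2 := memLp_integral_mul_left hB.memLp hdom.memLp
  have mh : MemLp h 2 := memLp_integral_mul_left hB.memLp hH
  have hfh : HasWeakDeriv (1 : ℝ) f h := hdH.integral_mul_left hdom.memLp hH hB.memLp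
  -- Nonnegativity of `P` and `b_r` is used here: `f` must be the square root of the density `f²` in
  -- the one-dimensional functional.
  have hf0 : ∀ᵐ z, 0 ≤ f z := Eventually.of_forall fun z =>
    integral_nonneg_of_ae (hβ0.mono fun y hy => mul_nonneg hy (hP0 _))
  have hh2 : ∫ z, h z ^ 2 ≤ ∫ x, H x ^ 2 := by
    simpa [hβn] using integral_sq_integral_mul_left_le hB.memLp hH
  have hf2 : ∫ z, f z ^ 2 ≤ 1 := by
    simpa [hβn, hn] using integral_sq_integral_mul_left_le hB.memLp hdom.memLp
  have hVf := lintegral_longPotScaled_projection_le hB.memLp hβn hdom.memLp s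
  have hVr := ENNReal.toReal_mono hV hVf
  set M := 2 * E / g with hM
  have hM0 : 0 < M := by positivity
  set t : ℝ → ℝ := fun z => min (f z ^ 2) M with ht
  obtain ⟨hTi, hT⟩ := sq_mass_mul_EGP_le_truncated hg hf0 mf mh hfh
    (hVf.trans_lt hV.lt_top).ne hf2 ht
  set Q : ℝ → ℝ := fun z => excessScaled W r (fun y => P (y, z)) fun i y => G i (y, z)
  have hQi : Integrable Q := hdom.integrable_excessScaled
  have hQX : ∫ z, Q z = _ := hdom.integral_excessScaled
  rw [hn, mul_one] at hQX
  have hP2 := integrable_integral_slice hdom.memLp.integrable_sq_real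
  -- The spectral gap, slice by slice: mass outside the ground state costs at least `κ/r²` per unit.
  have hmass : κ / r ^ 2 * (1 - ∫ z, f z ^ 2) ≤ ∫ z, Q z := by
    rw [← hn, ← integral_integral_slice hdom.memLp.integrable_sq_real,
      ← integral_sub hP2 mf.integrable_sq_real, ← integral_const_mul]
    refine integral_mono_ae ((hP2.sub mf.integrable_sq_real).const_mul _) hQi ?_
    filter_upwards [hdom.slice] with z hz
    exact (hbd' _ _ hz).1
  have hquart : (∫ y, β y ^ 4) * ((1 - 2 * η) * ∫ z, (2 * f z ^ 2 * t z - t z ^ 2))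
      + -(2 * M / (η * κ)) * (∫ z, Q z) ≤ ∫ x, P x ^ 4 := by
    have hi := hTi.const_mul (1 - 2 * η)
    rw [← integral_const_mul, ← integral_comb_two _ _ hi hQi, ← integral_integral_slice hP4]
    refine integral_mono_ae (integrable_comb_two _ _ hi hQi) (integrable_integral_slice hP4) ?_
    filter_upwards [hdom.slice, ae_integrable_slice hP4] with z hz hz4
    obtain ⟨-, h2, h3⟩ := hbd' _ _ hz
    exact integral_pow_four_ge hκ hη hβ4 hz4 h2 h3 (le_min (sq_nonneg _) hM0.le)
      (min_le_right _ _) (min_le_left _ _)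
  have hT0 : 0 ≤ ∫ z, h z ^ 2 := integral_nonneg fun z => sq_nonneg _
  have hVf0 : 0 ≤ (∫⁻ z, longPotScaled s 1 z * ENNReal.ofReal (f z ^ 2)).toReal :=
    ENNReal.toReal_nonneg
  have hl0 : 0 ≤ ∫ z, f z ^ 2 := integral_nonneg fun z => sq_nonneg _
  have hpi : 0 ≤ 4 * Real.pi * a := by have := Real.pi_pos; positivity
  have hX0 : 0 ≤ ∫ z, Q z := le_trans (mul_nonneg (by positivity) (by linarith)) hmass
  have hq2 := mul_le_mul_of_nonneg_left hquart hpi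
  set T := ∫ z, (2 * f z ^ 2 * t z - t z ^ 2)
  set X := ∫ z, Q z
  set l := ∫ z, f z ^ 2
  set Vf := (∫⁻ z, longPotScaled s 1 z * ENNReal.ofReal (f z ^ 2)).toReal
  set c₁ := 2 * (r ^ 2 * E) / ((∫ y, b y ^ 4) * η * κ) with hc₁
  set c₂ := 2 * (r ^ 2 * E) / κ with hc₂
  -- In the error term the factor `a` cancels against the one in `g` inside `M = 2E/g`, and `∫ b_r⁴
  -- = r⁻² ∫ b⁴` leaves the coefficient `c₁`, of order `r² E`.
  have e1 : 4 * Real.pi * a * ((∫ y, β y ^ 4) * ((1 - 2 * η) * T) + -(2 * M / (η * κ)) * X)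
      = (1 - 2 * η) * (g / 2 * T) - c₁ * X := by
    have h1 : 4 * Real.pi * a * (2 * M / (η * κ)) = c₁ := by
      rw [hc₁, hM, hgB, hB4]
      have := Real.pi_pos
      field_simp
      ring
    rw [← h1, hgB]
    ring
  rw [e1] at hq2
  -- From `l² ≥ 1 - 2 (1 - l)` and the bound `1 - l ≤ r² X/κ`.
  have hl2 : (1 - c₂ / E * X) * E ≤ l ^ 2 * E := by
    refine mul_le_mul_of_nonneg_right ?_ hE.le
    have h1 : c₂ / E * X = 2 * (r ^ 2 / κ * X) := by rw [hc₂]; field_simp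
    have h2 : 1 - l ≤ r ^ 2 / κ * X := by
      have := mul_le_mul_of_nonneg_left hmass (by positivity : 0 ≤ r ^ 2 / κ)
      refine le_trans (le_of_eq ?_) this
      field_simp
    have h3 := sq_nonneg (l - 1)
    linarith
  have e2 : (1 - c₂ / E * X) * E = E - c₂ * X := by field_simp
  rw [e2] at hl2
  have hc20 : 0 ≤ c₂ := by positivity
  have hη1 : 0 ≤ 1 - 2 * η := by linarith
  have h1 := mul_le_mul_of_nonneg_left (hl2.trans hT) hη1
  -- Kinetic and potential terms are reduced to the factor `1 - 2η` already carried by the quartic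
  -- term. The errors `c₁ X` and `c₂ X` are each at most `X/2` and are paid by `X`.
  have h2 : 0 ≤ 2 * η * (∫ z, h z ^ 2) + 2 * η * Vf := by positivity
  have h3 : 0 ≤ (1 / 2 - c₁) * X := mul_nonneg (by linarith) hX0
  have h4 : 0 ≤ (1 / 2 - c₂) * X := mul_nonneg (by linarith) hX0
  have h5 : 0 ≤ 2 * η * (c₂ * X) := by positivity
  linarith

/-- The diamagnetic-type inequality `|∇|Φ|| ≤ |∇Φ|`, componentwise. All other terms of the
functional depend on `|Φ|` only. -/
theorem GP3DAdmissible.exists_norm {r : ℝ} {Φ : Space → ℂ} {G : Fin 2 → Space → ℂ}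
    {H : Space → ℂ} (h : GP3DAdmissible W s 1 1 r Φ G H) :
    ∃ (G' : Fin 2 → Space → ℝ) (H' : Space → ℝ),
      SpaceFormDomain (transScaled W r) (fun x => ‖Φ x‖) G' ∧ MemLp H' 2 ∧
      HasWeakDeriv ((0, 1) : Space) (fun x => ‖Φ x‖) H' ∧
      (∑ i, ∫ x, G' i x ^ 2) + (∫ x, H' x ^ 2) ≤ ∫ x, ((∑ i, ‖G i x‖ ^ 2) + ‖H x‖ ^ 2) := by
  have mG := fun i => h.memLp.inner_div_norm (h.gradPerp_memLp i) 0
  have mH := h.memLp.inner_div_norm h.gradZ_memLp 0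
  refine ⟨fun i x => inner ℝ (Φ x - 0) (G i x) / ‖Φ x - 0‖,
    fun x => inner ℝ (Φ x - 0) (H x) / ‖Φ x - 0‖, ⟨h.memLp.norm, mG, fun i => ?_,
    h.potentialPerp⟩, mH, ?_, ?_⟩
  · simpa only [sub_zero] using (h.weakGradPerp i).norm_sub_const h.memLp (h.gradPerp_memLp i) 0
  · simpa only [sub_zero] using h.weakGradZ.norm_sub_const h.memLp h.gradZ_memLp 0
  · have hle : ∀ y z : ℂ, (inner ℝ y z / ‖y‖) ^ 2 ≤ ‖z‖ ^ 2 := fun y z =>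
      sq_le_sq.2 ((abs_inner_div_norm_le y z).trans (le_abs_self _))
    rw [integral_add (integrable_finsetSum _ fun i _ => (h.gradPerp_memLp i).integrable_normSq)
      h.gradZ_memLp.integrable_normSq,
      integral_finsetSum _ fun i _ => (h.gradPerp_memLp i).integrable_normSq]
    refine add_le_add (Finset.sum_le_sum fun i _ => ?_) ?_
    · exact integral_mono (mG i).integrable_sq_real (h.gradPerp_memLp i).integrable_normSq
        fun x => hle _ _
    · exact integral_mono mH.integrable_sq_real h.gradZ_memLp.integrable_normSq fun x => hle _ _

theorem exists_lower_bound (hW : IsTransverseTrap W) (hb : IsTransGroundState W b) (s : ℝ≥0∞) :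
    ∃ κ : ℝ, 0 < κ ∧ ∀ (η r a : ℝ), 0 < η → η ≤ 1 / 2 → 0 < r → 0 < a →
      2 * (r ^ 2 * EGP s 1 1 (coupling b r a)) / ((∫ y, b y ^ 4) * η * κ) ≤ 1 / 2 →
      2 * (r ^ 2 * EGP s 1 1 (coupling b r a)) / κ ≤ 1 / 2 →
      ∀ (Φ : Space → ℂ) (G : Fin 2 → Space → ℂ) (H : Space → ℂ),
        GP3DAdmissible W s 1 1 r Φ G H →
        (1 - 2 * η) * EGP s 1 1 (coupling b r a) + ePerp W / r ^ 2
          ≤ gp3DEnergy W s 1 r a Φ G H := by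
  obtain ⟨κ, hκ, hbd⟩ := exists_lower_bound_of_nonneg (s := s) hW hb
  refine ⟨κ, hκ, fun η r a hη hη2 hr ha hc1 hc2 Φ G H h => ?_⟩
  obtain ⟨G', H', hdom, mH, hdH, hle⟩ := h.exists_norm
  have := hbd η r a hη hη2 hr ha hc1 hc2 _ G' H' (fun x => norm_nonneg _) hdom mH hdH
    h.normalized h.potentialZ h.quartic
  rw [gp3DEnergy]
  linarith

/-- Boundedness below is a hypothesis because comparing an infimum with one of its competitors
requires it; the lower bound, valid for small `r² E`, supplies it. -/
theorem EGP3D_le {r a : ℝ} (hb : IsTransGroundState W b) (hr : 0 < r) (s : ℝ≥0∞)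
    (hbdd : BddBelow {e | ∃ (Φ : Space → ℂ) (G : Fin 2 → Space → ℂ) (H : Space → ℂ),
      GP3DAdmissible W s 1 1 r Φ G H ∧ gp3DEnergy W s 1 r a Φ G H = e}) :
    EGP3D W s 1 1 r a ≤ ePerp W / r ^ 2 + EGP s 1 1 (coupling b r a) := by
  rw [← sub_le_iff_le_add']
  obtain ⟨ρ₀, w₀, h₀⟩ := exists_gpAdmissible s
  refine le_csInf ⟨_, ρ₀, w₀, h₀, rfl⟩ ?_
  rintro _ ⟨ρ, w, h, rfl⟩
  obtain ⟨Φ, G, H, hadm, he⟩ := exists_product_trial (a := a) hb hr h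
  rw [sub_le_iff_le_add', ← he]
  exact csInf_le hbdd ⟨Φ, G, H, hadm, rfl⟩

end LowerBound

theorem theorem2p6 (W : Plane → ℝ) (hW : IsTransverseTrap W) (s : ℝ≥0∞) (hs : 0 < s)
    (b : Plane → ℝ) (hb : IsTransGroundState W b) :
    ∀ ε : ℝ, 0 < ε → ∃ δ : ℝ, 0 < δ ∧ ∀ r a : ℝ, 0 < r → r < δ → 0 < a → a < δ →
      r ^ 2 * EGP s 1 1 (coupling b r a) < δ →
      |(EGP3D W s 1 1 r a - ePerp W / r ^ 2) / EGP s 1 1 (coupling b r a) - 1| < ε := by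
  intro ε hε
  obtain ⟨κ, hκ, hbd⟩ := exists_lower_bound hW hb s
  have hb4 := hb.integral_pow_four_pos
  -- The relative error of the lower bound is `2η ≤ ε/2`. The two entries of `δ` below say precisely
  -- that the error coefficients `c₁` and `c₂` are at most `1/2`.
  set η := min (1 / 2) (ε / 4) with hη
  have hη0 : 0 < η := by positivity
  have hηε : 2 * η < ε := by
    have := min_le_right (1 / 2) (ε / 4)
    linarith
  refine ⟨min ((∫ y, b y ^ 4) * η * κ / 4) (κ / 4), by positivity,
    fun r a hr _ ha _ hδ => ?_⟩
  have hE := EGP_pos (coupling_pos hb hr ha).le s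
  obtain ⟨h1, h2⟩ := lt_min_iff.1 hδ
  have hlow := hbd η r a hη0 (min_le_left _ _) hr ha
    (by rw [div_le_iff₀ (by positivity)]; linarith) (by rw [div_le_iff₀ hκ]; linarith)
  have hbdd : BddBelow {e | ∃ (Φ : Space → ℂ) (G : Fin 2 → Space → ℂ) (H : Space → ℂ),
      GP3DAdmissible W s 1 1 r Φ G H ∧ gp3DEnergy W s 1 r a Φ G H = e} := by
    refine ⟨(1 - 2 * η) * EGP s 1 1 (coupling b r a) + ePerp W / r ^ 2, ?_⟩
    rintro _ ⟨Φ, G, H, h, rfl⟩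
    exact hlow Φ G H h
  have hup := EGP3D_le hb hr s hbdd
  have hlo : (1 - 2 * η) * EGP s 1 1 (coupling b r a) + ePerp W / r ^ 2 ≤ EGP3D W s 1 1 r a := by
    -- A competitor is produced only to make the set of three-dimensional energies nonempty.
    obtain ⟨ρ₀, w₀, h₀⟩ := exists_gpAdmissible s
    obtain ⟨Φ, G, H, hadm, -⟩ := exists_product_trial (a := a) hb hr h₀
    refine le_csInf ⟨_, Φ, G, H, hadm, rfl⟩ ?_
    rintro _ ⟨Φ, G, H, h, rfl⟩
    exact hlow Φ G H h
  set E := EGP s 1 1 (coupling b r a)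
  have e : (EGP3D W s 1 1 r a - ePerp W / r ^ 2) / E - 1
      = (EGP3D W s 1 1 r a - ePerp W / r ^ 2 - E) / E := by field_simp
  rw [e, abs_div, abs_of_pos hE, div_lt_iff₀ hE, abs_lt]
  have h3 := mul_lt_mul_of_pos_right hηε hE
  constructor <;> linarith [mul_pos hε hE]
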